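/- Let $\ell^\infty$ be the Banach space of bounded real sequences $U=\{U_n\}_{n\in\mathbb Z}$ with the supremum norm, let $S$ be the left shift $[SU]_n=U_{n+1}$, write $U\sim V$ if $V=S^pU$ for some $p\in\mathbb Z$, and let $\pi(U,\mu)=([U],\mu)$ be the quotient map onto $\ell^\infty/\langle S\rangle\times\mathbb R$. Consider the steady-state equation of the discrete Nagumo lattice, $$0=d(U_{n+1}+U_{n-1}-2U_n)+U_n(U_n-\mu)(1-U_n),\qquad n\in\mathbb Z. \tag{1}$$ Let $\bar U_n=0$ for $n\le 0$ and $\bar U_n=1$ for $n>0$; let $\bar V_n(\mu)=0$ for $n<0$, $\bar V_0(\mu)=\mu$, and $\bar V_n(\mu)=1$ for $n>0$; and set $$\Gamma_0=\bigcup_{p\in\mathbb Z}\bigcup_{\mu\in[0,1]}\{(S^p\bar U,\mu),(S^p\bar V(\mu),\mu)\}.$$ There exists $d_*>0$ such that for every $0<d<d_*$ there is a smooth curve $\Gamma(d)\subset\ell^\infty\times(0,1)$ (the image of a smooth regular embedding of the real line) with the following properties. 1. Every $(U,\mu)\in\Gamma(d)$ satisfies (1), with $U_n\to0$ as $n\to-\infty$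 and $U_n\to1$ as $n\to+\infty$. 2. $\pi(\Gamma(d))$ is a closed loop: it is the image of $\pi\circ c$ for a smooth curve $c:\mathbb R\to\ell^\infty\times\mathbb R$ with $c'(t)\neq0$ for all $t$ and $\pi(c(s))=\pi(c(t))$ if and only if $t-s\in\mathbb Z$. 3. $\Gamma(d)\to\Gamma_0$ uniformly in the norm of $\ell^\infty\times\mathbb R$ as $d\to0^+$, that is, there are parametrizations by $\mathbb R$ (homeomorphisms onto the curves) of $\Gamma(d)$, for small $d>0$, and of $\Gamma_0$ that converge uniformly on $\mathbb R$ as $d\to0^+$. 4. For each such $d$ there are $0<a<b<1$ and $K>0$ with $a<\mu<b$ and $\|U\|_\infty\le K$ for all $(U,\mu)\in\Gamma(d)$. Moreover, for every $(U,\mu)\in\Gamma(d)$ and every $n\in\mathbb Z$, the unstable manifold of $(0,0)$ and the stable manifold of $(1,1)$ for the planar map $(u,v)\mapsto\bigl(v,\,2v-u-\tfrac1d v(v-\mu)(1-v)\bigr)$ intersect at the point $(U_{n-1},U_n)$ either transversely or in a quadratic tangency. -/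

import Mathlib

open Set Filter Topology
open scoped ContDiff

namespace Nagumo

/-- The Banach space of bounded real sequences indexed by `ℤ`, with the supremum norm. -/
abbrev Linf : Type := lp (fun _ : ℤ => ℝ) ⊤

/-- Build an element of `Linf` from a sequence and a bound. -/
noncomputable def mkLinf (u : ℤ → ℝ) (C : ℝ) (h : ∀ n, |u n| ≤ C) : Linf :=
  ⟨u, memℓp_infty ⟨C, by rintro _ ⟨n, rfl⟩; exact h n⟩⟩

/-- The translate `n ↦ u (n + k)` of a bounded sequence. -/
noncomputable def translate (k : ℤ) (u : Linf) : Linf :=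
  mkLinf (fun n => u (n + k)) ‖u‖ fun n => lp.norm_apply_le_norm (by simp) u (n + k)

/-- The left shift `(S u) n = u (n + 1)`, as a bijection of `Linf`; its integer powers are
`(S ^ p) u`. -/
noncomputable def shift : Equiv.Perm Linf where
  toFun := translate 1
  invFun := translate (-1)
  left_inv u := by ext n; simp [translate, mkLinf]
  right_inv u := by ext n; simp [translate, mkLinf]

theorem shift_apply (u : Linf) (n : ℤ) : shift u n = u (n + 1) := rfl

theorem shift_zpow_apply (p : ℤ) : ∀ (u : Linf) (n : ℤ), (shift ^ p) u n = u (n + p) := by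
  induction p using Int.induction_on with
  | zero => intro u n; simp
  | succ k ih =>
    intro u n
    rw [zpow_add_one, Equiv.Perm.mul_apply, ih, shift_apply]
    exact congrArg (u : ℤ → ℝ) (by ring)
  | pred k ih =>
    intro u n
    rw [zpow_sub_one, Equiv.Perm.mul_apply, ih]
    change u (n + -(k : ℤ) + -1) = _
    exact congrArg (u : ℤ → ℝ) (by ring)

/-- `u ∼ v` if and only if `S ^ p u = v` for some integer `p`. -/
def shiftSetoid : Setoid Linf where
  r u v := ∃ p : ℤ, (shift ^ p) u = v
  iseqv :=
    { refl := fun u => ⟨0, by simp⟩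
      symm := by
        rintro u v ⟨p, rfl⟩
        exact ⟨-p, by rw [← Equiv.Perm.mul_apply, ← zpow_add]; simp⟩
      trans := by
        rintro u v w ⟨p, rfl⟩ ⟨q, rfl⟩
        exact ⟨q + p, by rw [zpow_add, Equiv.Perm.mul_apply]⟩ }

/-- The orbit space `ℓ^∞ / ⟨S⟩`. -/
abbrev ShiftOrbit : Type := Quotient shiftSetoid

/-- The quotient map `π (u, μ) = ([u], μ)`. -/
def orbitMap (w : Linf × ℝ) : ShiftOrbit × ℝ := (Quotient.mk shiftSetoid w.1, w.2)

/-- A smooth curve in `ℓ^∞ × ℝ`: the image of a smooth, regular, topologically embedded real line.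
In particular it is connected and without self-intersections. -/
def IsSmoothCurve (Γ : Set (Linf × ℝ)) : Prop :=
  ∃ c : ℝ → Linf × ℝ,
    ContDiff ℝ ∞ c ∧ (∀ t, deriv c t ≠ 0) ∧ IsEmbedding c ∧ range c = Γ

/-- A (simple, smooth) closed loop in the orbit space: it is traced out by `π ∘ c`, for a smooth
regular curve `c` in `ℓ^∞ × ℝ` such that `π ∘ c` has period one and passes through each of its
points exactly once per period. The restriction to `[0, 1]` is a smooth parametrization of the
loop whose two end points agree. -/
def IsClosedLoop (L : Set (ShiftOrbit × ℝ)) : Prop :=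
  ∃ c : ℝ → Linf × ℝ,
    ContDiff ℝ ∞ c ∧ (∀ t, deriv c t ≠ 0) ∧
    (∀ s t, orbitMap (c s) = orbitMap (c t) ↔ ∃ k : ℤ, t = s + k) ∧
    range (fun t => orbitMap (c t)) = L

/-- Uniform convergence of a family of embedded curves to an embedded curve: there are
parametrizations by the real line (homeomorphisms onto the curves) that converge uniformly in
the norm of `ℓ^∞ × ℝ`. -/
def CurvesTendstoUniformly (Γ : ℝ → Set (Linf × ℝ)) (Γ₀ : Set (Linf × ℝ)) (l : Filter ℝ) : Prop :=
  ∃ (c : ℝ → ℝ → Linf × ℝ) (c₀ : ℝ → Linf × ℝ),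
    (∀ᶠ d in l, IsEmbedding (c d) ∧ range (c d) = Γ d) ∧
    (IsEmbedding c₀ ∧ range c₀ = Γ₀) ∧
    TendstoUniformly c c₀ l

/-- `U` is a steady state of the discrete Nagumo equation with coupling `d` and parameter `μ`. -/
def IsSteadyState (d μ : ℝ) (U : ℤ → ℝ) : Prop :=
  ∀ n : ℤ, 0 = d * (U (n + 1) + U (n - 1) - 2 * U n) + U n * (U n - μ) * (1 - U n)

/-- The singular solution equal to `0` for `n ≤ 0` and to `1` for `n > 0`. -/
noncomputable def Ubar : Linf :=
  mkLinf (fun n => if n ≤ 0 then 0 else 1) 1 fun n => by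
    split_ifs <;> norm_num

/-- The singular solution equal to `0` for `n < 0`, to `μ` for `n = 0` and to `1` for `n > 0`. -/
noncomputable def Vbar (μ : ℝ) : Linf :=
  mkLinf (fun n => if n < 0 then 0 else if n = 0 then μ else 1) (max |μ| 1) fun n => by
    split_ifs <;> simp

/-- The singular curve at `d = 0`. -/
def Gamma0 : Set (Linf × ℝ) :=
  ⋃ p : ℤ, ⋃ μ ∈ Icc (0 : ℝ) 1, {((shift ^ p) Ubar, μ), ((shift ^ p) (Vbar μ), μ)}

/-- The planar map whose orbits `(U (n - 1), U n)` are the steady states. -/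
noncomputable def latticeMap (d μ : ℝ) (q : ℝ × ℝ) : ℝ × ℝ :=
  (q.2, 2 * q.2 - q.1 - 1 / d * (q.2 * (q.2 - μ) * (1 - q.2)))

/-- The unstable manifold of the point `e` for the planar map: the points through which there is
a full orbit that tends to `e` in backward time. -/
def unstableManifold (d μ : ℝ) (e : ℝ × ℝ) : Set (ℝ × ℝ) :=
  {q | ∃ x : ℤ → ℝ × ℝ,
    (∀ n, x (n + 1) = latticeMap d μ (x n)) ∧ x 0 = q ∧ Tendsto x atBot (𝓝 e)}

/-- The stable manifold of the point `e` for the planar map. -/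
def stableManifold (d μ : ℝ) (e : ℝ × ℝ) : Set (ℝ × ℝ) :=
  {q | Tendsto (fun n : ℕ => (latticeMap d μ)^[n] q) atTop (𝓝 e)}

/-- `α` is a smooth regular arc in the plane through `q` at time `0` that runs inside `A`.
When `A` is an (injectively immersed) curve, this is a local parametrization of `A` at `q`. -/
def IsArcThrough (A : Set (ℝ × ℝ)) (q : ℝ × ℝ) (α : ℝ → ℝ × ℝ) : Prop :=
  α 0 = q ∧ deriv α 0 ≠ 0 ∧
    ∃ ε > 0, ContDiffOn ℝ ∞ α (Ioo (-ε) ε) ∧ ∀ t ∈ Ioo (-ε) ε, α t ∈ A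

/-- The curves `A` and `B` intersect transversely at `q`. -/
def IsTransverseAt (A B : Set (ℝ × ℝ)) (q : ℝ × ℝ) : Prop :=
  ∃ α β : ℝ → ℝ × ℝ, IsArcThrough A q α ∧ IsArcThrough B q β ∧
    LinearIndependent ℝ ![deriv α 0, deriv β 0]

/-- The curves `A` and `B` have a quadratic tangency at `q`: with parametrizations that have the
same velocity at `q`, their second derivatives differ in a direction transverse to the common
tangent, so that the order of contact is exactly two. -/
def IsQuadraticTangencyAt (A B : Set (ℝ × ℝ)) (q : ℝ × ℝ) : Prop :=
  ∃ α β : ℝ → ℝ × ℝ, IsArcThrough A q α ∧ IsArcThrough B q β ∧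
    deriv α 0 = deriv β 0 ∧
    LinearIndependent ℝ ![deriv α 0, deriv (deriv α) 0 - deriv (deriv β) 0]

/-- The remaining requirements on a smooth curve `Γ` of heteroclinic orbits from `(0, 0)` to
`(1, 1)`: for a compact parameter interval `[a, b] ⊆ (0, 1)` it lies over the interior
of `[a, b]` and is bounded, and along each of its elements the unstable manifold of `(0, 0)` and
the stable manifold of `(1, 1)` meet transversely or in a quadratic tangency. -/
def IsNondegenerateFamily (d : ℝ) (Γ : Set (Linf × ℝ)) : Prop :=
  (∃ a b : ℝ, 0 < a ∧ a < b ∧ b < 1 ∧ ∀ w ∈ Γ, w.2 ∈ Ioo a b) ∧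
  (∃ K : ℝ, 0 < K ∧ ∀ w ∈ Γ, ‖w.1‖ ≤ K) ∧
  ∀ w ∈ Γ, ∀ n : ℤ,
    IsTransverseAt (unstableManifold d w.2 (0, 0)) (stableManifold d w.2 (1, 1))
      (w.1 (n - 1), w.1 n) ∨
    IsQuadraticTangencyAt (unstableManifold d w.2 (0, 0)) (stableManifold d w.2 (1, 1))
      (w.1 (n - 1), w.1 n)

end Nagumo

/-! For small `d` every profile on the curve, up to a shift, consists of one free value `a = U 0`
between two tails of size `O(d)`. Written as `U n = d * y n`, the left tail solves a fixed point
equation with parameters `(a / μ, d / μ, d)`. It is a contraction while `a / μ` is bounded and `d /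
μ` is small, so the tail is unique and depends smoothly on the parameters (`exists_tail`,
`contDiffAt_tail`). The reflection `U n ↦ 1 - U (-n)`, `μ ↦ 1 - μ` turns left tails into right
tails. What remains is the scalar equation at site `0`, `residual d a μ = 0`, whose left side is `a
(1 - a) (a + d / a - d / (1 - a) - μ)` up to `O(d ^ 2)`. It is strictly decreasing in `μ`, so it
defines an arc `μ = arcParam d a` over `3 d / 2 < a < 1 - 3 d / 2`. Since `a + d / a ≥ 2 √d`, the
parameter stays above `√d`, and symmetrically below `1 - √d`; hence the contraction survives where
the arc folds near `μ = 0` and `μ = 1`.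

The loop closes through the shift. At some `b ≈ 2 d` one has `μ = 1 / 2`, and the profile is
symmetric about the bond between the sites `0` and `1`, so its shift is the arc profile with `a = 1
- b`. Profiles with small tails are determined by `a` (`eq_arc`), so near `b` the shifted arc runs
inside the arc near `1 - b` (`shiftBy_one_arc`), and the shifts of the arc over `[b, 1 - b]` join to
a smooth equivariant curve (`exists_equivariant_extension`). Distinct translates are told apart by
the sizes of their entries, which gives an embedding.

Near `(U 0, U 1)` the unstable and stable manifolds contain graphs over `a` whose difference is
`residual / d` up to sign. A contact of order above two would make the first two `a`-derivatives of
the residual vanish, which the cubic `a (μ - a) (1 - a)` excludes (`residualSnd_ne_zero`). The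
planar map is a diffeomorphism and carries the contact to all other points of the orbit.

For the limit, `w - d / w + d / (1 - w)` is a monotone coordinate along the arc from which both the
profile and `μ` can be read off up to `O(√d)`. It matches the arc with one period of an explicit
parametrization of `Gamma0` (`dist_arc_singularCurve_le`). -/

namespace Nagumo

/-! ### Linear maps and norm bounds on bounded sequences -/

theorem linf_norm_le {u : Linf} {C : ℝ} (hC : 0 ≤ C) (h : ∀ n, |u n| ≤ C) : ‖u‖ ≤ C :=
  lp.norm_le_of_forall_le hC h

theorem abs_coord_le (u : Linf) (n : ℤ) : |u n| ≤ ‖u‖ :=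
  lp.norm_apply_le_norm (by simp) u n

/-- Evaluation at a lattice site. -/
noncomputable def coord (n : ℤ) : Linf →L[ℝ] ℝ :=
  LinearMap.mkContinuous
    { toFun := fun u => u n
      map_add' := fun u v => rfl
      map_smul' := fun a u => rfl } 1 fun u => by
        rw [one_mul]
        exact abs_coord_le u n

/-- Composition of a bounded sequence with a map of the lattice. -/
noncomputable def reindex (σ : ℤ → ℤ) : Linf →L[ℝ] Linf :=
  LinearMap.mkContinuous
    { toFun := fun u => mkLinf (fun n => u (σ n)) ‖u‖ fun n => abs_coord_le u (σ n)
      map_add' := fun u v => rfl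
      map_smul' := fun a u => rfl } 1 fun u => by
        simpa using linf_norm_le (norm_nonneg u) fun n => abs_coord_le u (σ n)

/-- The unit sequence supported at a lattice site. -/
noncomputable def site (k : ℤ) : Linf :=
  mkLinf (fun n => if n = k then 1 else 0) 1 fun n => by split_ifs <;> norm_num

@[simp]
theorem site_apply (k n : ℤ) : site k n = if n = k then 1 else 0 := rfl

/-- The sum of the two neighbours at negative sites, and zero at the other sites. -/
noncomputable def leftNeighbours : Linf →L[ℝ] Linf :=
  LinearMap.mkContinuous
    { toFun := fun u => mkLinf (fun n => if n < 0 then u (n + 1) + u (n - 1) else 0) (2 * ‖u‖)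
        fun n => by
          split_ifs
          · linarith [abs_add_le (u (n + 1)) (u (n - 1)), abs_coord_le u (n + 1),
              abs_coord_le u (n - 1)]
          · simp
      map_add' := fun u v => by
        ext n
        change (if n < 0 then (u (n + 1) + v (n + 1)) + (u (n - 1) + v (n - 1)) else 0 : ℝ) =
          (if n < 0 then u (n + 1) + u (n - 1) else 0) +
            (if n < 0 then v (n + 1) + v (n - 1) else 0)
        split_ifs
        · ring
        · simp
      map_smul' := fun a u => by
        ext n
        change (if n < 0 then a * u (n + 1) + a * u (n - 1) else 0 : ℝ) =
          a * (if n < 0 then u (n + 1) + u (n - 1) else 0)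
        split_ifs
        · ring
        · simp } 2 fun u => by
        refine linf_norm_le (by positivity) fun n => ?_
        change |(if n < 0 then u (n + 1) + u (n - 1) else 0 : ℝ)| ≤ _
        split_ifs
        · linarith [abs_add_le (u (n + 1)) (u (n - 1)), abs_coord_le u (n + 1),
            abs_coord_le u (n - 1)]
        · simp

theorem leftNeighbours_apply (u : Linf) (n : ℤ) :
    leftNeighbours u n = if n < 0 then u (n + 1) + u (n - 1) else 0 := rfl

theorem norm_leftNeighbours_le (u : Linf) : ‖leftNeighbours u‖ ≤ 2 * ‖u‖ :=
  LinearMap.mkContinuous_norm_le _ (by norm_num) _ |> fun h =>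
    (leftNeighbours.le_of_opNorm_le h u)

theorem norm_site_le (k : ℤ) : ‖site k‖ ≤ 1 :=
  linf_norm_le zero_le_one fun n => by simp only [site_apply]; split_ifs <;> norm_num

/-! ### Smoothness of uniquely determined solutions -/

/-- A function that is the only local solution of a smooth equation with invertible partial
derivative is smooth. -/
theorem contDiffAt_of_locally_unique_solution {E F G : Type*}
    [NormedAddCommGroup E] [NormedSpace ℝ E] [CompleteSpace E]
    [NormedAddCommGroup F] [NormedSpace ℝ F] [CompleteSpace F]
    [NormedAddCommGroup G] [NormedSpace ℝ G] [CompleteSpace G]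
    {f : E × F → G} {g : E → F} {x : E} (hf : ContDiffAt ℝ ∞ f (x, g x))
    (hinv : (fderiv ℝ f (x, g x) ∘L .inr ℝ E F).IsInvertible)
    (huniq : ∀ᶠ v in 𝓝 (x, g x), f v = f (x, g x) → v.2 = g v.1) :
    ContDiffAt ℝ ∞ g x := by
  have h0 : (∞ : WithTop ℕ∞) ≠ 0 := by simp
  have hψ := hf.contDiffAt_implicitFunction h0 hinv
  have hself := hf.implicitFunction_apply_self h0 hinv
  have hsol := hf.eventually_apply_implicitFunction h0 hinv
  refine hψ.congr_of_eventuallyEq ?_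
  have hc : Tendsto (fun y => (y, hf.implicitFunction h0 hinv y)) (𝓝 x) (𝓝 (x, g x)) := by
    have := (continuousAt_id.prodMk hψ.continuousAt).tendsto
    simpa [hself] using this
  filter_upwards [hc.eventually huniq, hsol] with y h1 h2
  exact (h1 h2).symm

/-! ### Left tails by contraction -/

/-- The fixed point operator for a left tail. With `U n = d * y n` for `n < 0` and `U 0 = a`, the
steady state equation at the negative sites is `y = tailMap ((a / μ, d / μ, d), y)`. -/
noncomputable def tailMap (v : (ℝ × ℝ × ℝ) × Linf) : Linf :=
  v.1.2.1 • leftNeighbours v.2 + v.1.1 • site (-1) - (2 * v.1.2.1) • v.2 +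
    (v.1.2.1 + v.1.2.2) • (v.2 * v.2) - (v.1.2.1 * v.1.2.2) • (v.2 * v.2 * v.2)

theorem tailMap_apply (q κ d : ℝ) (y : Linf) (n : ℤ) :
    tailMap ((q, κ, d), y) n =
      κ * (if n < 0 then y (n + 1) + y (n - 1) else 0) + q * (if n = -1 then 1 else 0) -
        2 * κ * y n + (κ + d) * (y n * y n) - κ * d * (y n * y n * y n) := rfl

theorem contDiff_tailMap : ContDiff ℝ ∞ tailMap := by
  unfold tailMap
  fun_prop

/-- The parameters for which the tail operator is a contraction. -/
def tailBox : Set (ℝ × ℝ × ℝ) :=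
  {p | |p.1| ≤ 5 ∧ |p.2.1| ≤ 1 / 1000 ∧ |p.2.2| ≤ 1 / 1000}

/-- The difference factors through `y - z`. The four terms contribute 2/1000, 2/1000, 40/1000 and
3/10000, which add up to less than 1/20. -/
theorem norm_tailMap_sub_le {p : ℝ × ℝ × ℝ} (hp : p ∈ tailBox) {y z : Linf}
    (hy : ‖y‖ ≤ 10) (hz : ‖z‖ ≤ 10) :
    ‖tailMap (p, y) - tailMap (p, z)‖ ≤ 1 / 20 * ‖y - z‖ := by
  obtain ⟨q, κ, d⟩ := p
  obtain ⟨-, hκ, hd⟩ := hp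
  simp only at hκ hd
  have h : tailMap ((q, κ, d), y) - tailMap ((q, κ, d), z) =
      κ • leftNeighbours (y - z) - (2 * κ) • (y - z) + (κ + d) • ((y - z) * (y + z)) -
        (κ * d) • ((y - z) * (y * y + y * z + z * z)) := by
    ext n
    simp only [lp.coeFn_sub, Pi.sub_apply, tailMap_apply, lp.coeFn_add, Pi.add_apply,
      lp.coeFn_smul, Pi.smul_apply, smul_eq_mul, leftNeighbours_apply, lp.infty_coeFn_mul,
      Pi.mul_apply]
    split_ifs <;> ring
  have hδ := norm_nonneg (y - z)
  set δ := ‖y - z‖ with hδ'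
  have hs : ‖y + z‖ ≤ 20 := (norm_add_le _ _).trans (by linarith)
  have hm : ∀ u w : Linf, ‖u‖ ≤ 10 → ‖w‖ ≤ 10 → ‖u * w‖ ≤ 100 := fun u w hu hw =>
    (norm_mul_le _ _).trans (by nlinarith [norm_nonneg u, norm_nonneg w])
  have hq : ‖y * y + y * z + z * z‖ ≤ 300 := by
    have := norm_add₃_le (a := y * y) (b := y * z) (c := z * z)
    linarith [hm y y hy hy, hm y z hy hz, hm z z hz hz]
  have h1 : ‖κ • leftNeighbours (y - z)‖ ≤ 1 / 1000 * (2 * δ) := by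
    rw [norm_smul, Real.norm_eq_abs]
    exact mul_le_mul hκ (norm_leftNeighbours_le _) (norm_nonneg _) (by norm_num)
  have h2 : ‖(2 * κ) • (y - z)‖ ≤ 2 / 1000 * δ := by
    rw [norm_smul, Real.norm_eq_abs, abs_mul, abs_two]
    exact mul_le_mul_of_nonneg_right (by linarith) hδ
  have h3 : ‖(κ + d) • ((y - z) * (y + z))‖ ≤ 2 / 1000 * (δ * 20) := by
    rw [norm_smul, Real.norm_eq_abs]
    refine mul_le_mul ((abs_add_le _ _).trans (by linarith)) ?_ (norm_nonneg _) (by norm_num)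
    exact (norm_mul_le _ _).trans (mul_le_mul_of_nonneg_left hs hδ)
  have h4 : ‖(κ * d) • ((y - z) * (y * y + y * z + z * z))‖ ≤ 1 / 1000 * (1 / 1000) * (δ * 300) := by
    rw [norm_smul, Real.norm_eq_abs, abs_mul]
    refine mul_le_mul (mul_le_mul hκ hd (abs_nonneg _) (by norm_num)) ?_ (norm_nonneg _)
      (by norm_num)
    exact (norm_mul_le _ _).trans (mul_le_mul_of_nonneg_left hq hδ)
  rw [h]
  refine (norm_sub_le _ _).trans ?_
  have h5 := norm_add_le (κ • leftNeighbours (y - z) - (2 * κ) • (y - z))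
    ((κ + d) • ((y - z) * (y + z)))
  have h6 := norm_sub_le (κ • leftNeighbours (y - z)) ((2 * κ) • (y - z))
  linarith

/-- The value at `0` has norm at most 5 and the contraction adds at most 10/20. As 6 < 10, fixed
points lie in the interior of the ball, which smooth dependence requires. -/
theorem norm_tailMap_le {p : ℝ × ℝ × ℝ} (hp : p ∈ tailBox) {y : Linf} (hy : ‖y‖ ≤ 10) :
    ‖tailMap (p, y)‖ ≤ 6 := by
  have h := norm_tailMap_sub_le hp hy (z := 0) (by simp)
  have h0 : ‖tailMap (p, 0)‖ ≤ 5 := by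
    have : tailMap (p, 0) = p.1 • site (-1) := by simp [tailMap]
    rw [this, norm_smul, Real.norm_eq_abs]
    exact (mul_le_mul hp.1 (norm_site_le _) (norm_nonneg _) (by norm_num)).trans (by norm_num)
  have h2 := norm_le_norm_sub_add (tailMap (p, y)) (tailMap (p, 0))
  rw [sub_zero] at h
  linarith

theorem exists_tail {p : ℝ × ℝ × ℝ} (hp : p ∈ tailBox) :
    ∃ y : Linf, ‖y‖ ≤ 10 ∧ tailMap (p, y) = y := by
  have hmaps : MapsTo (fun y => tailMap (p, y)) (Metric.closedBall 0 10)
      (Metric.closedBall (0 : Linf) 10) := fun y hy => by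
    rw [mem_closedBall_zero_iff] at hy ⊢
    linarith [norm_tailMap_le hp hy]
  have hcon : ContractingWith (1 / 20) (hmaps.restrict _ _ _) := by
    refine ⟨by rw [div_lt_one] <;> norm_num, LipschitzWith.of_dist_le_mul fun y z => ?_⟩
    have hy := y.2
    have hz := z.2
    rw [mem_closedBall_zero_iff] at hy hz
    have := norm_tailMap_sub_le hp hy hz
    simpa [Subtype.dist_eq, dist_eq_norm] using this
  obtain ⟨y, hy, hfix, -⟩ := hcon.exists_fixedPoint' Metric.isClosed_closedBall.isComplete hmaps
    (x := 0) (by simp) (edist_ne_top _ _)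
  exact ⟨y, mem_closedBall_zero_iff.1 hy, hfix⟩

theorem tail_unique {p : ℝ × ℝ × ℝ} (hp : p ∈ tailBox) {y z : Linf} (hy : ‖y‖ ≤ 10)
    (hz : ‖z‖ ≤ 10) (hfy : tailMap (p, y) = y) (hfz : tailMap (p, z) = z) : y = z := by
  have h := norm_tailMap_sub_le hp hy hz
  rw [hfy, hfz] at h
  exact sub_eq_zero.1 (norm_le_zero_iff.1 (by linarith [norm_nonneg (y - z)]))

open Classical in
/-- The scaled left tail. -/
noncomputable def tail (p : ℝ × ℝ × ℝ) : Linf :=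
  if hp : p ∈ tailBox then (exists_tail hp).choose else 0

theorem norm_tail_le_ten (p : ℝ × ℝ × ℝ) : ‖tail p‖ ≤ 10 := by
  unfold tail
  split_ifs with hp
  · exact (exists_tail hp).choose_spec.1
  · simp

theorem tailMap_tail {p : ℝ × ℝ × ℝ} (hp : p ∈ tailBox) : tailMap (p, tail p) = tail p := by
  rw [tail, dif_pos hp]
  exact (exists_tail hp).choose_spec.2

theorem eq_tail {p : ℝ × ℝ × ℝ} (hp : p ∈ tailBox) {y : Linf} (hy : ‖y‖ ≤ 10)
    (hfy : tailMap (p, y) = y) : y = tail p :=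
  tail_unique hp hy (norm_tail_le_ten p) hfy (tailMap_tail hp)

theorem norm_tail_le {p : ℝ × ℝ × ℝ} (hp : p ∈ tailBox) : ‖tail p‖ ≤ 6 := by
  rw [← tailMap_tail hp]
  exact norm_tailMap_le hp (norm_tail_le_ten p)

theorem abs_tail_le (p : ℝ × ℝ × ℝ) (n : ℤ) : |tail p n| ≤ 10 :=
  (abs_coord_le _ n).trans (norm_tail_le_ten p)

/-- The interior of the box of admissible tail parameters. -/
def openTailBox : Set (ℝ × ℝ × ℝ) :=
  {p | |p.1| < 5 ∧ |p.2.1| < 1 / 1000 ∧ |p.2.2| < 1 / 1000}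

theorem isOpen_openTailBox : IsOpen openTailBox := by
  have h1 : IsOpen {p : ℝ × ℝ × ℝ | |p.1| < 5} := isOpen_lt (by fun_prop) (by fun_prop)
  have h2 : IsOpen {p : ℝ × ℝ × ℝ | |p.2.1| < 1 / 1000} := isOpen_lt (by fun_prop) (by fun_prop)
  have h3 : IsOpen {p : ℝ × ℝ × ℝ | |p.2.2| < 1 / 1000} := isOpen_lt (by fun_prop) (by fun_prop)
  exact h1.inter (h2.inter h3)

theorem openTailBox_subset : openTailBox ⊆ tailBox := fun _ hp =>
  ⟨hp.1.le, hp.2.1.le, hp.2.2.le⟩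

theorem isInvertible_id_sub {E : Type*} [NormedAddCommGroup E] [NormedSpace ℝ E] [CompleteSpace E]
    {L : E →L[ℝ] E} (hL : ‖L‖ < 1) : (ContinuousLinearMap.id ℝ E - L).IsInvertible :=
  ⟨ContinuousLinearEquiv.unitsEquiv ℝ E (Units.oneSub L hL), by ext; rfl⟩

/-- The partial derivative of `y - tailMap (p, y)` is the identity minus an operator of norm at most
1/20, hence invertible. Local uniqueness is uniqueness of the fixed point in the ball of radius 10.
-/
theorem contDiffAt_tail {p : ℝ × ℝ × ℝ} (hp : p ∈ openTailBox) : ContDiffAt ℝ ∞ tail p := by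
  have hf : ContDiff ℝ ∞ fun v : (ℝ × ℝ × ℝ) × Linf => v.2 - tailMap v :=
    contDiff_snd.sub contDiff_tailMap
  have hp' := openTailBox_subset hp
  have hnorm : ∀ᶠ y in 𝓝 (tail p), ‖y‖ < 10 :=
    continuous_norm.continuousAt.eventually_lt_const ((norm_tail_le hp').trans_lt (by norm_num))
  refine contDiffAt_of_locally_unique_solution hf.contDiffAt ?_ ?_
  · have hd : HasFDerivAt tailMap (fderiv ℝ tailMap (p, tail p)) (p, tail p) :=
      (contDiff_tailMap.differentiable (by simp)).differentiableAt.hasFDerivAt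
    have h1 : fderiv ℝ (fun v : (ℝ × ℝ × ℝ) × Linf => v.2 - tailMap v) (p, tail p) =
        .snd ℝ _ _ - fderiv ℝ tailMap (p, tail p) := (hasFDerivAt_snd.sub hd).fderiv
    have h2 : HasFDerivAt (fun y => tailMap (p, y))
        (fderiv ℝ tailMap (p, tail p) ∘L .inr ℝ _ _) (tail p) :=
      hd.comp (tail p) (hasFDerivAt_prodMk_right p (tail p))
    have h3 : ‖fderiv ℝ tailMap (p, tail p) ∘L .inr ℝ (ℝ × ℝ × ℝ) Linf‖ ≤ (1 / 20 : NNReal) := by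
      rw [← h2.fderiv]
      refine norm_fderiv_le_of_lipschitzOn ℝ (s := {y | ‖y‖ < 10}) hnorm
        (LipschitzOnWith.of_dist_le_mul fun y hy z hz => ?_)
      have := norm_tailMap_sub_le hp' (le_of_lt hy) (le_of_lt hz)
      simpa [dist_eq_norm] using this
    rw [h1, ContinuousLinearMap.sub_comp, ContinuousLinearMap.snd_comp_inr]
    exact isInvertible_id_sub (h3.trans_lt (by norm_num))
  · have h1 : ∀ᶠ v : (ℝ × ℝ × ℝ) × Linf in 𝓝 (p, tail p), v.1 ∈ openTailBox :=
      (continuous_fst.tendsto (p, tail p)).eventually (isOpen_openTailBox.mem_nhds hp)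
    have h2 : ∀ᶠ v : (ℝ × ℝ × ℝ) × Linf in 𝓝 (p, tail p), ‖v.2‖ < 10 :=
      (continuous_snd.tendsto (p, tail p)).eventually hnorm
    filter_upwards [h1, h2] with v hv1 hv2 hv
    rw [tailMap_tail hp', sub_self, sub_eq_zero] at hv
    exact eq_tail (openTailBox_subset hv1) hv2.le hv.symm

/-! ### Support and decay of the tail -/

theorem tail_apply_eq {q κ d : ℝ} (hp : (q, κ, d) ∈ tailBox) (n : ℤ) :
    tail (q, κ, d) n =
      κ * (if n < 0 then tail (q, κ, d) (n + 1) + tail (q, κ, d) (n - 1) else 0) +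
        q * (if n = -1 then 1 else 0) -
        2 * κ * tail (q, κ, d) n + (κ + d) * (tail (q, κ, d) n * tail (q, κ, d) n) -
        κ * d * (tail (q, κ, d) n * tail (q, κ, d) n * tail (q, κ, d) n) := by
  conv_lhs => rw [← tailMap_tail hp]
  rw [tailMap_apply]

/-- The equation reads `s = y * (1 + ε)` with `|ε| ≤ 1 / 20`, and 20/19 < 11/10. -/
theorem abs_le_of_perturbed_eq {κ d y s : ℝ} (hκ : |κ| ≤ 1 / 1000) (hd : |d| ≤ 1 / 1000)
    (hy : |y| ≤ 10) (h : y = s - 2 * κ * y + (κ + d) * (y * y) - κ * d * (y * y * y)) :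
    |y| ≤ 11 / 10 * |s| := by
  obtain ⟨hκ1, hκ2⟩ := abs_le.1 hκ
  obtain ⟨hd1, hd2⟩ := abs_le.1 hd
  have h1 : |2 * κ - (κ + d) * y + κ * d * (y * y)| ≤ 1 / 20 := by
    have e1 : |2 * κ| ≤ 2 / 1000 := by rw [abs_mul, abs_two]; linarith
    have e2 : |(κ + d) * y| ≤ 2 / 1000 * 10 := by
      rw [abs_mul]
      exact mul_le_mul ((abs_add_le _ _).trans (by linarith)) hy (abs_nonneg _) (by norm_num)
    have e3 : |κ * d * (y * y)| ≤ 1 / 1000 * (1 / 1000) * (10 * 10) := by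
      rw [abs_mul, abs_mul, abs_mul]
      gcongr
    have := abs_add_le (2 * κ - (κ + d) * y) (κ * d * (y * y))
    have := abs_sub (2 * κ) ((κ + d) * y)
    linarith
  have h2 : s = y * (1 + (2 * κ - (κ + d) * y + κ * d * (y * y))) := by linear_combination -h
  rw [h2, abs_mul]
  have h3 : 19 / 20 ≤ |1 + (2 * κ - (κ + d) * y + κ * d * (y * y))| := by
    refine le_trans ?_ (le_abs_self _)
    linarith [neg_le_of_abs_le h1]
  nlinarith [abs_nonneg y]

/-- At these sites the source in the perturbed equation vanishes, so the entry does too. -/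
theorem tail_apply_of_nonneg {p : ℝ × ℝ × ℝ} (hp : p ∈ tailBox) {n : ℤ} (hn : 0 ≤ n) :
    tail p n = 0 := by
  obtain ⟨q, κ, d⟩ := p
  have h := tail_apply_eq hp n
  rw [if_neg (by omega), if_neg (by omega)] at h
  have := abs_le_of_perturbed_eq hp.2.1 hp.2.2 (abs_tail_le (q, κ, d) n) h
  simpa using this

theorem abs_tail_le_neighbours {q κ d : ℝ} (hp : (q, κ, d) ∈ tailBox) {n : ℤ} (hn : n ≤ -2) :
    |tail (q, κ, d) n| ≤
      11 / 10 * |κ| * |tail (q, κ, d) (n + 1) + tail (q, κ, d) (n - 1)| := by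
  have h := tail_apply_eq hp n
  rw [if_pos (by omega), if_neg (by omega), mul_zero, add_zero] at h
  have := abs_le_of_perturbed_eq hp.2.1 hp.2.2 (abs_tail_le (q, κ, d) n) h
  rwa [abs_mul, ← mul_assoc] at this

/-- Two or more sites away from the centre the scaled entry is far below the lower bound 8/5 for `b
/ d`. This later separates profiles shifted by at least two sites. -/
theorem abs_tail_le_of_le_neg_two {p : ℝ × ℝ × ℝ} (hp : p ∈ tailBox) {n : ℤ} (hn : n ≤ -2) :
    |tail p n| ≤ 1 / 10 := by
  obtain ⟨q, κ, d⟩ := p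
  have h := abs_tail_le_neighbours hp hn
  have h1 := abs_add_le (tail (q, κ, d) (n + 1)) (tail (q, κ, d) (n - 1))
  have h2 := abs_tail_le (q, κ, d) (n + 1)
  have h3 := abs_tail_le (q, κ, d) (n - 1)
  have h4 : |κ| ≤ 1 / 1000 := hp.2.1
  have h5 : |κ| * |tail (q, κ, d) (n + 1) + tail (q, κ, d) (n - 1)| ≤ 1 / 1000 * 20 :=
    mul_le_mul h4 (by linarith) (abs_nonneg _) (by norm_num)
  linarith

/-- Each entry is at most `11 / 10 * |κ|` times the sum of its neighbours, so a bound valid one site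
to the right improves by much more than the factor 1/2 claimed. -/
theorem abs_tail_le_geometric {p : ℝ × ℝ × ℝ} (hp : p ∈ tailBox) (j : ℕ) :
    ∀ n : ℤ, n ≤ -1 - j → |tail p n| ≤ 10 * (1 / 2) ^ j := by
  obtain ⟨q, κ, d⟩ := p
  induction j with
  | zero => intro n _; simpa using abs_tail_le (q, κ, d) n
  | succ j ih =>
    intro n hn
    push_cast at hn
    have h := abs_tail_le_neighbours hp (n := n) (by omega)
    have h1 := abs_add_le (tail (q, κ, d) (n + 1)) (tail (q, κ, d) (n - 1))
    have h2 := ih (n + 1) (by omega)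
    have h3 := ih (n - 1) (by omega)
    have h4 : |κ| ≤ 1 / 1000 := hp.2.1
    have h5 : |κ| * |tail (q, κ, d) (n + 1) + tail (q, κ, d) (n - 1)| ≤
        1 / 1000 * (20 * (1 / 2) ^ j) :=
      mul_le_mul h4 (by linarith) (abs_nonneg _) (by norm_num)
    rw [pow_succ]
    have : (0 : ℝ) < (1 / 2) ^ j := by positivity
    linarith

theorem tendsto_tail_atBot {p : ℝ × ℝ × ℝ} (hp : p ∈ tailBox) :
    Tendsto (fun n : ℤ => tail p n) atBot (𝓝 0) := by
  rw [Metric.tendsto_nhds]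
  intro ε hε
  obtain ⟨j, hj⟩ := exists_pow_lt_of_lt_one (show 0 < ε / 10 by positivity)
    (show (1 / 2 : ℝ) < 1 by norm_num)
  filter_upwards [eventually_le_atBot (-1 - (j : ℤ))] with n hn
  have := abs_tail_le_geometric hp j n hn
  rw [Real.dist_eq, sub_zero]
  linarith

/-! ### Derivatives of the first tail entry -/

/-- The first component of the scaled left tail. -/
noncomputable def tailHead (p : ℝ × ℝ × ℝ) : ℝ := tail p (-1)

theorem contDiffAt_tailHead {p : ℝ × ℝ × ℝ} (hp : p ∈ openTailBox) : ContDiffAt ℝ ∞ tailHead p :=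
  (coord (-1)).contDiff.contDiffAt.comp p (contDiffAt_tail hp)

/-- The derivative of `tailHead` in direction `e`. -/
noncomputable def tailHeadDeriv (e p : ℝ × ℝ × ℝ) : ℝ := fderiv ℝ tailHead p e

/-- The second derivative of `tailHead` in its first variable. -/
noncomputable def tailHeadSnd (p : ℝ × ℝ × ℝ) : ℝ :=
  fderiv ℝ (tailHeadDeriv (1, 0, 0)) p (1, 0, 0)

theorem contDiffAt_tailHeadDeriv (e : ℝ × ℝ × ℝ) {p : ℝ × ℝ × ℝ} (hp : p ∈ openTailBox) :
    ContDiffAt ℝ ∞ (tailHeadDeriv e) p :=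
  ((contDiffAt_tailHead hp).fderiv_right (m := ∞) (by simp)).clm_apply contDiffAt_const

theorem continuousAt_tailHeadSnd {p : ℝ × ℝ × ℝ} (hp : p ∈ openTailBox) :
    ContinuousAt tailHeadSnd p :=
  (((contDiffAt_tailHeadDeriv (1, 0, 0) hp).fderiv_right (m := ∞) (by simp)).clm_apply
    contDiffAt_const).continuousAt

/-- A compact box of tail parameters, on which derivatives are uniformly bounded. -/
def tailCore : Set (ℝ × ℝ × ℝ) :=
  Icc (-4) 4 ×ˢ Icc (-(1 / 2000)) (1 / 2000) ×ˢ Icc (-(1 / 2000)) (1 / 2000)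

theorem tailCore_subset : tailCore ⊆ openTailBox := by
  rintro ⟨q, κ, d⟩ ⟨⟨h1, h2⟩, ⟨h3, h4⟩, ⟨h5, h6⟩⟩
  simp only at h1 h2 h3 h4 h5 h6
  refine ⟨abs_lt.2 ⟨?_, ?_⟩, abs_lt.2 ⟨?_, ?_⟩, abs_lt.2 ⟨?_, ?_⟩⟩ <;> simp only <;> linarith

/-- Taking `d / μ` and `d` as independent parameters of the tail makes these bounds uniform in `d`
and `μ`: compactness of `tailCore` suffices. -/
theorem exists_tailHead_bound : ∃ C : ℝ, 1 ≤ C ∧ ∀ p ∈ tailCore,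
    |tailHeadDeriv (1, 0, 0) p| ≤ C ∧ |tailHeadDeriv (0, 1, 0) p| ≤ C ∧ |tailHeadSnd p| ≤ C := by
  have hK : IsCompact tailCore := isCompact_Icc.prod (isCompact_Icc.prod isCompact_Icc)
  obtain ⟨C₁, h₁⟩ := hK.exists_bound_of_continuousOn (f := tailHeadDeriv (1, 0, 0)) fun p hp =>
    (contDiffAt_tailHeadDeriv _ (tailCore_subset hp)).continuousAt.continuousWithinAt
  obtain ⟨C₂, h₂⟩ := hK.exists_bound_of_continuousOn (f := tailHeadDeriv (0, 1, 0)) fun p hp =>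
    (contDiffAt_tailHeadDeriv _ (tailCore_subset hp)).continuousAt.continuousWithinAt
  obtain ⟨C₃, h₃⟩ := hK.exists_bound_of_continuousOn (f := tailHeadSnd) fun p hp =>
    (continuousAt_tailHeadSnd (tailCore_subset hp)).continuousWithinAt
  refine ⟨max (max 1 C₁) (max C₂ C₃), by simp, fun p hp => ⟨?_, ?_, ?_⟩⟩
  · exact (h₁ p hp).trans (by simp)
  · exact (h₂ p hp).trans (by simp)
  · exact (h₃ p hp).trans (by simp)

/-- A bound for the derivatives of `tailHead` on `tailCore`. -/
noncomputable def tailBound : ℝ := exists_tailHead_bound.choose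

theorem one_le_tailBound : 1 ≤ tailBound := exists_tailHead_bound.choose_spec.1

/-- The parameters of the scaled left tail with boundary value `a`. -/
noncomputable def tailParam (d a μ : ℝ) : ℝ × ℝ × ℝ := (a / μ, d / μ, d)

/-- The first component of the left tail with boundary value `a`. -/
noncomputable def leftHead (d a μ : ℝ) : ℝ := d * tailHead (tailParam d a μ)

/-- The derivative of `leftHead` in the boundary value. -/
noncomputable def leftHeadDeriv (d a μ : ℝ) : ℝ :=
  d / μ * tailHeadDeriv (1, 0, 0) (tailParam d a μ)

/-- The second derivative of `leftHead` in the boundary value. -/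
noncomputable def leftHeadSnd (d a μ : ℝ) : ℝ := d / μ / μ * tailHeadSnd (tailParam d a μ)

/-- The derivative of `leftHead` in the parameter `μ`. -/
noncomputable def leftHeadDerivParam (d a μ : ℝ) : ℝ :=
  d * (-(a / μ ^ 2) * tailHeadDeriv (1, 0, 0) (tailParam d a μ) +
    -(d / μ ^ 2) * tailHeadDeriv (0, 1, 0) (tailParam d a μ))

theorem hasDerivAt_leftHead {d a μ : ℝ} (hp : tailParam d a μ ∈ openTailBox) :
    HasDerivAt (fun x => leftHead d x μ) (leftHeadDeriv d a μ) a := by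
  have h1 := ((contDiffAt_tailHead hp).differentiableAt (by simp)).hasFDerivAt
  have h2 : HasDerivAt (fun x => tailParam d x μ) (1 / μ, 0, 0) a :=
    ((hasDerivAt_id a).div_const μ).prodMk
      ((hasDerivAt_const a (d / μ)).prodMk (hasDerivAt_const a d))
  have h3 := (h1.comp_hasDerivAt a h2).const_mul d
  refine h3.congr_deriv ?_
  have : ((1 / μ, 0, 0) : ℝ × ℝ × ℝ) = (1 / μ) • (1, 0, 0) := by simp
  rw [this, map_smul, leftHeadDeriv, tailHeadDeriv, smul_eq_mul]
  ring

theorem hasDerivAt_leftHeadDeriv {d a μ : ℝ} (hp : tailParam d a μ ∈ openTailBox) :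
    HasDerivAt (fun x => leftHeadDeriv d x μ) (leftHeadSnd d a μ) a := by
  have h1 := ((contDiffAt_tailHeadDeriv (1, 0, 0) hp).differentiableAt (by simp)).hasFDerivAt
  have h2 : HasDerivAt (fun x => tailParam d x μ) (1 / μ, 0, 0) a :=
    ((hasDerivAt_id a).div_const μ).prodMk
      ((hasDerivAt_const a (d / μ)).prodMk (hasDerivAt_const a d))
  have h3 := (h1.comp_hasDerivAt a h2).const_mul (d / μ)
  refine h3.congr_deriv ?_
  have : ((1 / μ, 0, 0) : ℝ × ℝ × ℝ) = (1 / μ) • (1, 0, 0) := by simp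
  rw [this, map_smul, leftHeadSnd, tailHeadSnd, smul_eq_mul]
  ring

theorem hasDerivAt_leftHead_param {d a μ : ℝ} (hμ : μ ≠ 0) (hp : tailParam d a μ ∈ openTailBox) :
    HasDerivAt (fun x => leftHead d a x) (leftHeadDerivParam d a μ) μ := by
  have h1 := ((contDiffAt_tailHead hp).differentiableAt (by simp)).hasFDerivAt
  have hdiv : ∀ b : ℝ, HasDerivAt (fun x => b / x) (-(b / μ ^ 2)) μ := fun b => by
    have := (hasDerivAt_inv hμ).const_mul b
    simp only [← div_eq_mul_inv] at this
    exact this.congr_deriv (by ring)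
  have h2 : HasDerivAt (fun x => tailParam d a x) (-(a / μ ^ 2), -(d / μ ^ 2), 0) μ :=
    (hdiv a).prodMk ((hdiv d).prodMk (hasDerivAt_const μ d))
  have h3 := (h1.comp_hasDerivAt μ h2).const_mul d
  refine h3.congr_deriv ?_
  have : ((-(a / μ ^ 2), -(d / μ ^ 2), 0) : ℝ × ℝ × ℝ) =
      (-(a / μ ^ 2)) • (1, 0, 0) + (-(d / μ ^ 2)) • (0, 1, 0) := by simp
  rw [this, map_add, map_smul, map_smul, leftHeadDerivParam]
  rfl

theorem contDiffAt_tailParam {d a μ : ℝ} (hμ : μ ≠ 0) :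
    ContDiffAt ℝ ∞ (fun v : ℝ × ℝ => tailParam d v.1 v.2) (a, μ) := by
  have h1 : ContDiffAt ℝ ∞ (fun v : ℝ × ℝ => v.1 / v.2) (a, μ) :=
    contDiffAt_fst.div contDiffAt_snd hμ
  have h2 : ContDiffAt ℝ ∞ (fun v : ℝ × ℝ => d / v.2) (a, μ) :=
    contDiffAt_const.div contDiffAt_snd hμ
  exact h1.prodMk (h2.prodMk contDiffAt_const)

theorem contDiffAt_leftHead {d a μ : ℝ} (hμ : μ ≠ 0) (hp : tailParam d a μ ∈ openTailBox) :
    ContDiffAt ℝ ∞ (fun v : ℝ × ℝ => leftHead d v.1 v.2) (a, μ) :=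
  contDiffAt_const.mul (ContDiffAt.comp (f := fun v : ℝ × ℝ => tailParam d v.1 v.2) (a, μ)
    (contDiffAt_tailHead hp) (contDiffAt_tailParam hμ))

/-! ### Uniform estimates for small coupling -/

/-- The smallness requirement on the coupling. -/
def IsSmall (d : ℝ) : Prop := 0 < d ∧ √d * (10 ^ 5 * tailBound) ≤ 1

theorem IsSmall.sqrt_pos {d : ℝ} (hd : IsSmall d) : 0 < √d := Real.sqrt_pos.2 hd.1

theorem IsSmall.sqrt_mul_bound_le {d : ℝ} (hd : IsSmall d) : √d * tailBound ≤ 1 / 10 ^ 5 := by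
  have := hd.2
  rw [le_div_iff₀ (by norm_num)]
  linarith

theorem IsSmall.sqrt_le {d : ℝ} (hd : IsSmall d) : √d ≤ 1 / 10 ^ 5 := by
  have := hd.sqrt_mul_bound_le
  nlinarith [one_le_tailBound, hd.sqrt_pos]

theorem IsSmall.sq_sqrt {d : ℝ} (hd : IsSmall d) : √d * √d = d := Real.mul_self_sqrt hd.1.le

theorem IsSmall.le {d : ℝ} (hd : IsSmall d) : d ≤ 1 / 10 ^ 10 := by
  rw [← hd.sq_sqrt]
  have := hd.sqrt_le
  have := hd.sqrt_pos
  nlinarith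

theorem IsSmall.mul_bound_le {d : ℝ} (hd : IsSmall d) : d * tailBound ≤ 1 / 10 ^ 10 := by
  have h1 := hd.sqrt_le
  have h2 := hd.sqrt_pos
  have h3 := hd.sqrt_mul_bound_le
  calc d * tailBound = √d * (√d * tailBound) := by rw [← mul_assoc, hd.sq_sqrt]
    _ ≤ 1 / 10 ^ 5 * (1 / 10 ^ 5) :=
      mul_le_mul h1 h3 (mul_nonneg h2.le (zero_le_one.trans one_le_tailBound)) (by norm_num)
    _ = _ := by norm_num

/-- The central value `a` and the parameter `μ` for which both tails are under control. -/
def goodRegion (d : ℝ) : Set (ℝ × ℝ) :=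
  {v | 3 / 2 * d < v.1 ∧ v.1 < 1 - 3 / 2 * d ∧ √d ≤ v.2 ∧ √d ≤ 1 - v.2 ∧ v.1 ≤ 4 * v.2 ∧
    1 - v.1 ≤ 4 * (1 - v.2)}

theorem goodRegion_symm {d a μ : ℝ} (h : (a, μ) ∈ goodRegion d) :
    (1 - a, 1 - μ) ∈ goodRegion d := by
  obtain ⟨h1, h2, h3, h4, h5, h6⟩ := h
  simp only at h1 h2 h3 h4 h5 h6
  refine ⟨?_, ?_, ?_, ?_, ?_, ?_⟩ <;> simp only <;> linarith

section GoodRegion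

variable {d a μ : ℝ} (hd : IsSmall d) (h : (a, μ) ∈ goodRegion d)
include hd h

theorem goodRegion_pos : 0 < μ := hd.sqrt_pos.trans_le h.2.2.1

theorem goodRegion_div_le : d / μ ≤ √d := by
  rw [div_le_iff₀ (goodRegion_pos hd h)]
  have := h.2.2.1
  have := hd.sqrt_pos
  simp only at *
  nlinarith [hd.sq_sqrt]

theorem tailParam_mem_core : tailParam d a μ ∈ tailCore := by
  have hμ := goodRegion_pos hd h
  have h1 := goodRegion_div_le hd h
  have h2 := hd.sqrt_le
  have h3 := hd.le
  have h4 : 0 < d / μ := div_pos hd.1 hμ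
  have ha : 0 < a := by have := h.1; have := hd.1; simp only at *; linarith
  have h5 : a / μ ≤ 4 := by rw [div_le_iff₀ hμ]; exact h.2.2.2.2.1
  have h6 : 0 < a / μ := div_pos ha hμ
  have h7 := hd.1
  refine ⟨⟨?_, ?_⟩, ⟨?_, ?_⟩, ⟨?_, ?_⟩⟩ <;> simp only [tailParam] <;> linarith

theorem tailParam_mem_openTailBox : tailParam d a μ ∈ openTailBox :=
  tailCore_subset (tailParam_mem_core hd h)

theorem abs_leftHead_le : |leftHead d a μ| ≤ 6 * d := by
  rw [leftHead, abs_mul, abs_of_pos hd.1, mul_comm]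
  exact mul_le_mul_of_nonneg_right ((abs_coord_le _ _).trans
    (norm_tail_le (openTailBox_subset (tailParam_mem_openTailBox hd h)))) hd.1.le

theorem abs_leftHeadDeriv_le : |leftHeadDeriv d a μ| ≤ 1 / 10 ^ 5 := by
  have h1 := (exists_tailHead_bound.choose_spec.2 _ (tailParam_mem_core hd h)).1
  have h2 := goodRegion_div_le hd h
  rw [leftHeadDeriv, abs_mul, abs_of_pos (div_pos hd.1 (goodRegion_pos hd h))]
  exact (mul_le_mul h2 h1 (abs_nonneg _) hd.sqrt_pos.le).trans hd.sqrt_mul_bound_le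

/-- The second derivative is of order `d / μ ^ 2` and need not be small. The residual contains it
with another factor `d`, which gives `(d / μ) ^ 2 ≤ d`. -/
theorem abs_mul_leftHeadSnd_le : |d * leftHeadSnd d a μ| ≤ 1 / 10 ^ 5 := by
  have h1 := (exists_tailHead_bound.choose_spec.2 _ (tailParam_mem_core hd h)).2.2
  have h2 := goodRegion_div_le hd h
  have h3 := div_pos hd.1 (goodRegion_pos hd h)
  have h4 : d * leftHeadSnd d a μ = (d / μ * (d / μ)) * tailHeadSnd (tailParam d a μ) := by
    rw [leftHeadSnd]
    ring
  have h5 : d / μ * (d / μ) ≤ √d := by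
    have := hd.sqrt_le
    nlinarith
  rw [h4, abs_mul, abs_of_pos (mul_pos h3 h3)]
  exact (mul_le_mul h5 h1 (abs_nonneg _) hd.sqrt_pos.le).trans hd.sqrt_mul_bound_le

theorem abs_mul_leftHeadDerivParam_le :
    |d * leftHeadDerivParam d a μ| ≤ d ^ 2 * (2 * a) * tailBound / μ ^ 2 := by
  obtain ⟨h1, h2, -⟩ := exists_tailHead_bound.choose_spec.2 _ (tailParam_mem_core hd h)
  change _ ≤ tailBound at h1
  change _ ≤ tailBound at h2
  have hμ := goodRegion_pos hd h
  have ha : 3 / 2 * d < a := h.1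
  have hd0 := hd.1
  have e : d * leftHeadDerivParam d a μ =
      d ^ 2 / μ ^ 2 * (-(a * tailHeadDeriv (1, 0, 0) (tailParam d a μ)) -
        d * tailHeadDeriv (0, 1, 0) (tailParam d a μ)) := by
    rw [leftHeadDerivParam]
    ring
  have h3 : |-(a * tailHeadDeriv (1, 0, 0) (tailParam d a μ)) -
        d * tailHeadDeriv (0, 1, 0) (tailParam d a μ)| ≤ 2 * a * tailBound := by
    refine (abs_sub _ _).trans ?_
    rw [abs_neg, abs_mul, abs_mul, abs_of_pos hd0, abs_of_pos (by linarith : 0 < a)]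
    have := one_le_tailBound
    nlinarith
  rw [e, abs_mul, abs_of_pos (by positivity)]
  calc _ ≤ d ^ 2 / μ ^ 2 * (2 * a * tailBound) := mul_le_mul_of_nonneg_left h3 (by positivity)
    _ = _ := by ring

end GoodRegion

/-! ### The scalar equation at the central site -/

/-- The residual of the steady state equation at the central site of the sequence with central
value `a` and the two small tails. -/
noncomputable def residual (d a μ : ℝ) : ℝ :=
  d * (1 - 2 * a + leftHead d a μ - leftHead d (1 - a) (1 - μ)) - a * (μ - a) * (1 - a)

/-- The derivative of `residual` in the central value. -/
noncomputable def residualDeriv (d a μ : ℝ) : ℝ :=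
  d * (-2 + leftHeadDeriv d a μ + leftHeadDeriv d (1 - a) (1 - μ)) -
    (μ - 2 * a - 2 * a * μ + 3 * a ^ 2)

/-- The second derivative of `residual` in the central value. -/
noncomputable def residualSnd (d a μ : ℝ) : ℝ :=
  d * (leftHeadSnd d a μ - leftHeadSnd d (1 - a) (1 - μ)) + (2 + 2 * μ - 6 * a)

/-- The derivative of `residual` in the parameter `μ`. -/
noncomputable def residualDerivParam (d a μ : ℝ) : ℝ :=
  d * (leftHeadDerivParam d a μ + leftHeadDerivParam d (1 - a) (1 - μ)) - a * (1 - a)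

/-- The reflection `U n ↦ 1 - U (-n)` exchanges the two tails. Because of it, several estimates need
a proof for `a ≤ 1 / 2` only. -/
theorem residual_symm (d a μ : ℝ) : residual d (1 - a) (1 - μ) = -residual d a μ := by
  simp only [residual, sub_sub_cancel]
  ring

theorem residualDerivParam_symm (d a μ : ℝ) :
    residualDerivParam d (1 - a) (1 - μ) = residualDerivParam d a μ := by
  simp only [residualDerivParam, sub_sub_cancel]
  ring

theorem hasDerivAt_residual {d a μ : ℝ} (h1 : tailParam d a μ ∈ openTailBox)
    (h2 : tailParam d (1 - a) (1 - μ) ∈ openTailBox) :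
    HasDerivAt (fun x => residual d x μ) (residualDeriv d a μ) a := by
  have hs : HasDerivAt (fun x : ℝ => 1 - x) (-1) a := by
    simpa using (hasDerivAt_id a).const_sub 1
  have e1 := hasDerivAt_leftHead h1
  have e2 := HasDerivAt.comp a (hasDerivAt_leftHead h2) hs
  have e3 := ((hasDerivAt_id a).mul ((hasDerivAt_id a).const_sub μ)).mul hs
  have e4 := ((((((hasDerivAt_id a).const_mul 2).const_sub 1).add e1).sub e2).const_mul d).sub e3
  refine e4.congr_deriv ?_
  simp only [residualDeriv, id, Pi.mul_apply]
  ring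

theorem hasDerivAt_residualDeriv {d a μ : ℝ} (h1 : tailParam d a μ ∈ openTailBox)
    (h2 : tailParam d (1 - a) (1 - μ) ∈ openTailBox) :
    HasDerivAt (fun x => residualDeriv d x μ) (residualSnd d a μ) a := by
  have hs : HasDerivAt (fun x : ℝ => 1 - x) (-1) a := by
    simpa using (hasDerivAt_id a).const_sub 1
  have e1 := hasDerivAt_leftHeadDeriv h1
  have e2 := HasDerivAt.comp a (hasDerivAt_leftHeadDeriv h2) hs
  have e3 := ((((hasDerivAt_id a).const_mul 2).const_sub μ).sub
    (((hasDerivAt_id a).const_mul 2).mul_const μ)).add (((hasDerivAt_id a).pow 2).const_mul 3)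
  have e4 := (((e1.const_add (-2)).add e2).const_mul d).sub e3
  refine e4.congr_deriv ?_
  simp only [residualSnd, id]
  ring

theorem hasDerivAt_residual_param {d a μ : ℝ} (hμ : μ ≠ 0) (hμ' : 1 - μ ≠ 0)
    (h1 : tailParam d a μ ∈ openTailBox) (h2 : tailParam d (1 - a) (1 - μ) ∈ openTailBox) :
    HasDerivAt (fun x => residual d a x) (residualDerivParam d a μ) μ := by
  have hs : HasDerivAt (fun x : ℝ => 1 - x) (-1) μ := by
    simpa using (hasDerivAt_id μ).const_sub 1
  have e1 := hasDerivAt_leftHead_param hμ h1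
  have e2 := HasDerivAt.comp μ (hasDerivAt_leftHead_param hμ' h2) hs
  have e3 := (((hasDerivAt_id μ).sub_const a).const_mul a).mul_const (1 - a)
  have e4 := (((e1.const_add (1 - 2 * a)).sub e2).const_mul d).sub e3
  refine e4.congr_deriv ?_
  simp only [residualDerivParam]
  ring

theorem contDiffAt_residual {d a μ : ℝ} (hμ : μ ≠ 0) (hμ' : 1 - μ ≠ 0)
    (h1 : tailParam d a μ ∈ openTailBox) (h2 : tailParam d (1 - a) (1 - μ) ∈ openTailBox) :
    ContDiffAt ℝ ∞ (fun v : ℝ × ℝ => residual d v.1 v.2) (a, μ) := by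
  have e1 := contDiffAt_leftHead hμ h1
  have e2 : ContDiffAt ℝ ∞ (fun v : ℝ × ℝ => leftHead d (1 - v.1) (1 - v.2)) (a, μ) :=
    ContDiffAt.comp (f := fun v : ℝ × ℝ => (1 - v.1, 1 - v.2)) (a, μ)
      (contDiffAt_leftHead hμ' h2) (by fun_prop)
  unfold residual
  fun_prop

/-! ### Leading order, signs and nondegeneracy of the residual -/

/-- The leading order parameter of the steady state with central value `a`. -/
noncomputable def leadingParam (d a : ℝ) : ℝ := a + d / a - d / (1 - a)

theorem leadingParam_symm (d a : ℝ) : leadingParam d (1 - a) = 1 - leadingParam d a := by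
  simp only [leadingParam, sub_sub_cancel]
  ring

/-- For `a ≤ 1 / 2`, the inequality `a + d / a ≥ 2 √d` absorbs all errors of order `d`. For `a ≥ 1 /
2` the only danger is `d / (1 - a)`, which the bound on `1 - a` keeps below about 2/3, so that `μ`
is at least about 1/3. -/
theorem param_lower_bounds {d a μ : ℝ} (hd : IsSmall d) (h1 : 3 / 2 * d < a)
    (h2 : a < 1 - 3 / 2 * d) (h3 : leadingParam d a - 30 * d ≤ μ) : √d ≤ μ ∧ a ≤ 4 * μ := by
  have hd0 := hd.1
  have hs := hd.sqrt_pos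
  have hs1 := hd.sqrt_le
  have hsq := hd.sq_sqrt
  have hle := hd.le
  have hds : d ≤ 1 / 10 ^ 5 * √d := by nlinarith
  unfold leadingParam at h3
  have ha : 0 < a := by linarith
  rcases le_total a (1 / 2) with ha2 | ha2
  · have e1 : d / (1 - a) ≤ 2 * d := by
      rw [div_le_iff₀ (by linarith)]
      nlinarith
    have e2 : a * (d / a) = d := by field_simp
    have e3 : 0 < d / a := by positivity
    have e4 : 2 * √d ≤ a + d / a := by
      refine abs_le_of_sq_le_sq' ?_ (by positivity) |>.2
      nlinarith [sq_nonneg (a - d / a)]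
    constructor <;> linarith
  · have hb : 0 < 1 - a := by linarith
    have e1 : 0 < d / a := by positivity
    have e2 : d / (1 - a) ≤ (1 / 2 + 3 / 2 * d + 1 / 6) - (1 - a) := by
      rw [div_le_iff₀ hb]
      nlinarith [mul_nonneg (by linarith : 0 ≤ (1 - a) - 3 / 2 * d) (by linarith : 0 ≤ a - 1 / 2)]
    constructor <;> linarith

theorem mem_goodRegion_of_near {d a μ : ℝ} (hd : IsSmall d) (h1 : 3 / 2 * d < a)
    (h2 : a < 1 - 3 / 2 * d) (h3 : |μ - leadingParam d a| ≤ 30 * d) : (a, μ) ∈ goodRegion d := by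
  obtain ⟨h4, h5⟩ := abs_le.1 h3
  obtain ⟨e1, e2⟩ := param_lower_bounds (μ := μ) hd h1 h2 (by linarith)
  obtain ⟨e3, e4⟩ := param_lower_bounds (a := 1 - a) (μ := 1 - μ) hd (by linarith) (by linarith)
    (by rw [leadingParam_symm]; linarith)
  exact ⟨h1, h2, e1, e3, e2, e4⟩

theorem residual_eq {d a μ : ℝ} (ha : a ≠ 0) (ha' : 1 - a ≠ 0) :
    residual d a μ = a * (1 - a) * (leadingParam d a - μ) +
      d * (leftHead d a μ - leftHead d (1 - a) (1 - μ)) := by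
  have : d * (1 - 2 * a) = a * (1 - a) * (d / a - d / (1 - a)) := by field_simp; ring
  rw [residual, leadingParam]
  linear_combination this

theorem mul_one_sub_lower {d a : ℝ} (hd : IsSmall d) (h1 : 3 / 2 * d < a)
    (h2 : a < 1 - 3 / 2 * d) : 4 / 3 * d ≤ a * (1 - a) := by
  have hd0 := hd.1
  have hle := hd.le
  nlinarith [mul_pos (sub_pos.2 h1) (sub_pos.2 h2)]

section GoodRegion

variable {d a μ : ℝ} (hd : IsSmall d) (h : (a, μ) ∈ goodRegion d)
include hd h

theorem abs_residual_sub_le :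
    |d * (leftHead d a μ - leftHead d (1 - a) (1 - μ))| ≤ 12 * d * d := by
  have e1 := abs_leftHead_le hd h
  have e2 := abs_leftHead_le hd (goodRegion_symm h)
  rw [abs_mul, abs_of_pos hd.1]
  have := abs_sub (leftHead d a μ) (leftHead d (1 - a) (1 - μ))
  nlinarith [hd.1]

/-- At a zero, `a (1 - a) |μ - leadingParam d a|` is at most `12 d ^ 2`, and `a (1 - a)` is at least
`4 d / 3`; the quotient is `9 d`. -/
theorem abs_sub_leadingParam_le (h0 : residual d a μ = 0) : |μ - leadingParam d a| ≤ 9 * d := by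
  have h1 : 3 / 2 * d < a := h.1
  have h2 : a < 1 - 3 / 2 * d := h.2.1
  have hd0 := hd.1
  rw [residual_eq (by linarith) (by linarith)] at h0
  have e1 := abs_residual_sub_le hd h
  have e2 := mul_one_sub_lower hd h1 h2
  have e3 : a * (1 - a) * (μ - leadingParam d a) =
      d * (leftHead d a μ - leftHead d (1 - a) (1 - μ)) := by linarith
  rw [← e3, abs_mul, abs_of_pos (by linarith)] at e1
  by_contra! hc
  nlinarith

theorem abs_mul_leftHeadDerivParam_le_left :
    |d * leftHeadDerivParam d a μ| ≤ 1 / 10 ^ 9 * a := by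
  have h1 : 3 / 2 * d < a := h.1
  have h3 : √d ≤ μ := h.2.2.1
  have hμ : 0 < μ := goodRegion_pos hd h
  have hd0 := hd.1
  refine (abs_mul_leftHeadDerivParam_le hd h).trans ?_
  rw [div_le_iff₀ (by positivity)]
  have e1 : d ≤ μ ^ 2 := by rw [← hd.sq_sqrt, sq]; gcongr
  have e2 := hd.mul_bound_le
  calc d ^ 2 * (2 * a) * tailBound = 2 * a * (d * tailBound) * d := by ring
    _ ≤ 2 * a * (1 / 10 ^ 10) * μ ^ 2 := by
      refine mul_le_mul (mul_le_mul_of_nonneg_left e2 (by linarith)) e1 hd0.le (by linarith)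
    _ ≤ _ := by
      have := mul_pos (by linarith : 0 < a) (by positivity : 0 < μ ^ 2)
      linarith

/-- The main term is at most `-a / 2`. The left tail contributes a tiny multiple of `a` because `d ≤
μ ^ 2`; the right tail does so because `1 - μ ≥ 1 / 8` and `d < a`. -/
theorem residualDerivParam_neg_of_le (ha : a ≤ 1 / 2) : residualDerivParam d a μ < 0 := by
  have h1 : 3 / 2 * d < a := h.1
  have h6 : 1 - a ≤ 4 * (1 - μ) := h.2.2.2.2.2
  have hd0 := hd.1
  have e1 := abs_mul_leftHeadDerivParam_le_left hd h
  have e2 := abs_mul_leftHeadDerivParam_le hd (goodRegion_symm h)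
  have e3 : d ^ 2 * (2 * (1 - a)) * tailBound / (1 - μ) ^ 2 ≤ 1 / 10 ^ 7 * a := by
    have hν : 1 / 8 ≤ 1 - μ := by linarith
    rw [div_le_iff₀ (by positivity)]
    have e4 : 1 / 64 ≤ (1 - μ) ^ 2 := by nlinarith
    have e5 := hd.mul_bound_le
    calc d ^ 2 * (2 * (1 - a)) * tailBound = 2 * (1 - a) * (d * tailBound) * d := by ring
      _ ≤ 2 * (1 / 10 ^ 10) * a := by
        refine mul_le_mul (mul_le_mul (by linarith) e5
          (mul_nonneg hd0.le (zero_le_one.trans one_le_tailBound)) (by norm_num)) (by linarith)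
          hd0.le (by norm_num)
      _ ≤ 1 / 10 ^ 7 * a * (1 / 64) := by linarith
      _ ≤ _ := mul_le_mul_of_nonneg_left e4 (by linarith)
  have e6 := le_of_abs_le e1
  have e7 := (le_of_abs_le e2).trans e3
  rw [residualDerivParam]
  nlinarith

theorem residualDerivParam_neg : residualDerivParam d a μ < 0 := by
  rcases le_total a (1 / 2) with ha | ha
  · exact residualDerivParam_neg_of_le hd h ha
  · rw [← residualDerivParam_symm]
    exact residualDerivParam_neg_of_le hd (goodRegion_symm h) (by linarith)

theorem hasDerivAt_residual_param_of_mem :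
    HasDerivAt (fun x => residual d a x) (residualDerivParam d a μ) μ :=
  hasDerivAt_residual_param (goodRegion_pos hd h).ne' (goodRegion_pos hd (goodRegion_symm h)).ne'
    (tailParam_mem_openTailBox hd h) (tailParam_mem_openTailBox hd (goodRegion_symm h))

theorem hasDerivAt_residual_of_mem :
    HasDerivAt (fun x => residual d x μ) (residualDeriv d a μ) a :=
  hasDerivAt_residual (tailParam_mem_openTailBox hd h)
    (tailParam_mem_openTailBox hd (goodRegion_symm h))

theorem contDiffAt_residual_of_mem :
    ContDiffAt ℝ ∞ (fun v : ℝ × ℝ => residual d v.1 v.2) (a, μ) :=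
  contDiffAt_residual (goodRegion_pos hd h).ne' (goodRegion_pos hd (goodRegion_symm h)).ne'
    (tailParam_mem_openTailBox hd h) (tailParam_mem_openTailBox hd (goodRegion_symm h))

/-- The residual has no degenerate zero of its derivative in the central value. -/
theorem residualSnd_ne_zero (h0 : residualDeriv d a μ = 0) : residualSnd d a μ ≠ 0 := by
  intro h1
  have hd0 := hd.1
  have hle := hd.le
  have ha : 3 / 2 * d < a := h.1
  have ha' : a < 1 - 3 / 2 * d := h.2.1
  obtain ⟨e1, e2⟩ := abs_le.1 (abs_leftHeadDeriv_le hd h)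
  obtain ⟨e3, e4⟩ := abs_le.1 (abs_leftHeadDeriv_le hd (goodRegion_symm h))
  obtain ⟨e5, e6⟩ := abs_le.1 (abs_mul_leftHeadSnd_le hd h)
  obtain ⟨e7, e8⟩ := abs_le.1 (abs_mul_leftHeadSnd_le hd (goodRegion_symm h))
  rw [residualDeriv] at h0
  rw [residualSnd] at h1
  have g1 : |μ - 2 * a - 2 * a * μ + 3 * a ^ 2| ≤ 1 / 100 := by
    rw [← sub_eq_zero.1 h0, abs_mul, abs_of_pos hd0]
    have : |-2 + leftHeadDeriv d a μ + leftHeadDeriv d (1 - a) (1 - μ)| ≤ 3 := by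
      rw [abs_le]; constructor <;> linarith
    nlinarith
  obtain ⟨g1, g2⟩ := abs_le.1 g1
  obtain ⟨s, hs⟩ : ∃ s, s = 2 + 2 * μ - 6 * a := ⟨_, rfl⟩
  have g3 : |s| ≤ 1 / 100 := by rw [abs_le]; constructor <;> linarith
  obtain ⟨g3, g4⟩ := abs_le.1 g3
  have hμ : μ = s / 2 - 1 + 3 * a := by linarith
  rw [hμ] at g1
  -- After the substitution the expression in `g1` equals `s / 2 * (1 - 2 * a) - 3 * (a - 1 / 2) ^ 2
  -- - 1 / 4`, which is well below `-1 / 100`.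
  nlinarith [sq_nonneg (a - 1 / 2)]

/-- For `a` of order `d` the term `d / a` keeps `μ` away from zero, and the derivative of the cubic
at `a` close to its root `0` is close to `μ`. -/
theorem residualDeriv_neg (h0 : residual d a μ = 0) (ha : a ≤ 10 * d) :
    residualDeriv d a μ < 0 := by
  have hd0 := hd.1
  have hle := hd.le
  have ha1 : 3 / 2 * d < a := h.1
  obtain ⟨g1, g2⟩ := abs_le.1 (abs_sub_leadingParam_le hd h h0)
  have g3 : 1 / 10 ≤ d / a := by
    rw [le_div_iff₀ (by linarith)]
    linarith
  have g4 : d / (1 - a) ≤ 2 * d := by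
    rw [div_le_iff₀ (by linarith)]
    nlinarith
  have hμ : 1 / 20 ≤ μ := by
    rw [leadingParam] at g1
    linarith
  obtain ⟨e1, e2⟩ := abs_le.1 (abs_leftHeadDeriv_le hd h)
  obtain ⟨e3, e4⟩ := abs_le.1 (abs_leftHeadDeriv_le hd (goodRegion_symm h))
  rw [residualDeriv]
  have g5 : d * (-2 + leftHeadDeriv d a μ + leftHeadDeriv d (1 - a) (1 - μ)) < 0 :=
    mul_neg_of_pos_of_neg hd0 (by linarith)
  have hμ1 : μ ≤ 1 := by linarith [h.2.2.2.1, hd.sqrt_pos]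
  nlinarith

end GoodRegion

/-- For fixed `a` the admissible `μ` form an interval on which the derivative never vanishes, so
Rolle's theorem excludes two zeros. -/
theorem residual_unique {d a μ ν : ℝ} (hd : IsSmall d) (h1 : (a, μ) ∈ goodRegion d)
    (h2 : (a, ν) ∈ goodRegion d) (e1 : residual d a μ = 0) (e2 : residual d a ν = 0) : μ = ν := by
  wlog hlt : μ < ν generalizing μ ν with H
  · rcases eq_or_lt_of_le (not_lt.1 hlt) with h | h
    · exact h.symm
    · exact (H h2 h1 e2 e1 h).symm
  exfalso
  have hmem : ∀ x ∈ Icc μ ν, (a, x) ∈ goodRegion d := fun x hx =>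
    ⟨h1.1, h1.2.1, h1.2.2.1.trans hx.1, h2.2.2.2.1.trans (by have := hx.2; simp only; linarith),
      h1.2.2.2.2.1.trans (by simpa using hx.1), h2.2.2.2.2.2.trans (by have := hx.2; simp only; linarith)⟩
  obtain ⟨c, hc, h0⟩ := exists_hasDerivAt_eq_zero (f := fun x => residual d a x)
    (f' := residualDerivParam d a) hlt
    (fun x hx => (hasDerivAt_residual_param_of_mem hd (hmem x hx)).continuousAt.continuousWithinAt)
    (e1.trans e2.symm)
    fun x hx => hasDerivAt_residual_param_of_mem hd (hmem x (Ioo_subset_Icc_self hx))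
  exact (residualDerivParam_neg hd (hmem c (Ioo_subset_Icc_self hc))).ne h0

theorem exists_residual_zero {d a : ℝ} (hd : IsSmall d) (h1 : 3 / 2 * d < a)
    (h2 : a < 1 - 3 / 2 * d) : ∃ μ, (a, μ) ∈ goodRegion d ∧ residual d a μ = 0 := by
  have hd0 := hd.1
  set m := leadingParam d a with hm
  have hmem : ∀ x ∈ Icc (m - 30 * d) (m + 30 * d), (a, x) ∈ goodRegion d := fun x hx =>
    mem_goodRegion_of_near hd h1 h2 (abs_le.2 ⟨by linarith [hx.1], by linarith [hx.2]⟩)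
  have hle : m - 30 * d ≤ m + 30 * d := by linarith
  have hc : ContinuousOn (fun x => residual d a x) (Icc (m - 30 * d) (m + 30 * d)) := fun x hx =>
    (hasDerivAt_residual_param_of_mem hd (hmem x hx)).continuousAt.continuousWithinAt
  have hlow := mul_one_sub_lower hd h1 h2
  -- At distance `30 d` the leading term has size at least `4 / 3 * d * (30 * d) = 40 * d ^ 2`, more
  -- than the `12 * d ^ 2` coming from the tails.
  have e1 : 0 ≤ residual d a (m - 30 * d) := by
    rw [residual_eq (by linarith) (by linarith), ← hm]
    have := neg_le_of_abs_le (abs_residual_sub_le hd (hmem _ (left_mem_Icc.2 hle)))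
    nlinarith
  have e2 : residual d a (m + 30 * d) ≤ 0 := by
    rw [residual_eq (by linarith) (by linarith), ← hm]
    have := le_of_abs_le (abs_residual_sub_le hd (hmem _ (right_mem_Icc.2 hle)))
    nlinarith
  obtain ⟨μ, hμ, h0⟩ := intermediate_value_Icc' hle hc ⟨e2, e1⟩
  exact ⟨μ, hmem μ hμ, h0⟩

/-! ### The parameter as a function of the central value -/

open Classical in
/-- The parameter of the steady state with central value `a`. -/
noncomputable def arcParam (d a : ℝ) : ℝ :=
  if h : ∃ μ, (a, μ) ∈ goodRegion d ∧ residual d a μ = 0 then h.choose else 0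

section ArcParam

variable {d a : ℝ} (hd : IsSmall d) (h1 : 3 / 2 * d < a) (h2 : a < 1 - 3 / 2 * d)
include hd h1 h2

theorem arcParam_spec : (a, arcParam d a) ∈ goodRegion d ∧ residual d a (arcParam d a) = 0 := by
  rw [arcParam, dif_pos (exists_residual_zero hd h1 h2)]
  exact (exists_residual_zero hd h1 h2).choose_spec

theorem abs_arcParam_sub_le : |arcParam d a - leadingParam d a| ≤ 9 * d :=
  abs_sub_leadingParam_le hd (arcParam_spec hd h1 h2).1 (arcParam_spec hd h1 h2).2

theorem eq_arcParam {μ : ℝ} (hμ : (a, μ) ∈ goodRegion d) (h0 : residual d a μ = 0) :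
    μ = arcParam d a :=
  residual_unique hd hμ (arcParam_spec hd h1 h2).1 h0 (arcParam_spec hd h1 h2).2

theorem arcParam_symm : arcParam d (1 - a) = 1 - arcParam d a := by
  obtain ⟨e1, e2⟩ := arcParam_spec hd h1 h2
  refine (eq_arcParam hd (by linarith) (by linarith) (goodRegion_symm e1) ?_).symm
  rw [residual_symm, e2, neg_zero]

/-- The `μ`-derivative of the residual is nonzero. Nearby pairs stay within `30 d` of the leading
order, hence in `goodRegion`, where zeros are unique. -/
theorem contDiffAt_arcParam : ContDiffAt ℝ ∞ (arcParam d) a := by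
  obtain ⟨e1, e2⟩ := arcParam_spec hd h1 h2
  have hd0 := hd.1
  have hF := contDiffAt_residual_of_mem hd e1
  refine contDiffAt_of_locally_unique_solution hF ?_ ?_
  · have hf := (hF.differentiableAt (by simp)).hasFDerivAt
    have h3 : HasFDerivAt (fun x => residual d a x)
        (fderiv ℝ (fun v : ℝ × ℝ => residual d v.1 v.2) (a, arcParam d a) ∘L .inr ℝ ℝ ℝ)
        (arcParam d a) :=
      HasFDerivAt.comp (arcParam d a) hf (hasFDerivAt_prodMk_right a (arcParam d a))
    have h4 := h3.unique (hasDerivAt_residual_param_of_mem hd e1).hasFDerivAt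
    rw [h4]
    refine ⟨ContinuousLinearEquiv.unitsEquivAut ℝ
      (Units.mk0 _ (residualDerivParam_neg hd e1).ne), ?_⟩
    ext
    simp
  · have hc : ContinuousAt (fun v : ℝ × ℝ => v.2 - leadingParam d v.1) (a, arcParam d a) := by
      unfold leadingParam
      have : a ≠ 0 := by linarith
      have : 1 - a ≠ 0 := by linarith
      fun_prop (disch := assumption)
    have hlt := abs_arcParam_sub_le hd h1 h2
    have g1 : ∀ᶠ v : ℝ × ℝ in 𝓝 (a, arcParam d a), |v.2 - leadingParam d v.1| < 30 * d :=
      hc.abs.tendsto.eventually_lt_const (by dsimp only; linarith)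
    have g2 := (continuous_fst.tendsto (a, arcParam d a)).eventually_const_lt h1
    have g3 := (continuous_fst.tendsto (a, arcParam d a)).eventually_lt_const h2
    filter_upwards [g1, g2, g3] with v k1 k2 k3 k4
    exact eq_arcParam hd k2 k3 (mem_goodRegion_of_near hd k2 k3 k1.le) (k4.trans e2)

theorem residualDeriv_add_mul_deriv_arcParam :
    residualDeriv d a (arcParam d a) +
      deriv (arcParam d) a * residualDerivParam d a (arcParam d a) = 0 := by
  obtain ⟨e1, e2⟩ := arcParam_spec hd h1 h2
  have hf := ((contDiffAt_residual_of_mem hd e1).differentiableAt (by simp)).hasFDerivAt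
  set L := fderiv ℝ (fun v : ℝ × ℝ => residual d v.1 v.2) (a, arcParam d a)
  have h3 : HasDerivAt (fun x => residual d a x) (L (0, 1)) (arcParam d a) :=
    hf.comp_hasDerivAt (f := fun x => (a, x)) (arcParam d a)
      ((hasDerivAt_const _ a).prodMk (hasDerivAt_id _))
  have h4 : HasDerivAt (fun x => residual d x (arcParam d a)) (L (1, 0)) a :=
    hf.comp_hasDerivAt (f := fun x => (x, arcParam d a)) a
      ((hasDerivAt_id _).prodMk (hasDerivAt_const _ _))
  have hm := ((contDiffAt_arcParam hd h1 h2).differentiableAt (by simp)).hasDerivAt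
  have h5 : HasDerivAt (fun x => residual d x (arcParam d x)) (L (1, deriv (arcParam d) a)) a :=
    hf.comp_hasDerivAt (f := fun x => (x, arcParam d x)) a ((hasDerivAt_id a).prodMk hm)
  have h6 : (fun x => residual d x (arcParam d x)) =ᶠ[𝓝 a] fun _ => 0 := by
    filter_upwards [eventually_gt_nhds h1, eventually_lt_nhds h2] with x k1 k2
    exact (arcParam_spec hd k1 k2).2
  have h7 := h5.unique ((hasDerivAt_const a (0 : ℝ)).congr_of_eventuallyEq h6)
  have h8 : ((1, deriv (arcParam d) a) : ℝ × ℝ) = (1, 0) + deriv (arcParam d) a • (0, 1) := by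
    simp
  rw [h8, map_add, map_smul, smul_eq_mul] at h7
  rw [(hasDerivAt_residual_of_mem hd e1).unique h4,
    (hasDerivAt_residual_param_of_mem hd e1).unique h3]
  exact h7

/-- Both partial derivatives of the residual are negative here, so implicit differentiation gives a
negative slope. -/
theorem deriv_arcParam_neg (h3 : a ≤ 10 * d) : deriv (arcParam d) a < 0 := by
  obtain ⟨e1, e2⟩ := arcParam_spec hd h1 h2
  have g1 := residualDeriv_neg hd e1 e2 h3
  have g2 := residualDerivParam_neg hd e1
  have g3 := residualDeriv_add_mul_deriv_arcParam hd h1 h2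
  by_contra! hc
  nlinarith

end ArcParam

theorem strictAntiOn_arcParam {d : ℝ} (hd : IsSmall d) :
    StrictAntiOn (arcParam d) (Ioc (3 / 2 * d) (10 * d)) := by
  have hle := hd.le
  have hd0 := hd.1
  refine strictAntiOn_of_deriv_neg (convex_Ioc _ _) (fun x hx => ?_) fun x hx => ?_
  · exact (contDiffAt_arcParam hd hx.1 (by linarith [hx.2])).continuousAt.continuousWithinAt
  · have hx' := interior_subset hx
    exact deriv_arcParam_neg hd hx'.1 (by linarith [hx'.2]) hx'.2

theorem exists_arcParam_eq_half {d : ℝ} (hd : IsSmall d) :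
    ∃ w, 8 / 5 * d ≤ w ∧ w ≤ 3 * d ∧ arcParam d w = 1 / 2 := by
  have hle := hd.le
  have hd0 := hd.1
  -- At `a = k * d` the parameter is `1 / k` to leading order. The values 5/8 and 1/3 at the ends `k
  -- = 8 / 5` and `k = 3` enclose 1/2.
  have hlead : ∀ k : ℝ, 8 / 5 ≤ k → k ≤ 3 →
      |arcParam d (k * d) - 1 / k| ≤ 20 * d := fun k hk hk' => by
    have hkd : k * d ≤ 3 * d := by gcongr
    have hkd' : 8 / 5 * d ≤ k * d := by gcongr
    have e := abs_arcParam_sub_le (a := k * d) hd (by linarith) (by linarith)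
    have e1 : d / (k * d) = 1 / k := by field_simp
    have e2 : d / (1 - k * d) ≤ 2 * d := by
      rw [div_le_iff₀ (by linarith)]
      nlinarith
    have e3 : 0 ≤ d / (1 - k * d) := div_nonneg hd0.le (by linarith)
    rw [leadingParam, e1] at e
    rw [abs_le] at e ⊢
    constructor <;> linarith [e.1, e.2]
  have h1 := (abs_le.1 (hlead (8 / 5) le_rfl (by norm_num))).1
  have h2 := (abs_le.1 (hlead 3 (by norm_num) le_rfl)).2
  have hc : ContinuousOn (arcParam d) (Icc (8 / 5 * d) (3 * d)) := fun x hx =>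
    (contDiffAt_arcParam hd (by linarith [hx.1])
      (by linarith [hx.2])).continuousAt.continuousWithinAt
  obtain ⟨w, hw, h⟩ := intermediate_value_Icc' (by linarith) hc
    (show (1 / 2 : ℝ) ∈ _ from ⟨by linarith, by linarith⟩)
  exact ⟨w, hw.1, hw.2, h⟩

/-! ### Assembling steady states from two tails -/

/-- The steady state expression at a site with value `y` and neighbours `x`, `z`. -/
def siteResidual (d μ x y z : ℝ) : ℝ := d * (z + x - 2 * y) + y * (y - μ) * (1 - y)

theorem siteResidual_symm (d μ x y z : ℝ) :
    siteResidual d (1 - μ) (1 - z) (1 - y) (1 - x) = -siteResidual d μ x y z := by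
  unfold siteResidual
  ring

/-- The left half of a steady state, with boundary value `a` at the origin. -/
noncomputable def leftHalf (d a μ : ℝ) (n : ℤ) : ℝ :=
  if n < 0 then d * tail (tailParam d a μ) n else a

theorem leftHalf_of_neg {d a μ : ℝ} {n : ℤ} (hn : n < 0) :
    leftHalf d a μ n = d * tail (tailParam d a μ) n := if_pos hn

@[simp]
theorem leftHalf_zero (d a μ : ℝ) : leftHalf d a μ 0 = a := rfl

theorem leftHalf_neg_one (d a μ : ℝ) : leftHalf d a μ (-1) = leftHead d a μ := rfl

/-- The Boolean marks the site `-1`, whose right neighbour carries the boundary value `a` and not a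
scaled tail entry. Both forms differ by the factor `d * μ`. -/
theorem tail_equation_iff {d a μ y yl yr : ℝ} {b : Bool} (hd : d ≠ 0) (hμ : μ ≠ 0) :
    y = d / μ * (yr + yl) + a / μ * (if b then 1 else 0) - 2 * (d / μ) * y +
        (d / μ + d) * (y * y) - d / μ * d * (y * y * y) ↔
      siteResidual d μ (d * yl) (d * y) (d * yr + if b then a else 0) = 0 := by
  have key : siteResidual d μ (d * yl) (d * y) (d * yr + if b then a else 0) =
      d * μ * (d / μ * (yr + yl) + a / μ * (if b then 1 else 0) - 2 * (d / μ) * y +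
        (d / μ + d) * (y * y) - d / μ * d * (y * y * y) - y) := by
    unfold siteResidual
    cases b <;> simp <;> field_simp <;> ring
  rw [key, mul_eq_zero, or_iff_right (mul_ne_zero hd hμ), sub_eq_zero]
  exact eq_comm

theorem siteResidual_leftHalf {d a μ : ℝ} (hd : d ≠ 0) (hμ : μ ≠ 0)
    (hp : tailParam d a μ ∈ tailBox) {n : ℤ} (hn : n < 0) :
    siteResidual d μ (leftHalf d a μ (n - 1)) (leftHalf d a μ n) (leftHalf d a μ (n + 1)) = 0 := by
  have h := tail_apply_eq hp n
  rw [if_pos hn] at h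
  have h' := (tail_equation_iff (b := decide (n = -1)) (a := a) hd hμ).1 (by simpa using h)
  rw [leftHalf_of_neg hn, leftHalf_of_neg (by omega : n - 1 < 0)]
  rcases eq_or_ne n (-1) with rfl | hne
  · have h0 : tail (a / μ, d / μ, d) (-1 + 1) = 0 := tail_apply_of_nonneg hp (by norm_num)
    rw [h0] at h'
    simpa [tailParam] using h'
  · rw [leftHalf_of_neg (by omega : n + 1 < 0)]
    simpa [hne, tailParam] using h'

theorem abs_leftHalf_le {d a μ : ℝ} (hd : 0 < d) {n : ℤ} (hn : n < 0) :
    |leftHalf d a μ n| ≤ 10 * d := by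
  rw [leftHalf_of_neg hn, abs_mul, abs_of_pos hd, mul_comm]
  exact mul_le_mul_of_nonneg_right (abs_tail_le _ _) hd.le

theorem tendsto_leftHalf_atBot {d a μ : ℝ} (hp : tailParam d a μ ∈ tailBox) :
    Tendsto (leftHalf d a μ) atBot (𝓝 0) := by
  have h := (tendsto_tail_atBot hp).const_mul d
  rw [mul_zero] at h
  refine h.congr' ?_
  filter_upwards [eventually_lt_atBot (0 : ℤ)] with n hn
  exact (leftHalf_of_neg hn).symm

/-- Small left halves of steady states are determined by the boundary value. -/
theorem eq_leftHalf {d μ : ℝ} {u : ℤ → ℝ} (hd : 0 < d) (hμ : μ ≠ 0)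
    (hp : tailParam d (u 0) μ ∈ tailBox) (hb : ∀ n < 0, |u n| ≤ 10 * d)
    (hu : ∀ n < 0, siteResidual d μ (u (n - 1)) (u n) (u (n + 1)) = 0) {n : ℤ} (hn : n ≤ 0) :
    u n = leftHalf d (u 0) μ n := by
  let y : Linf := mkLinf (fun n => if n < 0 then u n / d else 0) 10 fun n => by
    split_ifs with h
    · rw [abs_div, abs_of_pos hd, div_le_iff₀ hd]
      exact hb n h
    · simp
  have hy : ∀ n, y n = if n < 0 then u n / d else 0 := fun n => rfl
  have hfix : tailMap (tailParam d (u 0) μ, y) = y := by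
    ext n
    rw [tailParam, tailMap_apply]
    by_cases h : n < 0
    · have h1 : siteResidual d μ (d * y (n - 1)) (d * y n)
          (d * y (n + 1) + if decide (n = -1) then u 0 else 0) = 0 := by
        refine Eq.trans ?_ (hu n h)
        rw [hy n, hy (n - 1), if_pos h, if_pos (by omega), mul_div_cancel₀ _ hd.ne',
          mul_div_cancel₀ _ hd.ne']
        congr 1
        rcases eq_or_ne n (-1) with rfl | hne
        · simp [hy]
        · rw [hy (n + 1), if_pos (by omega : n + 1 < 0), mul_div_cancel₀ _ hd.ne']
          simp [hne]
      have h2 := (tail_equation_iff hd.ne' hμ).2 h1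
      rw [if_pos h]
      simpa using h2.symm
    · have h3 : n ≠ -1 := by omega
      simp [hy, h, h3]
  have hyt := eq_tail hp (linf_norm_le (by norm_num) fun n => by
    rw [hy]
    split_ifs with h
    · rw [abs_div, abs_of_pos hd, div_le_iff₀ hd]
      exact hb n h
    · simp) hfix
  rcases hn.lt_or_eq with h | rfl
  · rw [leftHalf_of_neg h, ← hyt, hy, if_pos h, mul_div_cancel₀ _ hd.ne']
  · rfl

/-- The sequence with central value `a` and the two small tails. -/
noncomputable def arcSeq (d a μ : ℝ) : Linf :=
  d • tail (tailParam d a μ) + a • site 0 + Ubar -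
    d • reindex (fun n => -n) (tail (tailParam d (1 - a) (1 - μ)))

theorem arcSeq_apply (d a μ : ℝ) (n : ℤ) :
    arcSeq d a μ n = d * tail (tailParam d a μ) n + a * (if n = 0 then 1 else 0) +
      (if n ≤ 0 then 0 else 1) - d * tail (tailParam d (1 - a) (1 - μ)) (-n) := rfl

/-- The arc of steady states, parametrized by the central value. -/
noncomputable def arc (d a : ℝ) : Linf × ℝ := (arcSeq d a (arcParam d a), arcParam d a)

section GoodRegion

variable {d a μ : ℝ} (hd : IsSmall d) (h : (a, μ) ∈ goodRegion d)
include hd h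

theorem tailParam_mem_tailBox : tailParam d a μ ∈ tailBox :=
  openTailBox_subset (tailParam_mem_openTailBox hd h)

theorem arcSeq_of_nonpos {n : ℤ} (hn : n ≤ 0) : arcSeq d a μ n = leftHalf d a μ n := by
  have h1 := tail_apply_of_nonneg (tailParam_mem_tailBox hd (goodRegion_symm h))
    (show 0 ≤ -n by omega)
  rw [arcSeq_apply, h1, if_pos hn]
  rcases hn.lt_or_eq with h' | rfl
  · rw [leftHalf_of_neg h', if_neg (by omega)]
    ring
  · rw [tail_apply_of_nonneg (tailParam_mem_tailBox hd h) le_rfl]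
    simp

theorem arcSeq_of_nonneg {n : ℤ} (hn : 0 ≤ n) :
    arcSeq d a μ n = 1 - leftHalf d (1 - a) (1 - μ) (-n) := by
  rcases hn.lt_or_eq with h' | rfl
  · have h1 := tail_apply_of_nonneg (tailParam_mem_tailBox hd h) hn
    rw [arcSeq_apply, h1, if_neg (by omega), if_neg (by omega), leftHalf_of_neg (by omega)]
    ring
  · rw [arcSeq_of_nonpos hd h le_rfl]
    simp

theorem arcSeq_zero : arcSeq d a μ 0 = a := by
  rw [arcSeq_of_nonpos hd h le_rfl, leftHalf_zero]

theorem abs_arcSeq_le {n : ℤ} (hn : n < 0) : |arcSeq d a μ n| ≤ 10 * d := by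
  rw [arcSeq_of_nonpos hd h hn.le]
  exact abs_leftHalf_le hd.1 hn

theorem abs_one_sub_arcSeq_le {n : ℤ} (hn : 0 < n) : |1 - arcSeq d a μ n| ≤ 10 * d := by
  rw [arcSeq_of_nonneg hd h hn.le, sub_sub_cancel]
  exact abs_leftHalf_le hd.1 (by omega)

/-- From the second site on the deviation is below `8 / 5 * d`, hence below every `1 - w` with `w ≤
1 - b`. -/
theorem abs_one_sub_arcSeq_le_of_two_le {n : ℤ} (hn : 2 ≤ n) : |1 - arcSeq d a μ n| ≤ d := by
  rw [arcSeq_of_nonneg hd h (by omega), sub_sub_cancel, leftHalf_of_neg (by omega), abs_mul,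
    abs_of_pos hd.1]
  have := abs_tail_le_of_le_neg_two (tailParam_mem_tailBox hd (goodRegion_symm h))
    (show -n ≤ -2 by omega)
  nlinarith [hd.1]

theorem siteResidual_arcSeq (h0 : residual d a μ = 0) (n : ℤ) :
    siteResidual d μ (arcSeq d a μ (n - 1)) (arcSeq d a μ n) (arcSeq d a μ (n + 1)) = 0 := by
  have hμ := goodRegion_pos hd h
  have hμ' := goodRegion_pos hd (goodRegion_symm h)
  rcases lt_trichotomy n 0 with hn | rfl | hn
  · rw [arcSeq_of_nonpos hd h (by omega), arcSeq_of_nonpos hd h (by omega),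
      arcSeq_of_nonpos hd h (by omega)]
    exact siteResidual_leftHalf hd.1.ne' hμ.ne' (tailParam_mem_tailBox hd h) hn
  · rw [arcSeq_of_nonpos hd h (by omega), arcSeq_of_nonpos hd h (by omega),
      arcSeq_of_nonneg hd h (by omega)]
    simp only [zero_sub, zero_add, leftHalf_neg_one, leftHalf_zero]
    rw [← h0, residual, siteResidual]
    ring
  · rw [arcSeq_of_nonneg hd h (by omega), arcSeq_of_nonneg hd h (by omega),
      arcSeq_of_nonneg hd h (by omega), ← neg_eq_zero, ← siteResidual_symm]
    simp only [sub_sub_cancel]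
    have := siteResidual_leftHalf hd.1.ne' hμ'.ne' (tailParam_mem_tailBox hd (goodRegion_symm h))
      (show -n < 0 by omega)
    rwa [show -n - 1 = -(n + 1) by ring, show -n + 1 = -(n - 1) by ring] at this

theorem tendsto_arcSeq_atBot : Tendsto (fun n => arcSeq d a μ n) atBot (𝓝 0) := by
  refine (tendsto_leftHalf_atBot (tailParam_mem_tailBox hd h)).congr' ?_
  filter_upwards [eventually_le_atBot (0 : ℤ)] with n hn
  exact (arcSeq_of_nonpos hd h hn).symm

theorem tendsto_arcSeq_atTop : Tendsto (fun n => arcSeq d a μ n) atTop (𝓝 1) := by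
  have h1 := ((tendsto_leftHalf_atBot (tailParam_mem_tailBox hd (goodRegion_symm h))).comp
    tendsto_neg_atTop_atBot).const_sub 1
  rw [sub_zero] at h1
  refine h1.congr' ?_
  filter_upwards [eventually_ge_atTop (0 : ℤ)] with n hn
  exact (arcSeq_of_nonneg hd h hn).symm

theorem norm_arcSeq_le : ‖arcSeq d a μ‖ ≤ 2 := by
  have hle := hd.le
  refine linf_norm_le (by norm_num) fun n => ?_
  rcases lt_trichotomy n 0 with hn | rfl | hn
  · linarith [abs_arcSeq_le hd h hn]
  · rw [arcSeq_zero hd h, abs_le]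
    have h1 : 3 / 2 * d < a := h.1
    have h2 : a < 1 - 3 / 2 * d := h.2.1
    have := hd.1
    constructor <;> linarith
  · have h1 := abs_le.1 (abs_one_sub_arcSeq_le hd h hn)
    rw [abs_le]
    constructor <;> linarith [h1.1, h1.2]

end GoodRegion

/-- Steady states with small tails lie on the arc. -/
theorem eq_arc {d μ : ℝ} {U : Linf} (hd : IsSmall d) (hg : (U 0, μ) ∈ goodRegion d)
    (hU : ∀ n, siteResidual d μ (U (n - 1)) (U n) (U (n + 1)) = 0)
    (hl : ∀ n < 0, |U n| ≤ 10 * d) (hr : ∀ n, 0 < n → |1 - U n| ≤ 10 * d) :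
    (U, μ) = arc d (U 0) := by
  have hleft : ∀ n ≤ 0, U n = leftHalf d (U 0) μ n := fun n hn =>
    eq_leftHalf (u := U) hd.1 (goodRegion_pos hd hg).ne' (tailParam_mem_tailBox hd hg) hl
      (fun n _ => hU n) hn
  have hright : ∀ n, 0 ≤ n → U n = 1 - leftHalf d (1 - U 0) (1 - μ) (-n) := fun n hn => by
    have := eq_leftHalf (u := fun n => 1 - U (-n)) (μ := 1 - μ) hd.1
      (goodRegion_pos hd (goodRegion_symm hg)).ne'
      (by simpa using tailParam_mem_tailBox hd (goodRegion_symm hg))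
      (fun n hn => hr (-n) (by omega)) (fun n hn => by
        rw [show -(n - 1) = -n + 1 by ring, show -(n + 1) = -n - 1 by ring, siteResidual_symm,
          hU, neg_zero]) (n := -n) (by omega)
    simp only [neg_neg, neg_zero] at this
    linarith
  have hseq : U = arcSeq d (U 0) μ := by
    ext n
    rcases le_total n 0 with hn | hn
    · rw [arcSeq_of_nonpos hd hg hn, hleft n hn]
    · rw [arcSeq_of_nonneg hd hg hn, hright n hn]
  have h0 : residual d (U 0) μ = 0 := by
    have h1 := hU 0
    rw [hleft (0 - 1) (by norm_num), hright (0 + 1) (by norm_num)] at h1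
    simp only [zero_sub, zero_add, leftHalf_neg_one] at h1
    rw [← h1, residual, siteResidual]
    ring
  have hμ := eq_arcParam hd hg.1 hg.2.1 hg h0
  rw [arc, ← hμ, ← hseq]

theorem contDiffAt_arcSeq {d a μ : ℝ} (hd : IsSmall d) (h : (a, μ) ∈ goodRegion d) :
    ContDiffAt ℝ ∞ (fun v : ℝ × ℝ => arcSeq d v.1 v.2) (a, μ) := by
  have h1 : ContDiffAt ℝ ∞ (fun v : ℝ × ℝ => tail (tailParam d v.1 v.2)) (a, μ) :=
    ContDiffAt.comp (f := fun v : ℝ × ℝ => tailParam d v.1 v.2) (a, μ)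
      (contDiffAt_tail (tailParam_mem_openTailBox hd h))
      (contDiffAt_tailParam (goodRegion_pos hd h).ne')
  have h2 : ContDiffAt ℝ ∞ (fun v : ℝ × ℝ => tail (tailParam d (1 - v.1) (1 - v.2))) (a, μ) :=
    ContDiffAt.comp (f := fun v : ℝ × ℝ => tailParam d (1 - v.1) (1 - v.2)) (a, μ)
      (contDiffAt_tail (tailParam_mem_openTailBox hd (goodRegion_symm h)))
      (ContDiffAt.comp (f := fun v : ℝ × ℝ => (1 - v.1, 1 - v.2)) (a, μ)
        (contDiffAt_tailParam (goodRegion_pos hd (goodRegion_symm h)).ne') (by fun_prop))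
  unfold arcSeq
  fun_prop

section Arc

variable {d a : ℝ} (hd : IsSmall d) (h1 : 3 / 2 * d < a) (h2 : a < 1 - 3 / 2 * d)
include hd h1 h2

theorem arc_zero : (arc d a).1 0 = a := arcSeq_zero hd (arcParam_spec hd h1 h2).1

theorem contDiffAt_arc : ContDiffAt ℝ ∞ (arc d) a := by
  have hμ := contDiffAt_arcParam hd h1 h2
  exact (ContDiffAt.comp (f := fun x => (x, arcParam d x)) a
    (contDiffAt_arcSeq hd (arcParam_spec hd h1 h2).1) (contDiffAt_id.prodMk hμ)).prodMk hμ

/-- The entry at site `0` is the parameter of the arc itself and has derivative one, even where `μ`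
turns around. -/
theorem deriv_arc_ne_zero : deriv (arc d) a ≠ 0 := by
  intro h0
  have h := ((contDiffAt_arc hd h1 h2).differentiableAt (by simp)).hasDerivAt
  rw [h0] at h
  have h3 := ((coord 0 ∘L .fst ℝ Linf ℝ).hasFDerivAt (x := arc d a)).comp_hasDerivAt a h
  rw [map_zero] at h3
  have h4 : (fun x => x) =ᶠ[𝓝 a] (coord 0 ∘L .fst ℝ Linf ℝ) ∘ arc d := by
    filter_upwards [eventually_gt_nhds h1, eventually_lt_nhds h2] with x k1 k2
    exact (arc_zero hd k1 k2).symm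
  exact one_ne_zero ((hasDerivAt_id a).unique (h3.congr_of_eventuallyEq h4))

end Arc

/-! ### Transport of contact along orbits of the planar map -/

/-- The inverse of the planar map. -/
noncomputable def latticeInv (d μ : ℝ) (q : ℝ × ℝ) : ℝ × ℝ :=
  (2 * q.1 - q.2 - 1 / d * (q.1 * (q.1 - μ) * (1 - q.1)), q.1)

theorem latticeMap_latticeInv (d μ : ℝ) (q : ℝ × ℝ) : latticeMap d μ (latticeInv d μ q) = q := by
  ext <;> simp only [latticeMap, latticeInv]
  ring

theorem latticeInv_latticeMap (d μ : ℝ) (q : ℝ × ℝ) : latticeInv d μ (latticeMap d μ q) = q := by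
  ext <;> simp only [latticeMap, latticeInv]
  ring

theorem contDiff_latticeMap (d μ : ℝ) : ContDiff ℝ ∞ (latticeMap d μ) := by
  unfold latticeMap
  fun_prop

theorem contDiff_latticeInv (d μ : ℝ) : ContDiff ℝ ∞ (latticeInv d μ) := by
  unfold latticeInv
  fun_prop

theorem latticeMap_eq {d μ x y z : ℝ} (hd : d ≠ 0) (h : siteResidual d μ x y z = 0) :
    latticeMap d μ (x, y) = (y, z) := by
  ext
  · rfl
  · simp only [latticeMap]
    unfold siteResidual at h
    field_simp
    linear_combination -h

theorem mapsTo_latticeMap_unstableManifold (d μ : ℝ) (e : ℝ × ℝ) :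
    MapsTo (latticeMap d μ) (unstableManifold d μ e) (unstableManifold d μ e) := by
  rintro q ⟨x, hx, rfl, hlim⟩
  exact ⟨fun n => x (n + 1), fun n => hx (n + 1), hx 0,
    hlim.comp (tendsto_atBot_add_const_right _ 1 tendsto_id)⟩

theorem mapsTo_latticeInv_unstableManifold (d μ : ℝ) (e : ℝ × ℝ) :
    MapsTo (latticeInv d μ) (unstableManifold d μ e) (unstableManifold d μ e) := by
  rintro q ⟨x, hx, rfl, hlim⟩
  refine ⟨fun n => x (n - 1), fun n => ?_, ?_,
    hlim.comp (tendsto_atBot_add_const_right _ (-1) tendsto_id)⟩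
  · have := hx (n - 1)
    rwa [show n - 1 + 1 = n + 1 - 1 by ring] at this
  · have := hx (-1)
    rw [show (-1 : ℤ) + 1 = 0 by norm_num] at this
    rw [this, latticeInv_latticeMap]
    rfl

theorem mapsTo_latticeMap_stableManifold (d μ : ℝ) (e : ℝ × ℝ) :
    MapsTo (latticeMap d μ) (stableManifold d μ e) (stableManifold d μ e) := fun q hq => by
  have : Tendsto (fun n : ℕ => (latticeMap d μ)^[n + 1] q) atTop (𝓝 e) :=
    (tendsto_add_atTop_iff_nat 1).2 hq
  simp only [Function.iterate_succ_apply] at this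
  exact this

theorem mapsTo_latticeInv_stableManifold (d μ : ℝ) (e : ℝ × ℝ) :
    MapsTo (latticeInv d μ) (stableManifold d μ e) (stableManifold d μ e) := fun q hq => by
  refine (tendsto_add_atTop_iff_nat 1).1 ?_
  simp only [Function.iterate_succ_apply, latticeMap_latticeInv]
  exact hq

section Push

variable {f g : ℝ × ℝ → ℝ × ℝ} (hf : ContDiff ℝ ∞ f) (hg : ContDiff ℝ ∞ g)
  (hgf : ∀ q, g (f q) = q) {A B A' B' : Set (ℝ × ℝ)} {q : ℝ × ℝ} {α β : ℝ → ℝ × ℝ}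

theorem IsArcThrough.eventually_contDiffAt (h : IsArcThrough A q α) :
    ∀ᶠ t in 𝓝 0, ContDiffAt ℝ ∞ α t := by
  obtain ⟨-, -, ε, hε, hα, -⟩ := h
  filter_upwards [Ioo_mem_nhds (neg_lt_zero.2 hε) hε] with t ht
  exact hα.contDiffAt (Ioo_mem_nhds ht.1 ht.2)

theorem IsArcThrough.contDiffAt (h : IsArcThrough A q α) : ContDiffAt ℝ ∞ α 0 :=
  h.eventually_contDiffAt.self_of_nhds

include hf hg hgf in
theorem fderiv_injective_of_leftInverse (q : ℝ × ℝ) : Function.Injective (fderiv ℝ f q) := by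
  have h1 := ((hg.differentiable (by simp)) (f q)).hasFDerivAt.comp q
    ((hf.differentiable (by simp)) q).hasFDerivAt
  have h2 : g ∘ f = id := funext hgf
  rw [h2] at h1
  have h3 := h1.unique (hasFDerivAt_id q)
  exact Function.LeftInverse.injective (g := fderiv ℝ g (f q)) fun v =>
    congrArg (fun L : ℝ × ℝ →L[ℝ] ℝ × ℝ => L v) h3

include hf in
theorem deriv_comp_arc (h : IsArcThrough A q α) :
    deriv (f ∘ α) 0 = fderiv ℝ f q (deriv α 0) := by
  have h1 := (h.contDiffAt.differentiableAt (by simp)).hasDerivAt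
  rw [((hf.differentiable (by simp)) (α 0)).hasFDerivAt.comp_hasDerivAt 0 h1 |>.deriv, h.1]

include hf in
-- The term with the second derivative of `f` depends on the velocity only. It cancels between two
-- arcs with equal velocity, so a quadratic tangency is mapped to a quadratic tangency.
theorem deriv_deriv_comp_arc (h : IsArcThrough A q α) :
    deriv (deriv (f ∘ α)) 0 =
      fderiv ℝ (fderiv ℝ f) q (deriv α 0) (deriv α 0) + fderiv ℝ f q (deriv (deriv α) 0) := by
  have h0 := h.contDiffAt
  have h1 : deriv (f ∘ α) =ᶠ[𝓝 0] fun t => fderiv ℝ f (α t) (deriv α t) := by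
    filter_upwards [h.eventually_contDiffAt] with t ht
    exact ((hf.differentiable (by simp)) (α t)).hasFDerivAt.comp_hasDerivAt t
      (ht.differentiableAt (by simp)).hasDerivAt |>.deriv
  rw [h1.deriv_eq]
  have h2 := (h0.differentiableAt (by simp)).hasDerivAt
  have h3 : HasDerivAt (deriv α) (deriv (deriv α) 0) 0 :=
    (((h0.fderiv_right (m := ∞) (by simp)).clm_apply contDiffAt_const).differentiableAt
      (by simp)).hasDerivAt
  have h4 := ((hf.fderiv_right (m := ∞) (by simp)).differentiable (by simp) (α 0)).hasFDerivAt
  have h5 := (h4.comp_hasDerivAt 0 h2).clm_apply h3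
  simpa only [Function.comp_apply, h.1] using h5.deriv

include hf hg hgf in
theorem IsArcThrough.map (h : IsArcThrough A q α) (hA : MapsTo f A A') :
    IsArcThrough A' (f q) (f ∘ α) := by
  refine ⟨by simp [h.1], ?_, ?_⟩
  · rw [deriv_comp_arc hf h]
    intro h0
    exact h.2.1 (fderiv_injective_of_leftInverse hf hg hgf q (h0.trans (map_zero _).symm))
  · obtain ⟨-, -, ε, hε, hα, hmem⟩ := h
    exact ⟨ε, hε, hf.comp_contDiffOn hα, fun t ht => hA (hmem t ht)⟩

include hf hg hgf in
theorem linearIndependent_map_pair {v w : ℝ × ℝ} (h : LinearIndependent ℝ ![v, w]) :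
    LinearIndependent ℝ ![fderiv ℝ f q v, fderiv ℝ f q w] := by
  rw [LinearIndependent.pair_iff] at h ⊢
  intro s t hst
  refine h s t (fderiv_injective_of_leftInverse hf hg hgf q ?_)
  rw [map_add, map_smul, map_smul, hst, map_zero]

include hf hg hgf in
theorem IsTransverseAt.map (h : IsTransverseAt A B q) (hA : MapsTo f A A') (hB : MapsTo f B B') :
    IsTransverseAt A' B' (f q) := by
  obtain ⟨α, β, hα, hβ, hl⟩ := h
  refine ⟨f ∘ α, f ∘ β, hα.map hf hg hgf hA, hβ.map hf hg hgf hB, ?_⟩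
  rw [deriv_comp_arc hf hα, deriv_comp_arc hf hβ]
  exact linearIndependent_map_pair hf hg hgf hl

include hf hg hgf in
theorem IsQuadraticTangencyAt.map (h : IsQuadraticTangencyAt A B q) (hA : MapsTo f A A')
    (hB : MapsTo f B B') : IsQuadraticTangencyAt A' B' (f q) := by
  obtain ⟨α, β, hα, hβ, he, hl⟩ := h
  refine ⟨f ∘ α, f ∘ β, hα.map hf hg hgf hA, hβ.map hf hg hgf hB, ?_, ?_⟩
  · rw [deriv_comp_arc hf hα, deriv_comp_arc hf hβ, he]
  · rw [deriv_comp_arc hf hα, deriv_deriv_comp_arc hf hα, deriv_deriv_comp_arc hf hβ, ← he,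
      add_sub_add_left_eq_sub, ← map_sub]
    exact linearIndependent_map_pair hf hg hgf hl

end Push

/-- The unstable manifold of the origin and the stable manifold of `(1, 1)` meet transversely or
in a quadratic tangency. -/
def MeetsNondegenerately (d μ : ℝ) (q : ℝ × ℝ) : Prop :=
  IsTransverseAt (unstableManifold d μ (0, 0)) (stableManifold d μ (1, 1)) q ∨
    IsQuadraticTangencyAt (unstableManifold d μ (0, 0)) (stableManifold d μ (1, 1)) q

theorem MeetsNondegenerately.latticeMap {d μ : ℝ} {q : ℝ × ℝ} (h : MeetsNondegenerately d μ q) :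
    MeetsNondegenerately d μ (latticeMap d μ q) := by
  have hf := contDiff_latticeMap d μ
  have hg := contDiff_latticeInv d μ
  have hgf := latticeInv_latticeMap d μ
  have hA := mapsTo_latticeMap_unstableManifold d μ (0, 0)
  have hB := mapsTo_latticeMap_stableManifold d μ (1, 1)
  exact h.imp (fun h => h.map hf hg hgf hA hB) fun h => h.map hf hg hgf hA hB

theorem MeetsNondegenerately.latticeInv {d μ : ℝ} {q : ℝ × ℝ} (h : MeetsNondegenerately d μ q) :
    MeetsNondegenerately d μ (latticeInv d μ q) := by
  have hf := contDiff_latticeInv d μ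
  have hg := contDiff_latticeMap d μ
  have hgf := latticeMap_latticeInv d μ
  have hA := mapsTo_latticeInv_unstableManifold d μ (0, 0)
  have hB := mapsTo_latticeInv_stableManifold d μ (1, 1)
  exact h.imp (fun h => h.map hf hg hgf hA hB) fun h => h.map hf hg hgf hA hB

/-! ### Invariant manifolds as graphs and their contact -/

/-- The second component of the point of the unstable manifold with first component `a`. -/
noncomputable def unstableGraph (d μ a : ℝ) : ℝ :=
  2 * a - leftHead d a μ - 1 / d * (a * (a - μ) * (1 - a))

/-- The second component of the point of the stable manifold with first component `a`. -/
noncomputable def stableGraph (d μ a : ℝ) : ℝ := 1 - leftHead d (1 - a) (1 - μ)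

/-- The left half is a backward orbit tending to the origin. Forward iterates are unconstrained, so
the orbit through `q` is completed by iteration; the formula for the graph is the map applied to the
pair of entries at the sites `-1` and `0`. -/
theorem unstableGraph_mem {d a μ : ℝ} (hd : d ≠ 0) (hμ : μ ≠ 0)
    (hp : tailParam d a μ ∈ tailBox) :
    (a, unstableGraph d μ a) ∈ unstableManifold d μ (0, 0) := by
  set q : ℝ × ℝ := (a, unstableGraph d μ a)
  refine ⟨fun n => if n < 0 then (leftHalf d a μ n, leftHalf d a μ (n + 1)) else
    (Nagumo.latticeMap d μ)^[n.toNat] q, fun n => ?_, rfl, ?_⟩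
  · dsimp only
    rcases lt_trichotomy n (-1) with hn | rfl | hn
    · rw [if_pos (by omega), if_pos (by omega)]
      refine (latticeMap_eq hd ?_).symm
      simpa using siteResidual_leftHalf hd hμ hp (n := n + 1) (by omega)
    · simp [q, Nagumo.latticeMap, unstableGraph, leftHalf_neg_one]
    · rw [if_neg (by omega), if_neg (by omega), show (n + 1).toNat = n.toNat + 1 by omega,
        Function.iterate_succ_apply']
  · have h := tendsto_leftHalf_atBot hp
    have h1 := h.prodMk_nhds (h.comp (tendsto_atBot_add_const_right _ 1 tendsto_id))
    refine h1.congr' ?_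
    filter_upwards [eventually_lt_atBot (0 : ℤ)] with n hn
    simp [hn]

theorem stableGraph_mem {d a μ : ℝ} (hd : d ≠ 0) (hμ : 1 - μ ≠ 0)
    (hp : tailParam d (1 - a) (1 - μ) ∈ tailBox) :
    (a, stableGraph d μ a) ∈ stableManifold d μ (1, 1) := by
  set R : ℕ → ℝ := fun n => 1 - leftHalf d (1 - a) (1 - μ) (-n) with hR
  have hiter : ∀ n : ℕ, (Nagumo.latticeMap d μ)^[n] (a, stableGraph d μ a) = (R n, R (n + 1)) := by
    intro n
    induction n with
    | zero => simp [hR, stableGraph, leftHalf_neg_one]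
    | succ n ih =>
      rw [Function.iterate_succ_apply', ih]
      refine latticeMap_eq hd ?_
      have h := siteResidual_leftHalf hd hμ hp (n := -((n : ℤ) + 1)) (by omega)
      rw [show -((n : ℤ) + 1) - 1 = -((n : ℤ) + 1 + 1) by ring,
        show -((n : ℤ) + 1) + 1 = -(n : ℤ) by ring] at h
      rw [← neg_eq_zero, ← siteResidual_symm, hR]
      push_cast
      simpa only [sub_sub_cancel] using h
  have hlim : Tendsto R atTop (𝓝 1) := by
    have h1 := ((tendsto_leftHalf_atBot hp).comp
      (tendsto_neg_atTop_atBot.comp tendsto_natCast_atTop_atTop)).const_sub 1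
    rw [sub_zero] at h1
    exact h1
  simp only [stableManifold, mem_ofPred_eq, hiter]
  exact hlim.prodMk_nhds ((tendsto_add_atTop_iff_nat 1).2 hlim)

theorem isArcThrough_graph {A : Set (ℝ × ℝ)} {F : ℝ → ℝ} {a : ℝ}
    (hF : ∀ᶠ x in 𝓝 a, ContDiffAt ℝ ∞ F x ∧ (x, F x) ∈ A) :
    IsArcThrough A (a, F a) fun t => (a + t, F (a + t)) := by
  obtain ⟨ε, hε, h⟩ := Metric.eventually_nhds_iff.1 hF
  have hmem : ∀ t ∈ Ioo (-ε) ε, ContDiffAt ℝ ∞ F (a + t) ∧ (a + t, F (a + t)) ∈ A := fun t ht =>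
    h (by simpa [Real.dist_eq] using abs_lt.2 ht)
  have hc : ∀ t ∈ Ioo (-ε) ε, ContDiffAt ℝ ∞ (fun t => (a + t, F (a + t))) t := fun t ht => by
    have h1 : ContDiffAt ℝ ∞ (fun t : ℝ => a + t) t := by fun_prop
    exact h1.prodMk (ContDiffAt.comp t (hmem t ht).1 h1)
  refine ⟨by simp, fun h0 => ?_, ε, hε, fun t ht => (hc t ht).contDiffWithinAt,
    fun t ht => (hmem t ht).2⟩
  have h1 := ((hc 0 ⟨by linarith, hε⟩).differentiableAt (by simp)).hasDerivAt
  rw [h0] at h1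
  have h2 : HasDerivAt (fun t : ℝ => a + t) 0 0 := h1.fst
  exact one_ne_zero (((hasDerivAt_id (0 : ℝ)).const_add a).unique h2)

theorem deriv_graph {F F' : ℝ → ℝ} {a : ℝ} (hF : HasDerivAt F (F' a) a) :
    deriv (fun t => (a + t, F (a + t))) 0 = (1, F' a) := by
  have h1 : HasDerivAt (fun t : ℝ => a + t) 1 0 := (hasDerivAt_id (0 : ℝ)).const_add a
  have h2 : HasDerivAt (fun t => F (a + t)) (F' a) 0 := by
    have := HasDerivAt.comp_const_add a 0 (by simpa using hF)
    simpa using this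
  exact (h1.prodMk h2).deriv

theorem deriv_deriv_graph {F F' : ℝ → ℝ} {a F'' : ℝ} (hF : ∀ᶠ x in 𝓝 a, HasDerivAt F (F' x) x)
    (hF' : HasDerivAt F' F'' a) :
    deriv (deriv fun t => (a + t, F (a + t))) 0 = (0, F'') := by
  have h0 : Tendsto (fun t : ℝ => a + t) (𝓝 0) (𝓝 a) := by
    simpa using (continuous_const_add a).tendsto (0 : ℝ)
  have h1 : deriv (fun t => (a + t, F (a + t))) =ᶠ[𝓝 0] fun t => (1, F' (a + t)) := by
    filter_upwards [h0.eventually hF] with t ht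
    have e1 : HasDerivAt (fun t : ℝ => a + t) 1 t := (hasDerivAt_id t).const_add a
    exact (e1.prodMk (HasDerivAt.comp_const_add a t ht)).deriv
  rw [h1.deriv_eq]
  have h2 : HasDerivAt (fun t => F' (a + t)) F'' 0 :=
    HasDerivAt.comp_const_add a 0 (by simpa using hF')
  exact ((hasDerivAt_const (0 : ℝ) (1 : ℝ)).prodMk h2).deriv

theorem linearIndependent_pair_of_det_ne_zero {x y z w : ℝ} (h : x * w - y * z ≠ 0) :
    LinearIndependent ℝ ![((x, y) : ℝ × ℝ), (z, w)] := by
  rw [LinearIndependent.pair_iff]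
  intro s t hst
  simp only [Prod.smul_mk, smul_eq_mul, Prod.mk_add_mk, Prod.mk_eq_zero] at hst
  obtain ⟨h1, h2⟩ := hst
  have h3 : s * (x * w - y * z) = 0 := by linear_combination w * h1 - z * h2
  have h4 : t * (x * w - y * z) = 0 := by linear_combination x * h2 - y * h1
  exact ⟨(mul_eq_zero.1 h3).resolve_right h, (mul_eq_zero.1 h4).resolve_right h⟩

/-- Two graphs that meet to order at most two. -/
theorem transverse_or_tangent_of_graphs {A B : Set (ℝ × ℝ)} {F G F' G' : ℝ → ℝ} {a F'' G'' : ℝ}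
    (hF : ∀ᶠ x in 𝓝 a, ContDiffAt ℝ ∞ F x ∧ (x, F x) ∈ A)
    (hG : ∀ᶠ x in 𝓝 a, ContDiffAt ℝ ∞ G x ∧ (x, G x) ∈ B) (h0 : F a = G a)
    (hF1 : ∀ᶠ x in 𝓝 a, HasDerivAt F (F' x) x) (hG1 : ∀ᶠ x in 𝓝 a, HasDerivAt G (G' x) x)
    (hF2 : HasDerivAt F' F'' a) (hG2 : HasDerivAt G' G'' a)
    (hne : F' a = G' a → F'' ≠ G'') :
    IsTransverseAt A B (a, F a) ∨ IsQuadraticTangencyAt A B (a, F a) := by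
  have hα := isArcThrough_graph hF
  have hβ := isArcThrough_graph hG
  rw [← h0] at hβ
  have e1 := deriv_graph hF1.self_of_nhds
  have e2 := deriv_graph hG1.self_of_nhds
  by_cases he : F' a = G' a
  · refine Or.inr ⟨_, _, hα, hβ, ?_, ?_⟩
    · rw [e1, e2, he]
    · rw [e1, deriv_deriv_graph hF1 hF2, deriv_deriv_graph hG1 hG2, Prod.mk_sub_mk]
      refine linearIndependent_pair_of_det_ne_zero ?_
      have := sub_ne_zero.2 (hne he)
      simpa using this
  · refine Or.inl ⟨_, _, hα, hβ, ?_⟩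
    rw [e1, e2]
    refine linearIndependent_pair_of_det_ne_zero ?_
    have := sub_ne_zero.2 (Ne.symm he)
    simpa using this

/-- The two graphs differ by `residual / d`. They cross transversely unless `residualDeriv`
vanishes, and then `residualSnd` is nonzero, which leaves a quadratic tangency. -/
theorem meetsNondegenerately_center {d a μ : ℝ} (hd : IsSmall d) (h : (a, μ) ∈ goodRegion d)
    (h0 : residual d a μ = 0) : MeetsNondegenerately d μ (a, stableGraph d μ a) := by
  have hd0 := hd.1.ne'
  have hμ := (goodRegion_pos hd h).ne'
  have hμ' := (goodRegion_pos hd (goodRegion_symm h)).ne'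
  have hgraph : ∀ x, unstableGraph d μ x = stableGraph d μ x - residual d x μ / d := fun x => by
    unfold unstableGraph stableGraph residual
    field_simp
    ring
  have hbox : ∀ᶠ x in 𝓝 a, tailParam d x μ ∈ openTailBox ∧
      tailParam d (1 - x) (1 - μ) ∈ openTailBox := by
    have c1 : Continuous fun x => tailParam d x μ := by unfold tailParam; fun_prop
    have c2 : Continuous fun x => tailParam d (1 - x) (1 - μ) := by unfold tailParam; fun_prop
    exact (c1.continuousAt.eventually (isOpen_openTailBox.mem_nhds
      (tailParam_mem_openTailBox hd h))).and (c2.continuousAt.eventually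
      (isOpen_openTailBox.mem_nhds (tailParam_mem_openTailBox hd (goodRegion_symm h))))
  have hs : ∀ x, HasDerivAt (fun x : ℝ => 1 - x) (-1) x := fun x => by
    simpa using (hasDerivAt_id x).const_sub 1
  have hG1 : ∀ᶠ x in 𝓝 a, HasDerivAt (stableGraph d μ) (leftHeadDeriv d (1 - x) (1 - μ)) x := by
    filter_upwards [hbox] with x hx
    exact ((HasDerivAt.comp x (hasDerivAt_leftHead hx.2) (hs x)).const_sub 1).congr_deriv (by ring)
  have hG2 := HasDerivAt.comp a (hasDerivAt_leftHeadDeriv hbox.self_of_nhds.2) (hs a)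
  have hF1 : ∀ᶠ x in 𝓝 a, HasDerivAt (unstableGraph d μ)
      (leftHeadDeriv d (1 - x) (1 - μ) - residualDeriv d x μ / d) x := by
    filter_upwards [hbox, hG1] with x hx hGx
    rw [funext hgraph]
    exact hGx.sub ((hasDerivAt_residual hx.1 hx.2).div_const d)
  have hF2 := hG2.sub ((hasDerivAt_residualDeriv hbox.self_of_nhds.1
    hbox.self_of_nhds.2).div_const d)
  have hfa : unstableGraph d μ a = stableGraph d μ a := by rw [hgraph, h0, zero_div, sub_zero]
  have hsmooth : ∀ {x}, tailParam d x μ ∈ openTailBox → ContDiffAt ℝ ∞ (fun y => leftHead d y μ) x :=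
    fun hx => ContDiffAt.comp (f := fun y => (y, μ)) _ (contDiffAt_leftHead hμ hx) (by fun_prop)
  have hsmooth' : ∀ {x}, tailParam d (1 - x) (1 - μ) ∈ openTailBox →
      ContDiffAt ℝ ∞ (fun y => leftHead d (1 - y) (1 - μ)) x := fun hx =>
    ContDiffAt.comp (f := fun y => (1 - y, 1 - μ)) _ (contDiffAt_leftHead hμ' hx) (by fun_prop)
  rw [← hfa]
  refine transverse_or_tangent_of_graphs ?_ ?_ hfa hF1 hG1 hF2 hG2 fun he => ?_
  · filter_upwards [hbox] with x hx
    refine ⟨?_, unstableGraph_mem hd0 hμ (openTailBox_subset hx.1)⟩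
    have := hsmooth hx.1
    unfold unstableGraph
    fun_prop
  · filter_upwards [hbox] with x hx
    refine ⟨?_, stableGraph_mem hd0 hμ' (openTailBox_subset hx.2)⟩
    exact contDiffAt_const.sub (hsmooth' hx.2)
  · have h1 : residualDeriv d a μ = 0 := by
      rcases div_eq_zero_iff.1 (sub_eq_self.1 he) with h | h
      · exact h
      · exact absurd h hd0
    intro h2
    rcases div_eq_zero_iff.1 (sub_eq_self.1 h2) with h3 | h3
    · exact residualSnd_ne_zero hd h h1 h3
    · exact hd0 h3

theorem meetsNondegenerately_arcSeq {d a μ : ℝ} (hd : IsSmall d) (h : (a, μ) ∈ goodRegion d)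
    (h0 : residual d a μ = 0) (n : ℤ) :
    MeetsNondegenerately d μ (arcSeq d a μ (n - 1), arcSeq d a μ n) := by
  have hstep : ∀ n : ℤ, Nagumo.latticeMap d μ (arcSeq d a μ (n - 1), arcSeq d a μ n) =
      (arcSeq d a μ n, arcSeq d a μ (n + 1)) := fun n =>
    latticeMap_eq hd.1.ne' (siteResidual_arcSeq hd h h0 n)
  -- The base point is `n = 1`, where the pair is `(U 0, U 1)`. The planar map and its inverse carry
  -- the contact to the other indices.
  induction n using Int.inductionOn' (b := 1) with
  | zero =>
    have := meetsNondegenerately_center hd h h0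
    rw [sub_self, arcSeq_zero hd h, arcSeq_of_nonneg hd h zero_le_one]
    exact this
  | succ k _ ih =>
    have := ih.latticeMap
    rw [hstep] at this
    simpa using this
  | pred k _ ih =>
    have h1 := hstep (k - 1)
    rw [sub_add_cancel] at h1
    have := ih.latticeInv
    rw [← h1, latticeInv_latticeMap] at this
    exact this

/-! ### Shifts and gluing of equivariant curves -/

/-- The `k`-th power of the shift, acting on the first component of `ℓ^∞ × ℝ`. -/
noncomputable def shiftBy (k : ℤ) : Linf × ℝ →L[ℝ] Linf × ℝ :=
  (reindex fun n => n + k).prodMap (.id ℝ ℝ)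

@[simp]
theorem shiftBy_fst_apply (k : ℤ) (x : Linf × ℝ) (n : ℤ) : (shiftBy k x).1 n = x.1 (n + k) := rfl

@[simp]
theorem shiftBy_snd (k : ℤ) (x : Linf × ℝ) : (shiftBy k x).2 = x.2 := rfl

theorem shiftBy_add (j k : ℤ) (x : Linf × ℝ) : shiftBy (j + k) x = shiftBy j (shiftBy k x) := by
  refine Prod.ext ?_ rfl
  ext n
  simp only [shiftBy_fst_apply]
  rw [add_assoc]

@[simp]
theorem shiftBy_zero (x : Linf × ℝ) : shiftBy 0 x = x := by
  refine Prod.ext ?_ rfl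
  ext n
  simp

theorem shiftBy_injective (k : ℤ) : Function.Injective (shiftBy k) :=
  Function.LeftInverse.injective (g := shiftBy (-k)) fun x => by
    rw [← shiftBy_add, neg_add_cancel, shiftBy_zero]

theorem shiftBy_eq (k : ℤ) (x : Linf × ℝ) : shiftBy k x = ((shift ^ k) x.1, x.2) := by
  refine Prod.ext ?_ rfl
  ext n
  exact (shift_zpow_apply k x.1 n).symm

theorem orbitMap_eq_iff {x y : Linf × ℝ} : orbitMap x = orbitMap y ↔ ∃ k, shiftBy k x = y := by
  rw [orbitMap, orbitMap, Prod.mk.injEq, Quotient.eq]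
  constructor
  · rintro ⟨⟨k, hk⟩, h2⟩
    exact ⟨k, by rw [shiftBy_eq, hk, h2]⟩
  · rintro ⟨k, rfl⟩
    rw [shiftBy_eq]
    exact ⟨⟨k, rfl⟩, rfl⟩

theorem norm_shiftBy (k : ℤ) (x : Linf × ℝ) : ‖shiftBy k x‖ = ‖x‖ := by
  have h : ∀ (k : ℤ) (x : Linf × ℝ), ‖shiftBy k x‖ ≤ ‖x‖ := fun k x => by
    refine max_le ((linf_norm_le (norm_nonneg x.1) fun n => ?_).trans (le_max_left _ _))
      (le_max_right _ _)
    exact abs_coord_le x.1 (n + k)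
  refine le_antisymm (h k x) ?_
  conv_lhs => rw [← shiftBy_zero x, ← neg_add_cancel k, shiftBy_add]
  exact h (-k) _

theorem dist_shiftBy (k : ℤ) (x y : Linf × ℝ) : dist (shiftBy k x) (shiftBy k y) = dist x y := by
  rw [dist_eq_norm, dist_eq_norm, ← map_sub, norm_shiftBy]

section Inverse

variable {t : ℝ → ℝ} {l r : ℝ} (ht : ∀ w ∈ Ioo l r, ContDiffAt ℝ ∞ t w)
  (ht' : ∀ w ∈ Ioo l r, 0 < deriv t w)
include ht ht'

theorem strictMonoOn_of_contDiffAt : StrictMonoOn t (Ioo l r) :=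
  strictMonoOn_of_deriv_pos (convex_Ioo l r)
    (fun w hw => (ht w hw).continuousAt.continuousWithinAt)
    fun w hw => ht' w (interior_subset hw)

theorem invFunOn_apply {w : ℝ} (hw : w ∈ Ioo l r) : Function.invFunOn t (Ioo l r) (t w) = w :=
  (strictMonoOn_of_contDiffAt ht ht').injOn.leftInvOn_invFunOn hw

theorem contDiffAt_invFunOn {w : ℝ} (hw : w ∈ Ioo l r) :
    ContDiffAt ℝ ∞ (Function.invFunOn t (Ioo l r)) (t w) := by
  have hinv := invFunOn_apply ht ht' hw
  have hF : ContDiffAt ℝ ∞ (fun v : ℝ × ℝ => t v.2 - v.1)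
      (t w, Function.invFunOn t (Ioo l r) (t w)) := by
    rw [hinv]
    exact (ContDiffAt.comp (f := fun v : ℝ × ℝ => v.2) (t w, w) (ht w hw) contDiffAt_snd).sub
      contDiffAt_fst
  refine contDiffAt_of_locally_unique_solution hF ?_ ?_
  · have h3 := HasFDerivAt.comp (f := fun x : ℝ => (t w, x)) _
      (hF.differentiableAt (by simp)).hasFDerivAt (hasFDerivAt_prodMk_right (t w) _)
    have h4 : HasDerivAt (fun x => t x - t w) (deriv t w)
        (Function.invFunOn t (Ioo l r) (t w)) := by
      rw [hinv]
      exact ((ht w hw).differentiableAt (by simp)).hasDerivAt.sub_const (t w)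
    rw [h3.unique h4.hasFDerivAt]
    refine ⟨ContinuousLinearEquiv.unitsEquivAut ℝ (Units.mk0 _ (ht' w hw).ne'), ?_⟩
    ext
    simp
  · rw [hinv]
    filter_upwards [(continuous_snd.tendsto (t w, w)).eventually (Ioo_mem_nhds hw.1 hw.2)]
      with v hv h
    rw [sub_self, sub_eq_zero] at h
    rw [← h, invFunOn_apply ht ht' hv]

theorem deriv_invFunOn_ne_zero {w : ℝ} (hw : w ∈ Ioo l r) :
    deriv (Function.invFunOn t (Ioo l r)) (t w) ≠ 0 := by
  intro h0
  have h1 := ((contDiffAt_invFunOn ht ht' hw).differentiableAt (by simp)).hasDerivAt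
  have h2 := ((ht w hw).differentiableAt (by simp)).hasDerivAt
  have h3 := h1.comp w h2
  rw [h0, zero_mul] at h3
  have h4 : (fun x => x) =ᶠ[𝓝 w] Function.invFunOn t (Ioo l r) ∘ t := by
    filter_upwards [Ioo_mem_nhds hw.1 hw.2] with x hx
    exact (invFunOn_apply ht ht' hx).symm
  exact one_ne_zero ((hasDerivAt_id w).unique (h3.congr_of_eventuallyEq h4))

end Inverse

/-- A smooth arc whose end overlaps with the shift of its beginning extends to a smooth
shift-equivariant curve. -/
theorem exists_equivariant_extension {γ : ℝ → Linf × ℝ} {t : ℝ → ℝ} {l a b r : ℝ} (hla : l < a)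
    (hab : a < b) (hbr : b < r) (hγ : ∀ w ∈ Ioo l r, ContDiffAt ℝ ∞ γ w)
    (hγ' : ∀ w ∈ Ioo l r, deriv γ w ≠ 0) (ht : ∀ w ∈ Ioo l r, ContDiffAt ℝ ∞ t w)
    (ht' : ∀ w ∈ Ioo l r, 0 < deriv t w) (hta : t a = 0) (htb : t b = 1)
    (hglue : ∀ᶠ w in 𝓝 a, ∃ w' ∈ Ioo l r, γ w' = shiftBy 1 (γ w) ∧ t w' = t w + 1) :
    ∃ c : ℝ → Linf × ℝ, ContDiff ℝ ∞ c ∧ (∀ s, deriv c s ≠ 0) ∧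
      (∀ s, c (s + 1) = shiftBy 1 (c s)) ∧ ∀ w ∈ Icc a b, c (t w) = γ w := by
  have hsub : Icc a b ⊆ Ioo l r := Icc_subset_Ioo hla hbr
  have ha : a ∈ Ioo l r := hsub (left_mem_Icc.2 hab.le)
  set g := Function.invFunOn t (Ioo l r)
  have hg : ∀ w ∈ Ioo l r, g (t w) = w := fun w hw => invFunOn_apply ht ht' hw
  have hmono := strictMonoOn_of_contDiffAt ht ht'
  have hsurj : ∀ s ∈ Icc (0 : ℝ) 1, ∃ w ∈ Icc a b, t w = s := fun s hs => by
    have := intermediate_value_Icc hab.le fun w hw => (ht w (hsub hw)).continuousAt.continuousWithinAt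
    exact this (by rwa [hta, htb])
  set c : ℝ → Linf × ℝ := fun s => shiftBy ⌊s⌋ (γ (g (Int.fract s))) with hc
  -- Since `t` has nonzero derivative at `a`, it maps neighbourhoods of `a` onto neighbourhoods of
  -- `0`; this turns the gluing hypothesis into a statement about the time variable.
  have hoverlap : ∀ᶠ τ in 𝓝 (0 : ℝ), γ (g (τ + 1)) = shiftBy 1 (γ (g τ)) := by
    have hmap := ((ht a ha).hasStrictDerivAt (by simp)).map_nhds_eq (ht' a ha).ne'
    rw [hta] at hmap
    rw [← hmap, eventually_map]
    filter_upwards [hglue, Ioo_mem_nhds hla (hab.trans hbr)] with w ⟨w', hw', h1, h2⟩ hw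
    rw [← h2, hg w' hw', hg w hw, h1]
  -- Near every time one smooth formula holds. Just to the left of an integer the floor drops by
  -- one, and the overlap relation compensates for it.
  have hlocal : ∀ s, c =ᶠ[𝓝 s] fun x => shiftBy ⌊s⌋ (γ (g (x - ⌊s⌋))) := fun s => by
    have hup : ∀ᶠ x : ℝ in 𝓝 s, x < ⌊s⌋ + 1 := eventually_lt_nhds (Int.lt_floor_add_one s)
    have hfl : ∀ x : ℝ, (⌊s⌋ : ℝ) ≤ x → x < ⌊s⌋ + 1 →
        c x = shiftBy ⌊s⌋ (γ (g (x - ⌊s⌋))) := fun x h1 h2 => by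
      have : ⌊x⌋ = ⌊s⌋ := Int.floor_eq_iff.2 ⟨h1, h2⟩
      rw [hc]
      simp only [Int.fract, this]
    rcases (Int.floor_le s).lt_or_eq with hlt | heq
    · filter_upwards [hup, eventually_gt_nhds hlt] with x h1 h2
      exact hfl x h2.le h1
    · have hlow : ∀ᶠ x : ℝ in 𝓝 s, (⌊s⌋ : ℝ) - 1 < x := eventually_gt_nhds (by linarith)
      have htend : Tendsto (fun x : ℝ => x - ⌊s⌋) (𝓝 s) (𝓝 0) := by
        have : Tendsto (fun x : ℝ => x - ⌊s⌋) (𝓝 s) (𝓝 (s - ⌊s⌋)) :=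
          (continuous_sub_right (⌊s⌋ : ℝ)).tendsto s
        rwa [show s - (⌊s⌋ : ℝ) = 0 by rw [heq, sub_self]] at this
      filter_upwards [hup, hlow, htend.eventually hoverlap] with x h1 h2 h3
      rcases le_or_gt (⌊s⌋ : ℝ) x with h4 | h4
      · exact hfl x h4 h1
      · have : ⌊x⌋ = ⌊s⌋ - 1 := Int.floor_eq_iff.2 (by push_cast; constructor <;> linarith)
        rw [hc]
        simp only [Int.fract, this]
        push_cast
        rw [show x - ((⌊s⌋ : ℝ) - 1) = x - ⌊s⌋ + 1 by ring, h3, ← shiftBy_add, sub_add_cancel]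
  have hpt : ∀ s : ℝ, ∃ w ∈ Icc a b, t w = s - ⌊s⌋ := fun s =>
    hsurj _ ⟨sub_nonneg.2 (Int.floor_le s), by linarith [Int.lt_floor_add_one s]⟩
  have hdata : ∀ s, ContDiffAt ℝ ∞ c s ∧ deriv c s ≠ 0 := fun s => by
    obtain ⟨w, hw, hws⟩ := hpt s
    have hw' := hsub hw
    have hg1 := contDiffAt_invFunOn ht ht' hw'
    have hg2 := deriv_invFunOn_ne_zero ht ht' hw'
    rw [hws] at hg1 hg2
    have hval : g (s - ⌊s⌋) = w := by rw [← hws, hg w hw']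
    have hsub' : ContDiffAt ℝ ∞ (fun x : ℝ => x - ⌊s⌋) s := by fun_prop
    have hgs : ContDiffAt ℝ ∞ (fun x : ℝ => g (x - ⌊s⌋)) s :=
      ContDiffAt.comp (f := fun x : ℝ => x - ⌊s⌋) s hg1 hsub'
    have hγs : ContDiffAt ℝ ∞ (fun x : ℝ => γ (g (x - ⌊s⌋))) s :=
      ContDiffAt.comp (f := fun x : ℝ => g (x - ⌊s⌋)) s (by simpa only [hval] using hγ w hw') hgs
    have hcs : ContDiffAt ℝ ∞ (fun x : ℝ => shiftBy ⌊s⌋ (γ (g (x - ⌊s⌋)))) s :=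
      (shiftBy ⌊s⌋).contDiff.contDiffAt.comp s hγs
    refine ⟨hcs.congr_of_eventuallyEq (hlocal s), ?_⟩
    rw [(hlocal s).deriv_eq]
    have d1 : HasDerivAt (fun x : ℝ => g (x - ⌊s⌋)) (deriv g (s - ⌊s⌋)) s :=
      (hg1.differentiableAt (by simp)).hasDerivAt.comp_sub_const s (⌊s⌋ : ℝ)
    have d2 : HasDerivAt γ (deriv γ w) (g (s - ⌊s⌋)) := by
      rw [hval]
      exact ((hγ w hw').differentiableAt (by simp)).hasDerivAt
    have d3 := (shiftBy ⌊s⌋).hasFDerivAt.comp_hasDerivAt s (d2.scomp s d1)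
    have d4 : deriv (fun x : ℝ => shiftBy ⌊s⌋ (γ (g (x - ⌊s⌋)))) s =
        shiftBy ⌊s⌋ (deriv g (s - ⌊s⌋) • deriv γ w) := d3.deriv
    rw [d4]
    intro h0
    have h1 := shiftBy_injective _ (h0.trans (map_zero _).symm)
    exact (smul_ne_zero hg2 (hγ' w hw')) h1
  refine ⟨c, contDiff_iff_contDiffAt.2 fun s => (hdata s).1, fun s => (hdata s).2, fun s => ?_,
    fun w hw => ?_⟩
  · simp only [hc, Int.floor_add_one, Int.fract_add_one]
    rw [add_comm, shiftBy_add]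
  · rcases hw.2.lt_or_eq with hlt | rfl
    · have h1 : t w < 1 := htb ▸ hmono (hsub hw) (hsub (right_mem_Icc.2 hab.le)) hlt
      have h0 : 0 ≤ t w := hta ▸ hmono.monotoneOn ha (hsub hw) hw.1
      have hf : ⌊t w⌋ = 0 := Int.floor_eq_zero_iff.2 ⟨h0, h1⟩
      simp only [hc, Int.fract, hf, Int.cast_zero, sub_zero, shiftBy_zero, hg w (hsub hw)]
    -- At the right end `t = 1`, the definition already uses the shifted left end. Gluing at `a`
    -- itself identifies the two values.
    · obtain ⟨w', hw', h1, h2⟩ := hglue.self_of_nhds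
      rw [hta, zero_add, ← htb] at h2
      have : w' = w := hmono.injOn hw' (hsub hw) h2
      rw [htb, hc]
      simp only [Int.floor_one, Int.fract_one]
      rw [← hta, hg a ha, ← h1, this]

/-! ### Bond-centered states -/

/-- The tail is its image under one contraction step; compared with the image of `0`, the error is
at most 6/20. -/
theorem abs_tailHead_sub_le {p : ℝ × ℝ × ℝ} (hp : p ∈ tailBox) :
    |tailHead p - p.1| ≤ 3 / 10 := by
  have h := norm_tailMap_sub_le hp (norm_tail_le_ten p) (z := 0) (by simp)
  have h0 : tailMap (p, 0) = p.1 • site (-1) := by simp [tailMap]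
  rw [tailMap_tail hp, h0, sub_zero] at h
  have h1 := (abs_coord_le _ (-1)).trans h
  have h2 : (tail p - p.1 • site (-1)) (-1) = tailHead p - p.1 := by
    change tail p (-1) - p.1 * site (-1) (-1) = _
    simp [tailHead]
  rw [h2] at h1
  linarith [norm_tail_le hp]

/-- After the shift the old central value `w` becomes the entry at site `-1`. It is small enough to
count as part of a left tail, so uniqueness applies to the shifted profile. -/
theorem shiftBy_one_arc {d w : ℝ} (hd : IsSmall d) (h1 : 3 / 2 * d < w) (h2 : w ≤ 10 * d)
    (h3 : (arc d w).1 1 < 1 - 3 / 2 * d) (h4 : 3 / 10 ≤ arcParam d w) (h5 : arcParam d w ≤ 7 / 10) :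
    shiftBy 1 (arc d w) = arc d ((arc d w).1 1) := by
  have hd0 := hd.1
  have hle := hd.le
  have hs := hd.sqrt_le
  obtain ⟨hg, h0⟩ := arcParam_spec hd h1 (by linarith)
  have hb : |1 - (arc d w).1 1| ≤ 10 * d := abs_one_sub_arcSeq_le hd hg one_pos
  obtain ⟨hb1, hb2⟩ := abs_le.1 hb
  have hU0 : (shiftBy 1 (arc d w)).1 0 = (arc d w).1 1 := rfl
  have h := eq_arc (U := (shiftBy 1 (arc d w)).1) (μ := arcParam d w) hd ?_ (fun n => ?_)
    (fun n hn => ?_) fun n hn => ?_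
  · rw [hU0] at h
    exact h
  · rw [hU0]
    refine ⟨?_, h3, ?_, ?_, ?_, ?_⟩ <;> simp only <;> linarith
  · have := siteResidual_arcSeq hd hg h0 (n + 1)
    simp only [shiftBy_fst_apply]
    rwa [add_sub_right_comm] at this
  · simp only [shiftBy_fst_apply]
    rcases eq_or_ne n (-1) with rfl | hne
    · rw [neg_add_cancel, arc_zero hd h1 (by linarith), abs_of_pos (by linarith)]
      exact h2
    · exact abs_arcSeq_le hd hg (n := n + 1) (by omega)
  · exact abs_one_sub_arcSeq_le hd hg (n := n + 1) (by omega)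

/-- A central value of a steady state that is symmetric about a bond. -/
structure IsBondCentered (d w : ℝ) : Prop where
  ge : 8 / 5 * d ≤ w
  le : w ≤ 3 * d
  param : arcParam d w = 1 / 2

theorem exists_isBondCentered {d : ℝ} (hd : IsSmall d) : ∃ w, IsBondCentered d w :=
  let ⟨w, h1, h2, h3⟩ := exists_arcParam_eq_half hd
  ⟨w, h1, h2, h3⟩

section BondCentered

variable {d b : ℝ} (hd : IsSmall d) (hb : IsBondCentered d b)
include hd hb

theorem IsBondCentered.gt : 3 / 2 * d < b := by linarith [hb.ge, hd.1]

theorem IsBondCentered.lt : b < 1 - 3 / 2 * d := by linarith [hb.le, hd.le]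

/-- Let `z = 1 - U 1`, which is about `2 d`. The shifted profile lies on the arc with central value
`1 - z` and the same parameter 1/2, so by reflection `arcParam d z = 1 / 2`. Strict monotonicity for
central values up to `10 d` forces `z = b`. -/
theorem IsBondCentered.arc_one : (arc d b).1 1 = 1 - b := by
  have hd0 := hd.1
  have hle := hd.le
  have h1 := hb.gt hd
  have h2 := hb.lt hd
  obtain ⟨hg, h0⟩ := arcParam_spec hd h1 h2
  have hbd : |1 - (arc d b).1 1| ≤ 10 * d := abs_one_sub_arcSeq_le hd hg one_pos
  have hval : (arc d b).1 1 = 1 - leftHead d (1 - b) (1 - arcParam d b) := by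
    rw [arc, arcSeq_of_nonneg hd hg zero_le_one, leftHalf_neg_one]
  have hz : 3 / 2 * d < leftHead d (1 - b) (1 - arcParam d b) := by
    have := abs_tailHead_sub_le (tailParam_mem_tailBox hd (goodRegion_symm hg))
    rw [hb.param] at this ⊢
    have e1 : (tailParam d (1 - b) (1 - 1 / 2)).1 = 2 * (1 - b) := by
      simp only [tailParam]
      ring
    rw [e1] at this
    have e2 := (abs_le.1 this).1
    rw [leftHead]
    have : 3 / 2 < tailHead (tailParam d (1 - b) (1 - 1 / 2)) := by linarith [hb.le]
    nlinarith
  have hsh := shiftBy_one_arc hd h1 (by linarith [hb.le]) (by rw [hval]; linarith)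
    (by rw [hb.param]; norm_num) (by rw [hb.param]; norm_num)
  have hμ : arcParam d ((arc d b).1 1) = 1 / 2 := by
    have := congrArg Prod.snd hsh
    rw [shiftBy_snd] at this
    exact this.symm.trans hb.param
  set z := leftHead d (1 - b) (1 - arcParam d b)
  have hz2 : z ≤ 10 * d := by
    have := (abs_le.1 hbd).2
    rw [hval] at this
    linarith
  have hμz : arcParam d z = 1 / 2 := by
    rw [hval, arcParam_symm hd hz (by linarith)] at hμ
    linarith
  have : z = b := (strictAntiOn_arcParam hd).injOn ⟨hz, hz2⟩ ⟨h1, by linarith [hb.le]⟩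
    (hμz.trans hb.param.symm)
  rw [hval, this]

/-- Near the bond-centered state, the shift moves the arc to itself. -/
theorem IsBondCentered.eventually_shift :
    Tendsto (fun w => (arc d w).1 1) (𝓝 b) (𝓝 (1 - b)) ∧
      ∀ᶠ w in 𝓝 b, shiftBy 1 (arc d w) = arc d ((arc d w).1 1) := by
  have hd0 := hd.1
  have hle := hd.le
  have h1 := hb.gt hd
  have h2 := hb.lt hd
  have hc := (contDiffAt_arc hd h1 h2).continuousAt
  have hlim : Tendsto (fun w => (arc d w).1 1) (𝓝 b) (𝓝 (1 - b)) := by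
    have := ((coord 1 ∘L .fst ℝ Linf ℝ).continuous.continuousAt (x := arc d b)).comp hc
    rw [← hb.arc_one hd]
    exact this
  have hμ : Tendsto (arcParam d) (𝓝 b) (𝓝 (1 / 2)) := by
    rw [← hb.param]
    exact (contDiffAt_arcParam hd h1 h2).continuousAt
  refine ⟨hlim, ?_⟩
  filter_upwards [eventually_gt_nhds h1, eventually_lt_nhds (show b < 10 * d by linarith [hb.le]),
    hlim.eventually_lt_const (show 1 - b < 1 - 3 / 2 * d by linarith),
    hμ.eventually_const_lt (show (3 / 10 : ℝ) < 1 / 2 by norm_num),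
    hμ.eventually_lt_const (show (1 / 2 : ℝ) < 7 / 10 by norm_num)] with w k1 k2 k3 k4 k5
  exact shiftBy_one_arc hd k1 k2.le k3 k4.le k5.le

end BondCentered

/-! ### A phase adapted to the gluing -/

/-- A cutoff that equals one near the bond-centered state and below. -/
noncomputable def cutoff (d b w : ℝ) : ℝ := Real.smoothTransition ((b + d / 10 - w) / (d / 20))

/-- The phase along the arc. Near both ends of the arc it is a function of `μ`. -/
noncomputable def phase (d b w : ℝ) : ℝ :=
  w + cutoff d b w * (b * (1 / 2 - arcParam d w) - w) +
    cutoff d b (1 - w) * (1 + b * (1 / 2 - arcParam d w) - w)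

theorem contDiff_cutoff (d b : ℝ) : ContDiff ℝ ∞ (cutoff d b) := by
  unfold cutoff
  exact Real.smoothTransition.contDiff.comp (by fun_prop)

theorem cutoff_eq_one {d b w : ℝ} (hd : 0 < d) (h : w ≤ b + d / 20) : cutoff d b w = 1 :=
  Real.smoothTransition.one_of_one_le (by rw [le_div_iff₀ (by positivity)]; linarith)

theorem cutoff_eq_zero {d b w : ℝ} (hd : 0 < d) (h : b + d / 10 ≤ w) : cutoff d b w = 0 :=
  Real.smoothTransition.zero_of_nonpos (div_nonpos_of_nonpos_of_nonneg (by linarith)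
    (by positivity))

theorem antitone_cutoff {d b : ℝ} (hd : 0 < d) : Antitone (cutoff d b) := fun x y hxy =>
  Real.smoothTransition.monotone (by gcongr)

theorem cutoff_nonneg (d b w : ℝ) : 0 ≤ cutoff d b w := Real.smoothTransition.nonneg _

theorem cutoff_le_one (d b w : ℝ) : cutoff d b w ≤ 1 := Real.smoothTransition.le_one _

section Phase

variable {d b w : ℝ} (hd : IsSmall d) (hb : IsBondCentered d b)
include hd

theorem contDiffAt_phase (h1 : 3 / 2 * d < w) (h2 : w < 1 - 3 / 2 * d) :
    ContDiffAt ℝ ∞ (phase d b) w := by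
  have e1 := contDiffAt_arcParam hd h1 h2
  have e2 : ContDiffAt ℝ ∞ (cutoff d b) w := (contDiff_cutoff d b).contDiffAt
  have e3 : ContDiffAt ℝ ∞ (fun x => cutoff d b (1 - x)) w :=
    ((contDiff_cutoff d b).comp (by fun_prop : ContDiff ℝ ∞ fun x : ℝ => 1 - x)).contDiffAt
  unfold phase
  fun_prop

theorem phase_symm (h1 : 3 / 2 * d < w) (h2 : w < 1 - 3 / 2 * d) :
    phase d b w = 1 - phase d b (1 - w) := by
  rw [phase, phase, arcParam_symm hd h1 h2, sub_sub_cancel]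
  ring

include hb

theorem phase_of_le (h : w ≤ b + d / 20) :
    phase d b w = b * (1 / 2 - arcParam d w) := by
  have := hd.1
  have := hd.le
  have := hb.le
  rw [phase, cutoff_eq_one hd.1 h, cutoff_eq_zero hd.1 (by linarith)]
  ring

theorem phase_of_ge (h : 1 - (b + d / 20) ≤ w) :
    phase d b w = 1 + b * (1 / 2 - arcParam d w) := by
  have := hd.1
  have := hd.le
  have := hb.le
  rw [phase, cutoff_eq_one (w := 1 - w) hd.1 (by linarith), cutoff_eq_zero hd.1 (by linarith)]
  ring

/-- With `χ` the cutoff, the derivative is `(1 - χ) + χ * (-b * μ') - χ' * (w - b * (1 / 2 - μ))`.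
The first two terms average positive numbers, because `μ' < 0` where `χ` is nonzero. The last is
nonnegative, because `χ' ≤ 0` and `b / 2 ≤ w`. -/
theorem deriv_phase_pos_of_le_half (h1 : b - d / 20 < w) (h2 : w ≤ 1 / 2) :
    0 < deriv (phase d b) w := by
  have hd0 := hd.1
  have hle := hd.le
  have hbl := hb.le
  have hbg := hb.ge
  have g1 : 3 / 2 * d < w := by linarith
  have g2 : w < 1 - 3 / 2 * d := by linarith
  have hloc : phase d b =ᶠ[𝓝 w] fun x => x + cutoff d b x * (b * (1 / 2 - arcParam d x) - x) := by
    filter_upwards [eventually_lt_nhds (show w < 3 / 4 by linarith)] with x hx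
    rw [phase, cutoff_eq_zero (w := 1 - x) hd0 (by linarith)]
    ring
  have e1 := ((contDiffAt_arcParam hd g1 g2).differentiableAt (by simp)).hasDerivAt
  have e2 := ((contDiff_cutoff d b).differentiable (by simp) w).hasDerivAt
  have e3 := (hasDerivAt_id w).add (e2.mul (((e1.const_sub (1 / 2)).const_mul b).sub
    (hasDerivAt_id w)))
  have e4 : deriv (phase d b) w = _ := hloc.deriv_eq.trans e3.deriv
  rw [e4]
  simp only [Pi.sub_apply, id]
  have hχ' : deriv (cutoff d b) w ≤ 0 := (antitone_cutoff hd0).deriv_nonpos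
  have hχ0 := cutoff_nonneg d b w
  have hχ1 := cutoff_le_one d b w
  have hg := (arcParam_spec hd g1 g2).1
  have hμ := goodRegion_pos hd hg
  have hk : 0 ≤ w - b * (1 / 2 - arcParam d w) := by nlinarith
  have hterm : 0 ≤ -deriv (cutoff d b) w * (w - b * (1 / 2 - arcParam d w)) :=
    mul_nonneg (by linarith) hk
  rcases le_or_gt w (b + d / 10) with hw | hw
  · have hμ' := deriv_arcParam_neg hd g1 g2 (by linarith)
    have hA : 0 < -(b * deriv (arcParam d) w) := by nlinarith
    have hmix : 0 < (1 - cutoff d b w) + cutoff d b w * -(b * deriv (arcParam d) w) := by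
      rcases hχ1.lt_or_eq with h | h
      · exact add_pos_of_pos_of_nonneg (by linarith) (mul_nonneg hχ0 hA.le)
      · rw [h]; linarith
    linarith
  · have : cutoff d b w = 0 := cutoff_eq_zero hd0 hw.le
    rw [this]
    linarith

theorem deriv_phase_pos (h1 : b - d / 20 < w) (h2 : w < 1 - (b - d / 20)) :
    0 < deriv (phase d b) w := by
  have hd0 := hd.1
  have hbg := hb.ge
  rcases le_total w (1 / 2) with h | h
  · exact deriv_phase_pos_of_le_half hd hb h1 h
  · have g1 : 3 / 2 * d < w := by linarith
    have g2 : w < 1 - 3 / 2 * d := by linarith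
    have hloc : phase d b =ᶠ[𝓝 w] fun x => 1 - phase d b (1 - x) := by
      filter_upwards [eventually_gt_nhds g1, eventually_lt_nhds g2] with x k1 k2
      exact phase_symm hd k1 k2
    rw [hloc.deriv_eq, deriv_const_sub, deriv_comp_const_sub, neg_neg]
    exact deriv_phase_pos_of_le_half hd hb (by linarith) (by linarith)

end Phase

/-! ### The global curve and its properties -/

/-- A smooth shift-equivariant curve of steady states that follows the arc between two
bond-centered states. -/
structure IsChain (d b : ℝ) (c : ℝ → Linf × ℝ) : Prop where
  isSmall : IsSmall d
  isBondCentered : IsBondCentered d b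
  contDiff : ContDiff ℝ ∞ c
  deriv_ne_zero : ∀ s, deriv c s ≠ 0
  map_add_one : ∀ s, c (s + 1) = shiftBy 1 (c s)
  map_phase : ∀ w ∈ Icc b (1 - b), c (phase d b w) = arc d w

/-- The shift preserves `μ`. Near the ends the phase depends on `μ` alone, up to the constant 1, so
the gluing condition on phases holds exactly. -/
theorem exists_isChain {d : ℝ} (hd : IsSmall d) : ∃ b c, IsChain d b c := by
  obtain ⟨b, hb⟩ := exists_isBondCentered hd
  have hd0 := hd.1
  have hle := hd.le
  have hbl := hb.le
  have hbg := hb.ge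
  obtain ⟨hlim, hshift⟩ := hb.eventually_shift hd
  obtain ⟨c, h1, h2, h3, h4⟩ := exists_equivariant_extension (γ := arc d) (t := phase d b)
    (l := b - d / 20) (a := b) (b := 1 - b) (r := 1 - (b - d / 20)) (by linarith) (by linarith)
    (by linarith)
    (fun w hw => contDiffAt_arc hd (by linarith [hw.1]) (by linarith [hw.2]))
    (fun w hw => deriv_arc_ne_zero hd (by linarith [hw.1]) (by linarith [hw.2]))
    (fun w hw => contDiffAt_phase hd (by linarith [hw.1]) (by linarith [hw.2]))
    (fun w hw => deriv_phase_pos hd hb hw.1 hw.2)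
    (by rw [phase_of_le hd hb (by linarith), hb.param]; ring)
    (by rw [phase_of_ge hd hb (by linarith), arcParam_symm hd (hb.gt hd) (hb.lt hd), hb.param]; ring)
    (by
      filter_upwards [hshift, eventually_lt_nhds (show b < b + d / 20 by linarith),
        hlim.eventually_const_lt (show 1 - (b + d / 20) < 1 - b by linarith),
        hlim.eventually_lt_const (show 1 - b < 1 - (b - d / 20) by linarith)] with w k1 k2 k3 k4
      refine ⟨(arc d w).1 1, ⟨by linarith, k4⟩, k1.symm, ?_⟩
      have hμ : arcParam d ((arc d w).1 1) = arcParam d w := (congrArg Prod.snd k1).symm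
      rw [phase_of_ge hd hb k3.le, phase_of_le hd hb k2.le, hμ]
      ring)
  exact ⟨b, c, hd, hb, h1, h2, h3, h4⟩

/-- An injective continuous curve in a metric space that does not return close to itself after
a long time is an embedding. -/
theorem isEmbedding_of_dist {X : Type*} [MetricSpace X] {c : ℝ → X} (hc : Continuous c)
    (hinj : Function.Injective c) {δ L : ℝ} (hδ : 0 < δ)
    (h : ∀ s t, dist (c s) (c t) < δ → |s - t| ≤ L) : IsEmbedding c := by
  refine ⟨isInducing_iff_nhds.2 fun x => le_antisymm (hc.tendsto x).le_comap fun U hU => ?_, hinj⟩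
  have hK : IsCompact (c '' (Icc (x - L) (x + L) \ interior U)) :=
    (isCompact_Icc.diff isOpen_interior).image hc
  have hx : c x ∉ c '' (Icc (x - L) (x + L) \ interior U) := by
    rintro ⟨y, hy, hxy⟩
    rw [hinj hxy] at hy
    exact hy.2 (mem_interior_iff_mem_nhds.2 hU)
  refine ⟨(c '' (Icc (x - L) (x + L) \ interior U))ᶜ ∩ Metric.ball (c x) δ,
    inter_mem (hK.isClosed.isOpen_compl.mem_nhds hx) (Metric.ball_mem_nhds _ hδ), ?_⟩
  rintro y ⟨hy1, hy2⟩
  obtain ⟨h1, h2⟩ := abs_le.1 (h y x hy2)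
  by_contra hyU
  exact hy1 ⟨y, ⟨⟨by linarith, by linarith⟩, fun hi => hyU (interior_subset hi)⟩, rfl⟩

theorem abs_sub_apply_le_dist (x y : Linf × ℝ) (n : ℤ) : |x.1 n - y.1 n| ≤ dist x y := by
  rw [dist_eq_norm]
  exact (abs_coord_le (x.1 - y.1) n).trans (norm_fst_le (x - y))

namespace IsChain

variable {d b : ℝ} {c : ℝ → Linf × ℝ} (h : IsChain d b c)
include h

theorem map_add_int (s : ℝ) (k : ℤ) : c (s + k) = shiftBy k (c s) := by
  induction k using Int.induction_on with
  | zero => simp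
  | succ k ih =>
    push_cast at ih ⊢
    rw [← add_assoc, h.map_add_one, ih, ← shiftBy_add, add_comm]
  | pred k ih =>
    refine shiftBy_injective 1 ?_
    rw [← h.map_add_one, ← shiftBy_add, add_sub_cancel, ← ih]
    push_cast
    congr 1
    ring

theorem strictMonoOn_phase : StrictMonoOn (phase d b) (Icc b (1 - b)) := by
  have hd := h.isSmall
  have hd0 := hd.1
  have hg := h.isBondCentered.ge
  exact (strictMonoOn_of_contDiffAt (l := b - d / 20) (r := 1 - (b - d / 20))
    (fun w hw => contDiffAt_phase hd (by linarith [hw.1]) (by linarith [hw.2]))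
    (fun w hw => deriv_phase_pos hd h.isBondCentered hw.1 hw.2)).mono
    (Icc_subset_Ioo (by linarith) (by linarith))

theorem continuousOn_phase : ContinuousOn (phase d b) (Icc b (1 - b)) := fun w hw =>
  (contDiffAt_phase h.isSmall (by linarith [hw.1, h.isBondCentered.gt h.isSmall])
    (by linarith [hw.2, h.isBondCentered.gt h.isSmall])).continuousAt.continuousWithinAt

theorem phase_left : phase d b b = 0 := by
  rw [phase_of_le h.isSmall h.isBondCentered (by linarith [h.isSmall.1]), h.isBondCentered.param]
  ring

theorem phase_right : phase d b (1 - b) = 1 := by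
  rw [phase_symm h.isSmall, sub_sub_cancel, h.phase_left, sub_zero] <;>
    linarith [h.isBondCentered.gt h.isSmall, h.isBondCentered.lt h.isSmall]

theorem left_lt_right : b < 1 - b := by
  linarith [h.isBondCentered.le, h.isSmall.le]

theorem exists_phase_eq (s : ℝ) :
    ∃ w ∈ Ico b (1 - b), ∃ k : ℤ, s = phase d b w + k ∧ phase d b w ∈ Ico (0 : ℝ) 1 := by
  have hlt := h.left_lt_right
  have hs0 : 0 ≤ Int.fract s := Int.fract_nonneg s
  have hs1 : Int.fract s < 1 := Int.fract_lt_one s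
  obtain ⟨w, hw, he⟩ := intermediate_value_Icc hlt.le h.continuousOn_phase
    (show Int.fract s ∈ _ by rw [h.phase_left, h.phase_right]; exact ⟨hs0, hs1.le⟩)
  refine ⟨w, ⟨hw.1, lt_of_le_of_ne hw.2 ?_⟩, ⌊s⌋, ?_, he ▸ ⟨hs0, hs1⟩⟩
  · rintro rfl
    rw [h.phase_right] at he
    linarith
  · rw [he, Int.fract_add_floor]

theorem apply_phase_add {w : ℝ} (hw : w ∈ Icc b (1 - b)) (k : ℤ) :
    c (phase d b w + k) = shiftBy k (arc d w) := by
  rw [h.map_add_int, h.map_phase w hw]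

theorem gt_of_mem {w : ℝ} (hw : w ∈ Icc b (1 - b)) : 3 / 2 * d < w :=
  (h.isBondCentered.gt h.isSmall).trans_le hw.1

theorem lt_of_mem {w : ℝ} (hw : w ∈ Icc b (1 - b)) : w < 1 - 3 / 2 * d := by
  linarith [hw.2, h.isBondCentered.gt h.isSmall]

theorem spec_of_mem {w : ℝ} (hw : w ∈ Icc b (1 - b)) :
    (w, arcParam d w) ∈ goodRegion d ∧ residual d w (arcParam d w) = 0 :=
  arcParam_spec h.isSmall (h.gt_of_mem hw) (h.lt_of_mem hw)

theorem exists_eq_shiftBy_arc {x : Linf × ℝ} (hx : x ∈ range c) :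
    ∃ w ∈ Icc b (1 - b), ∃ k, x = shiftBy k (arc d w) := by
  obtain ⟨s, rfl⟩ := hx
  obtain ⟨w, hw, k, hs, -⟩ := h.exists_phase_eq s
  exact ⟨w, Ico_subset_Icc_self hw, k, by
    rw [hs, h.apply_phase_add (Ico_subset_Icc_self hw)]⟩

/-- For a shift by one, `w'` and `1 - w` would both be at most `10 d`; monotonicity of the parameter
then gives `μ ≤ 1 / 2` from `w' ≥ b` and `μ > 1 / 2` from `1 - w > b`. For larger shifts, `1 - w ≤
d` contradicts `1 - w > b`. -/
theorem eq_zero_of_arc_eq_shiftBy {w w' : ℝ} (hw : w ∈ Ico b (1 - b)) (hw' : w' ∈ Ico b (1 - b))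
    {m : ℤ} (hm : 0 ≤ m) (he : arc d w = shiftBy m (arc d w')) : m = 0 := by
  have hd := h.isSmall
  have hd0 := hd.1
  have hle := hd.le
  have hbg := h.isBondCentered.ge
  have hbl := h.isBondCentered.le
  have hm1 := Ico_subset_Icc_self hw
  have hm2 := Ico_subset_Icc_self hw'
  have hw0 := arc_zero hd (h.gt_of_mem hm1) (h.lt_of_mem hm1)
  have hw0' := arc_zero hd (h.gt_of_mem hm2) (h.lt_of_mem hm2)
  have e1 : w = (arc d w').1 m := by
    rw [← hw0, he, shiftBy_fst_apply, zero_add]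
  have e2 : w' = (arc d w).1 (-m) := by
    rw [he, shiftBy_fst_apply, neg_add_cancel, hw0']
  by_contra hne
  rcases (show 1 ≤ m by omega).eq_or_lt with rfl | hlt
  · have k1 := abs_one_sub_arcSeq_le hd (h.spec_of_mem hm2).1 one_pos
    have k2 := abs_arcSeq_le hd (h.spec_of_mem hm1).1 (show (-1 : ℤ) < 0 by norm_num)
    change |1 - (arc d w').1 1| ≤ _ at k1
    change |(arc d w).1 (-1)| ≤ _ at k2
    rw [← e1] at k1
    rw [← e2] at k2
    have hb := h.isBondCentered.gt hd
    have hanti := strictAntiOn_arcParam hd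
    have l1 : arcParam d w' ≤ 1 / 2 := by
      rw [← h.isBondCentered.param]
      exact hanti.antitoneOn ⟨hb, by linarith⟩ ⟨h.gt_of_mem hm2, le_of_abs_le k2⟩ hw'.1
    have l2 : arcParam d (1 - w) < 1 / 2 := by
      rw [← h.isBondCentered.param]
      exact hanti ⟨hb, by linarith⟩ ⟨by linarith [h.lt_of_mem hm1], le_of_abs_le k1⟩
        (by linarith [hw.2])
    rw [arcParam_symm hd (h.gt_of_mem hm1) (h.lt_of_mem hm1)] at l2
    have l3 : arcParam d w = arcParam d w' := congrArg Prod.snd he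
    linarith
  · have k1 := abs_one_sub_arcSeq_le_of_two_le hd (h.spec_of_mem hm2).1 (show 2 ≤ m by omega)
    change |1 - (arc d w').1 m| ≤ _ at k1
    rw [← e1] at k1
    linarith [le_of_abs_le k1, hw.2]

theorem injective : Function.Injective c := by
  have key : ∀ {w w' : ℝ} (k j : ℤ), w ∈ Ico b (1 - b) → w' ∈ Ico b (1 - b) → k ≤ j →
      shiftBy k (arc d w) = shiftBy j (arc d w') → k = j ∧ w = w' := by
    intro w w' k j hw hw' hkj he
    have h1 : arc d w = shiftBy (j - k) (arc d w') := shiftBy_injective k (by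
      rw [he, ← shiftBy_add, add_sub_cancel])
    have h2 := h.eq_zero_of_arc_eq_shiftBy hw hw' (by omega) h1
    rw [h2, shiftBy_zero] at h1
    refine ⟨by omega, ?_⟩
    have hm1 := Ico_subset_Icc_self hw
    have hm2 := Ico_subset_Icc_self hw'
    rw [← arc_zero h.isSmall (h.gt_of_mem hm1) (h.lt_of_mem hm1),
      ← arc_zero h.isSmall (h.gt_of_mem hm2) (h.lt_of_mem hm2), h1]
  intro s t hst
  obtain ⟨w, hw, k, rfl, -⟩ := h.exists_phase_eq s
  obtain ⟨w', hw', j, rfl, -⟩ := h.exists_phase_eq t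
  rw [h.apply_phase_add (Ico_subset_Icc_self hw), h.apply_phase_add (Ico_subset_Icc_self hw')] at hst
  rcases le_total k j with hkj | hkj
  · obtain ⟨rfl, rfl⟩ := key k j hw hw' hkj hst
    rfl
  · obtain ⟨rfl, rfl⟩ := key j k hw' hw hkj hst.symm
    rfl

theorem abs_sub_le_of_dist_lt {s t : ℝ} (hst : dist (c s) (c t) < 1 / 2) : |s - t| ≤ 2 := by
  have hd := h.isSmall
  have hle := hd.le
  have key : ∀ {w w' : ℝ} (k j : ℤ), w ∈ Icc b (1 - b) → w' ∈ Icc b (1 - b) → j + 2 ≤ k →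
      1 / 2 ≤ dist (shiftBy k (arc d w)) (shiftBy j (arc d w')) := by
    intro w w' k j hw hw' hkj
    -- At site `1 - k` the first profile shows its entry at site `1`, near one, and the second an
    -- entry at a negative site, near zero.
    have k1 := abs_one_sub_arcSeq_le hd (h.spec_of_mem hw).1 one_pos
    have k2 := abs_arcSeq_le hd (h.spec_of_mem hw').1 (show 1 - k + j < 0 by omega)
    have k3 := abs_sub_apply_le_dist (shiftBy k (arc d w)) (shiftBy j (arc d w')) (1 - k)
    rw [shiftBy_fst_apply, shiftBy_fst_apply, sub_add_cancel] at k3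
    change |1 - (arc d w).1 1| ≤ _ at k1
    change |(arc d w').1 (1 - k + j)| ≤ _ at k2
    have k4 := le_of_abs_le k1
    have k5 := le_of_abs_le k2
    have k6 := le_of_abs_le k3
    linarith
  obtain ⟨w, hw, k, rfl, p0, p1⟩ := h.exists_phase_eq s
  obtain ⟨w', hw', j, rfl, q0, q1⟩ := h.exists_phase_eq t
  have hm1 := Ico_subset_Icc_self hw
  have hm2 := Ico_subset_Icc_self hw'
  rw [h.apply_phase_add hm1, h.apply_phase_add hm2] at hst
  have h1 : k < j + 2 := by
    by_contra! hc
    linarith [key k j hm1 hm2 hc]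
  have h2 : j < k + 2 := by
    by_contra! hc
    have := key j k hm2 hm1 hc
    rw [dist_comm] at this
    linarith
  have h3 : (k : ℝ) ≤ j + 1 := by exact_mod_cast (by omega : k ≤ j + 1)
  have h4 : (j : ℝ) ≤ k + 1 := by exact_mod_cast (by omega : j ≤ k + 1)
  rw [abs_le]
  constructor <;> linarith

theorem isEmbedding : IsEmbedding c :=
  isEmbedding_of_dist h.contDiff.continuous h.injective one_half_pos fun _ _ =>
    h.abs_sub_le_of_dist_lt

theorem isSmoothCurve : IsSmoothCurve (range c) :=
  ⟨c, h.contDiff, h.deriv_ne_zero, h.isEmbedding, rfl⟩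

theorem isClosedLoop : IsClosedLoop (orbitMap '' range c) := by
  refine ⟨c, h.contDiff, h.deriv_ne_zero, fun s t => ?_, ?_⟩
  · rw [orbitMap_eq_iff]
    simp only [← h.map_add_int, h.injective.eq_iff]
    exact ⟨fun ⟨k, hk⟩ => ⟨k, hk.symm⟩, fun ⟨k, hk⟩ => ⟨k, hk.symm⟩⟩
  · rw [← range_comp]
    rfl

theorem param_mem {x : Linf × ℝ} (hx : x ∈ range c) : √d ≤ x.2 ∧ x.2 ≤ 1 - √d := by
  obtain ⟨w, hw, k, rfl⟩ := h.exists_eq_shiftBy_arc hx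
  obtain ⟨-, -, h1, h2, -⟩ := (h.spec_of_mem hw).1
  exact ⟨h1, by rw [shiftBy_snd]; change arcParam d w ≤ _; simp only at h2; linarith⟩

theorem isSteadyState {x : Linf × ℝ} (hx : x ∈ range c) :
    IsSteadyState d x.2 x.1 ∧ Tendsto (fun n : ℤ => x.1 n) atBot (𝓝 0) ∧
      Tendsto (fun n : ℤ => x.1 n) atTop (𝓝 1) := by
  obtain ⟨w, hw, k, rfl⟩ := h.exists_eq_shiftBy_arc hx
  obtain ⟨h1, h2⟩ := h.spec_of_mem hw
  refine ⟨fun n => ?_, ?_, ?_⟩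
  · have := siteResidual_arcSeq h.isSmall h1 h2 (n + k)
    simp only [shiftBy_fst_apply, shiftBy_snd]
    rw [add_right_comm, sub_add_eq_add_sub]
    exact this.symm
  · exact (tendsto_arcSeq_atBot h.isSmall h1).comp
      (tendsto_atBot_add_const_right _ k tendsto_id)
  · exact (tendsto_arcSeq_atTop h.isSmall h1).comp
      (tendsto_atTop_add_const_right _ k tendsto_id)

theorem isNondegenerateFamily : IsNondegenerateFamily d (range c) := by
  have hs := h.isSmall.sqrt_pos
  have hs1 := h.isSmall.sqrt_le
  refine ⟨⟨√d / 2, 1 - √d / 2, by linarith, by linarith, by linarith, fun x hx => ?_⟩,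
    ⟨2, by norm_num, fun x hx => ?_⟩, fun x hx n => ?_⟩
  · have := h.param_mem hx
    exact ⟨by linarith, by linarith⟩
  · obtain ⟨w, hw, k, rfl⟩ := h.exists_eq_shiftBy_arc hx
    exact linf_norm_le (by norm_num) fun n =>
      (abs_coord_le (arc d w).1 (n + k)).trans (norm_arcSeq_le h.isSmall (h.spec_of_mem hw).1)
  · obtain ⟨w, hw, k, rfl⟩ := h.exists_eq_shiftBy_arc hx
    obtain ⟨h1, h2⟩ := h.spec_of_mem hw
    have := meetsNondegenerately_arcSeq h.isSmall h1 h2 (n + k)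
    rw [add_sub_right_comm] at this
    exact this

end IsChain

/-! ### The singular curve -/

/-- The retraction of the line onto the unit interval. -/
noncomputable def clamp (x : ℝ) : ℝ := max 0 (min 1 x)

theorem clamp_of_le {x : ℝ} (h : x ≤ 0) : clamp x = 0 :=
  max_eq_left ((min_le_right _ _).trans h)

theorem clamp_of_ge {x : ℝ} (h : 1 ≤ x) : clamp x = 1 := by
  rw [clamp, min_eq_left h, max_eq_right zero_le_one]

theorem clamp_of_mem {x : ℝ} (h0 : 0 ≤ x) (h1 : x ≤ 1) : clamp x = x := by
  rw [clamp, min_eq_right h1, max_eq_right h0]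

theorem clamp_nonneg (x : ℝ) : 0 ≤ clamp x := le_max_left _ _

theorem clamp_le_one (x : ℝ) : clamp x ≤ 1 := max_le zero_le_one (min_le_left _ _)

theorem clamp_one_sub (x : ℝ) : clamp (1 - x) = 1 - clamp x := by
  rcases le_total x 0 with h | h
  · rw [clamp_of_le h, clamp_of_ge (by linarith)]
    ring
  · rcases le_total 1 x with h1 | h1
    · rw [clamp_of_ge h1, clamp_of_le (by linarith)]
      ring
    · rw [clamp_of_mem h h1, clamp_of_mem (by linarith) (by linarith)]

theorem abs_clamp_sub_le (x y : ℝ) : |clamp x - clamp y| ≤ |x - y| := by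
  refine (abs_max_sub_max_le_max _ _ _ _).trans (max_le (by simp) ?_)
  exact (abs_min_sub_min_le_max _ _ _ _).trans (max_le (by simp) le_rfl)

/-- The distance to the nearest even integer. -/
noncomputable def fold (x : ℝ) : ℝ := 2 * |x / 2 - round (x / 2)|

theorem fold_eq_norm (x : ℝ) : fold x = 2 * ‖((x / 2 : ℝ) : UnitAddCircle)‖ := by
  rw [UnitAddCircle.norm_eq, fold]

/-- The fold is twice the circle norm of `x / 2`, so this is the reverse triangle inequality. -/
theorem abs_fold_sub_le (x y : ℝ) : |fold x - fold y| ≤ |x - y| := by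
  rw [fold_eq_norm, fold_eq_norm, ← mul_sub, abs_mul, abs_two]
  have h1 := abs_norm_sub_norm_le ((x / 2 : ℝ) : UnitAddCircle) ((y / 2 : ℝ) : UnitAddCircle)
  rw [← AddCircle.coe_sub] at h1
  have h2 : ‖((x / 2 - y / 2 : ℝ) : UnitAddCircle)‖ ≤ |x / 2 - y / 2| := by
    rw [UnitAddCircle.norm_eq]
    simpa using round_le (x / 2 - y / 2) 0
  have h3 : |x / 2 - y / 2| = |x - y| / 2 := by rw [← sub_div, abs_div, abs_two]
  linarith

theorem fold_add_int (x : ℝ) (k : ℤ) : fold (x + 2 * k) = fold x := by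
  have : (x + 2 * k) / 2 = x / 2 + k := by ring
  rw [fold, fold, this, round_add_intCast]
  push_cast
  rw [add_sub_add_right_eq_sub]

theorem fold_of_abs_le {x : ℝ} (h : |x| ≤ 1) : fold x = |x| := by
  have h1 : |x / 2| = |x| / 2 := by rw [abs_div, abs_two]
  have h2 := (AddCircle.norm_coe_eq_abs_iff (p := 1) (x := x / 2) one_ne_zero).2 (by
    rw [h1, abs_one]
    linarith)
  rw [fold_eq_norm, h2, h1]
  ring

/-- The curve `Gamma0`, parametrized by the line. -/
noncomputable def singularCurve (θ : ℝ) : Linf × ℝ :=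
  (mkLinf (fun n => clamp (2 * (θ + n) - 1 / 2)) 1 fun n =>
    abs_le.2 ⟨by linarith [clamp_nonneg (2 * (θ + n) - 1 / 2)], clamp_le_one _⟩,
    fold (2 * θ - 1 / 2))

theorem singularCurve_fst_apply (θ : ℝ) (n : ℤ) :
    (singularCurve θ).1 n = clamp (2 * (θ + n) - 1 / 2) := rfl

theorem singularCurve_snd (θ : ℝ) : (singularCurve θ).2 = fold (2 * θ - 1 / 2) := rfl

theorem singularCurve_add_int (θ : ℝ) (k : ℤ) :
    singularCurve (θ + k) = shiftBy k (singularCurve θ) := by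
  refine Prod.ext ?_ ?_
  · ext n
    rw [shiftBy_fst_apply, singularCurve_fst_apply, singularCurve_fst_apply]
    push_cast
    congr 1
    ring
  · rw [shiftBy_snd, singularCurve_snd, singularCurve_snd, ← fold_add_int (2 * θ - 1 / 2) k]
    congr 1
    ring

theorem dist_singularCurve_le (θ θ' : ℝ) :
    dist (singularCurve θ) (singularCurve θ') ≤ 2 * dist θ θ' := by
  rw [dist_eq_norm, Real.dist_eq]
  have h2 : |2 * (θ - θ')| = 2 * |θ - θ'| := by rw [abs_mul, abs_two]
  refine max_le (linf_norm_le (by positivity) fun n => ?_) ?_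
  · refine (abs_clamp_sub_le (2 * (θ + n) - 1 / 2) (2 * (θ' + n) - 1 / 2)).trans ?_
    rw [← h2]
    exact le_of_eq (congrArg abs (by ring))
  · refine (abs_fold_sub_le (2 * θ - 1 / 2) (2 * θ' - 1 / 2)).trans ?_
    rw [← h2]
    exact le_of_eq (congrArg abs (by ring))

theorem continuous_singularCurve : Continuous singularCurve :=
  (LipschitzWith.of_dist_le_mul (K := 2) fun θ θ' => by
    simpa using dist_singularCurve_le θ θ').continuous

theorem le_or_ge_of_clamp_eq {x y : ℝ} (hxy : x < y) (h : clamp x = clamp y) : y ≤ 0 ∨ 1 ≤ x := by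
  by_contra! hc
  rcases le_total x 0 with hx | hx
  · rw [clamp_of_le hx] at h
    rcases le_total 1 y with hy | hy
    · rw [clamp_of_ge hy] at h
      exact zero_ne_one h
    · rw [clamp_of_mem hc.1.le hy] at h
      linarith
  · rw [clamp_of_mem hx hc.2.le] at h
    rcases le_total 1 y with hy | hy
    · rw [clamp_of_ge hy] at h
      linarith
    · rw [clamp_of_mem hc.1.le hy] at h
      linarith

/-- Some index has a positive argument at `θ'`; equality of profiles then forces both arguments onto
the plateau at one. So both points lie on a stretch where the profile is constant, and there `fold`
is strictly monotone. -/
theorem singularCurve_injective : Function.Injective singularCurve := by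
  intro θ θ' h
  wlog hlt : θ < θ' generalizing θ θ' with H
  · rcases eq_or_lt_of_le (not_lt.1 hlt) with h1 | h1
    · exact h1.symm
    · exact (H h.symm h1).symm
  have hn : ∀ n : ℤ, 2 * (θ' + n) - 1 / 2 ≤ 0 ∨ 1 ≤ 2 * (θ + n) - 1 / 2 := fun n =>
    le_or_ge_of_clamp_eq (by linarith) (by
      rw [← singularCurve_fst_apply, ← singularCurve_fst_apply, h])
  obtain ⟨m, hm⟩ : ∃ m : ℤ, m = ⌊1 / 4 - θ'⌋ := ⟨_, rfl⟩
  have h1 : (m : ℝ) ≤ 1 / 4 - θ' := hm ▸ Int.floor_le _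
  have h2 : 1 / 4 - θ' < m + 1 := hm ▸ Int.lt_floor_add_one _
  have h3 : 1 ≤ 2 * (θ + (m + 1)) - 1 / 2 := by
    have := hn (m + 1)
    push_cast at this
    exact this.resolve_left (by linarith)
  have h4 : fold (2 * θ - 1 / 2) = fold (2 * θ' - 1 / 2) := congrArg Prod.snd h
  rw [← fold_add_int _ m, ← fold_add_int (2 * θ' - 1 / 2) m,
    fold_of_abs_le (by rw [abs_le]; constructor <;> linarith),
    fold_of_abs_le (by rw [abs_le]; constructor <;> linarith),
    abs_of_nonpos (by linarith), abs_of_nonpos (by linarith)] at h4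
  linarith

theorem abs_sub_le_of_dist_singularCurve_lt {θ θ' : ℝ}
    (h : dist (singularCurve θ) (singularCurve θ') < 1) : |θ - θ'| ≤ 2 := by
  wlog hlt : θ ≤ θ' generalizing θ θ' with H
  · rw [abs_sub_comm]
    exact H (by rwa [dist_comm]) (le_of_not_ge hlt)
  rw [abs_of_nonpos (by linarith)]
  by_contra! hc
  obtain ⟨m, hm⟩ : ∃ m : ℤ, m = ⌊1 / 4 - θ⌋ := ⟨_, rfl⟩
  have h1 : (m : ℝ) ≤ 1 / 4 - θ := hm ▸ Int.floor_le _
  have h2 : 1 / 4 - θ < m + 1 := hm ▸ Int.lt_floor_add_one _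
  have h3 := abs_sub_apply_le_dist (singularCurve θ) (singularCurve θ') m
  rw [singularCurve_fst_apply, singularCurve_fst_apply, clamp_of_le (by linarith),
    clamp_of_ge (by linarith)] at h3
  norm_num at h3
  linarith

theorem isEmbedding_singularCurve : IsEmbedding singularCurve :=
  isEmbedding_of_dist continuous_singularCurve singularCurve_injective one_pos fun _ _ =>
    abs_sub_le_of_dist_singularCurve_lt

/-- One period follows `Ubar` with `μ` falling from 1/2 to 0, then `Vbar` with `μ` rising to 1, then
the shifted `Ubar` with `μ` falling back to 1/2. The arc from `b` to `1 - b` passes near them in the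
same order. -/
theorem singularCurve_of_le {θ : ℝ} (h0 : 0 ≤ θ) (h1 : θ ≤ 1 / 4) :
    singularCurve θ = (Ubar, 1 / 2 - 2 * θ) := by
  refine Prod.ext ?_ ?_
  · ext n
    rw [singularCurve_fst_apply]
    change _ = if n ≤ 0 then (0 : ℝ) else 1
    split_ifs with hn
    · have : (n : ℝ) ≤ 0 := by exact_mod_cast hn
      exact clamp_of_le (by linarith)
    · have : (1 : ℝ) ≤ n := by exact_mod_cast (by omega : 1 ≤ n)
      exact clamp_of_ge (by linarith)
  · rw [singularCurve_snd, fold_of_abs_le (by rw [abs_le]; constructor <;> linarith),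
      abs_of_nonpos (by linarith)]
    ring

theorem singularCurve_of_mid {θ : ℝ} (h0 : 1 / 4 ≤ θ) (h1 : θ ≤ 3 / 4) :
    singularCurve θ = (Vbar (2 * θ - 1 / 2), 2 * θ - 1 / 2) := by
  refine Prod.ext ?_ ?_
  · ext n
    rw [singularCurve_fst_apply]
    change _ = if n < 0 then (0 : ℝ) else if n = 0 then 2 * θ - 1 / 2 else 1
    split_ifs with hn hn'
    · have : (n : ℝ) ≤ -1 := by exact_mod_cast (by omega : n ≤ -1)
      exact clamp_of_le (by linarith)
    · rw [hn', Int.cast_zero, add_zero]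
      exact clamp_of_mem (by linarith) (by linarith)
    · have : (1 : ℝ) ≤ n := by exact_mod_cast (by omega : 1 ≤ n)
      exact clamp_of_ge (by linarith)
  · rw [singularCurve_snd, fold_of_abs_le (by rw [abs_le]; constructor <;> linarith),
      abs_of_nonneg (by linarith)]

theorem singularCurve_of_ge {θ : ℝ} (h0 : 3 / 4 ≤ θ) (h1 : θ ≤ 1) :
    singularCurve θ = shiftBy 1 (Ubar, 5 / 2 - 2 * θ) := by
  refine Prod.ext ?_ ?_
  · ext n
    rw [singularCurve_fst_apply, shiftBy_fst_apply]
    change _ = if n + 1 ≤ 0 then (0 : ℝ) else 1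
    split_ifs with hn
    · have : (n : ℝ) ≤ -1 := by exact_mod_cast (by omega : n ≤ -1)
      exact clamp_of_le (by linarith)
    · have : (0 : ℝ) ≤ n := by exact_mod_cast (by omega : 0 ≤ n)
      exact clamp_of_ge (by linarith)
  · rw [singularCurve_snd, shiftBy_snd, ← fold_add_int _ (-1),
      fold_of_abs_le (by push_cast; rw [abs_le]; constructor <;> linarith),
      abs_of_nonpos (by push_cast; linarith)]
    push_cast
    ring

theorem mem_Gamma0_iff {x : Linf × ℝ} : x ∈ Gamma0 ↔
    ∃ (p : ℤ) (μ : ℝ), μ ∈ Icc (0 : ℝ) 1 ∧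
      (x = shiftBy p (Ubar, μ) ∨ x = shiftBy p (Vbar μ, μ)) := by
  simp only [Gamma0, mem_iUnion, mem_insert_iff, mem_singleton_iff, shiftBy_eq, exists_prop]

theorem range_singularCurve : range singularCurve = Gamma0 := by
  ext x
  rw [mem_Gamma0_iff]
  constructor
  · rintro ⟨θ, rfl⟩
    have h0 : 0 ≤ Int.fract θ := Int.fract_nonneg θ
    have h1 : Int.fract θ < 1 := Int.fract_lt_one θ
    rw [← Int.fract_add_floor θ, singularCurve_add_int]
    rcases le_total (Int.fract θ) (1 / 4) with h2 | h2
    · rw [singularCurve_of_le h0 h2]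
      exact ⟨_, _, ⟨by linarith, by linarith⟩, Or.inl rfl⟩
    · rcases le_total (Int.fract θ) (3 / 4) with h3 | h3
      · rw [singularCurve_of_mid h2 h3]
        exact ⟨_, _, ⟨by linarith, by linarith⟩, Or.inr rfl⟩
      · rw [singularCurve_of_ge h3 h1.le, ← shiftBy_add]
        exact ⟨_, _, ⟨by linarith, by linarith⟩, Or.inl rfl⟩
  · rintro ⟨p, μ, ⟨h0, h1⟩, rfl | rfl⟩
    · rcases le_total μ (1 / 2) with h2 | h2
      · refine ⟨(1 / 2 - μ) / 2 + p, ?_⟩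
        rw [singularCurve_add_int, singularCurve_of_le (by linarith) (by linarith)]
        congr 2
        ring
      · refine ⟨(5 / 2 - μ) / 2 + (p - 1 : ℤ), ?_⟩
        rw [singularCurve_add_int, singularCurve_of_ge (by linarith) (by linarith), ← shiftBy_add,
          sub_add_cancel]
        congr 2
        ring
    · refine ⟨(μ + 1 / 2) / 2 + p, ?_⟩
      rw [singularCurve_add_int, singularCurve_of_mid (by linarith) (by linarith)]
      have : 2 * ((μ + 1 / 2) / 2) - 1 / 2 = μ := by ring
      rw [this]

/-! ### Uniform convergence to the singular curve -/

/-- A homeomorphism of the unit interval extends to an order isomorphism of the line that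
commutes with integer translations. -/
theorem exists_periodic_orderIso {f : ℝ → ℝ} (hf : StrictMonoOn f (Icc 0 1))
    (hc : ContinuousOn f (Icc 0 1)) (h0 : f 0 = 0) (h1 : f 1 = 1) :
    ∃ e : ℝ ≃o ℝ, ∀ v ∈ Ico (0 : ℝ) 1, ∀ k : ℤ, e (v + k) = f v + k := by
  have hmem : ∀ x : ℝ, Int.fract x ∈ Icc (0 : ℝ) 1 := fun x =>
    ⟨Int.fract_nonneg x, (Int.fract_lt_one x).le⟩
  have hmono : StrictMono fun x => f (Int.fract x) + ⌊x⌋ := fun x y hxy => by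
    rcases (Int.floor_mono hxy.le).lt_or_eq with h | h
    · have e1 : f (Int.fract x) < 1 := h1 ▸ hf (hmem x) ⟨zero_le_one, le_rfl⟩ (Int.fract_lt_one x)
      have e2 : 0 ≤ f (Int.fract y) :=
        h0 ▸ hf.monotoneOn ⟨le_rfl, zero_le_one⟩ (hmem y) (Int.fract_nonneg y)
      have e3 : (⌊x⌋ : ℝ) + 1 ≤ ⌊y⌋ := by exact_mod_cast h
      dsimp only
      linarith
    · dsimp only
      rw [h]
      have : Int.fract x < Int.fract y := by
        rw [Int.fract, Int.fract, h]
        linarith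
      linarith [hf (hmem x) (hmem y) this]
  have hval : ∀ v ∈ Ico (0 : ℝ) 1, ∀ k : ℤ, f (Int.fract (v + k)) + ⌊v + k⌋ = f v + k :=
    fun v hv k => by
      rw [Int.fract_add_intCast, Int.floor_add_intCast, Int.fract_eq_self.2 hv,
        Int.floor_eq_zero_iff.2 hv, zero_add]
  have hsurj : Function.Surjective fun x => f (Int.fract x) + ⌊x⌋ := fun y => by
    obtain ⟨v, hv, he⟩ := intermediate_value_Icc zero_le_one hc
      (show Int.fract y ∈ _ by rw [h0, h1]; exact hmem y)
    have hv1 : v ≠ 1 := by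
      rintro rfl
      linarith [Int.fract_lt_one y]
    refine ⟨v + ⌊y⌋, ?_⟩
    dsimp only
    rw [hval v ⟨hv.1, lt_of_le_of_ne hv.2 hv1⟩, he, Int.fract_add_floor]
  exact ⟨hmono.orderIsoOfSurjective _ hsurj, hval⟩

/-- The signed coordinate along the arc, whose absolute value approximates `μ` and whose positive
part approximates the central value, in the left half of the arc. -/
noncomputable def position (d w : ℝ) : ℝ := w - d / w + d / (1 - w)

theorem position_symm (d w : ℝ) : position d (1 - w) = 1 - position d w := by
  simp only [position, sub_sub_cancel]
  ring

theorem strictMonoOn_position {d : ℝ} (hd : 0 < d) : StrictMonoOn (position d) (Ioo 0 1) := by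
  intro x hx y hy hxy
  have h1 : d / y ≤ d / x := div_le_div_of_nonneg_left hd.le hx.1 hxy.le
  have h2 : d / (1 - x) ≤ d / (1 - y) :=
    div_le_div_of_nonneg_left hd.le (by linarith [hy.2]) (by linarith)
  simp only [position]
  linarith

theorem continuousOn_position {d : ℝ} : ContinuousOn (position d) (Ioo 0 1) := by
  intro x hx
  have h1 : x ≠ 0 := hx.1.ne'
  have h2 : 1 - x ≠ 0 := by linarith [hx.2]
  unfold position
  exact ContinuousAt.continuousWithinAt (by fun_prop (disch := assumption))

/-- The product of `w` and `d / w` is `d`, so the smaller of them is at most `√d`. Up to `O(d)`, the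
sum `w + d / w` exceeds the absolute value of the difference by twice the smaller one. -/
theorem position_estimates {d w : ℝ} (hd : IsSmall d) (h1 : 8 / 5 * d ≤ w) (h2 : w ≤ 1 / 2) :
    |position d w| ≤ 7 / 10 ∧ |w - clamp (position d w)| ≤ 2 * √d ∧
      |leadingParam d w - abs (position d w)| ≤ 3 * √d := by
  have hd0 := hd.1
  have hs := hd.sqrt_pos
  have hs1 := hd.sqrt_le
  have hsq := hd.sq_sqrt
  have hle := hd.le
  have hds : d ≤ 1 / 10 ^ 5 * √d := by nlinarith
  have hw : 0 < w := by linarith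
  have e1 : d / (1 - w) ≤ 2 * d := by
    rw [div_le_iff₀ (by linarith)]
    nlinarith
  have e0 : 0 ≤ d / (1 - w) := div_nonneg hd0.le (by linarith)
  have p0 : 0 < d / w := by positivity
  have p1 : d / w ≤ 5 / 8 := by
    rw [div_le_iff₀ hw]
    linarith
  have hwp : w ≤ √d ∨ d / w ≤ √d := by
    by_contra! hc
    have : w * (d / w) = d := by field_simp
    nlinarith
  have hpos : |position d w| ≤ 7 / 10 := by
    rw [position, abs_le]
    constructor <;> linarith
  refine ⟨hpos, ?_⟩
  rcases le_total (position d w) 0 with h | h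
  · rw [clamp_of_le h, abs_of_nonpos h, sub_zero, abs_of_pos hw, leadingParam]
    rw [position] at h ⊢
    have : w ≤ √d := hwp.elim id fun h' => by linarith
    refine ⟨by linarith, ?_⟩
    rw [abs_le]
    constructor <;> linarith
  · rw [clamp_of_mem h (by linarith [le_of_abs_le hpos]), abs_of_nonneg h, leadingParam]
    rw [position] at h ⊢
    have : d / w ≤ √d + 2 * d := hwp.elim (fun h' => by linarith) fun h' => by linarith
    constructor <;> rw [abs_le] <;> constructor <;> linarith

theorem position_approx {d w : ℝ} (hd : IsSmall d) (h1 : 8 / 5 * d ≤ w) (h2 : w ≤ 1 - 8 / 5 * d) :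
    |position d w - 1 / 2| ≤ 6 / 5 ∧ |w - clamp (position d w)| ≤ 2 * √d ∧
      |leadingParam d w - fold (position d w)| ≤ 3 * √d := by
  rcases le_total w (1 / 2) with hw | hw
  · obtain ⟨e1, e2, e3⟩ := position_estimates hd h1 hw
    refine ⟨?_, e2, ?_⟩
    · rw [abs_le] at e1 ⊢
      constructor <;> linarith [e1.1, e1.2]
    · rw [fold_of_abs_le (e1.trans (by norm_num))]
      exact e3
  · obtain ⟨e1, e2, e3⟩ := position_estimates (w := 1 - w) hd (by linarith) (by linarith)
    rw [position_symm, clamp_one_sub] at e2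
    rw [position_symm, leadingParam_symm] at e3
    rw [position_symm] at e1
    obtain ⟨k1, k2⟩ := abs_le.1 e1
    refine ⟨?_, ?_, ?_⟩
    · rw [abs_le]
      constructor <;> linarith
    · rw [abs_sub_comm] at e2
      convert e2 using 2
      ring
    · have hfold : fold (position d w) = 1 - |1 - position d w| := by
        rcases le_total (position d w) 1 with h | h
        · rw [fold_of_abs_le (by rw [abs_le]; constructor <;> linarith),
            abs_of_nonneg (by linarith), abs_of_nonneg (by linarith)]
          ring
        · rw [← fold_add_int _ (-1), fold_of_abs_le (by push_cast; rw [abs_le]; constructor <;> linarith),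
            abs_of_nonpos (by push_cast; linarith), abs_of_nonpos (by linarith)]
          push_cast
          ring
      rw [hfold, abs_sub_comm]
      convert e3 using 2
      ring

/-- The position along the arc, normalized to the unit interval. -/
noncomputable def arcPosition (d b w : ℝ) : ℝ :=
  1 / 2 + (position d w - 1 / 2) / (1 - 2 * position d b)

section ArcPosition

variable {d b : ℝ} (hd : IsSmall d) (hb : IsBondCentered d b)
include hd hb

theorem abs_position_add_half_le : |position d b + 1 / 2| ≤ 15 * d := by
  have h := abs_arcParam_sub_le hd (hb.gt hd) (hb.lt hd)
  have e : position d b = 2 * b - leadingParam d b := by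
    rw [position, leadingParam]
    ring
  have hd0 := hd.1
  have := hb.le
  have := hb.ge
  rw [hb.param] at h
  rw [e]
  rw [abs_le] at h ⊢
  constructor <;> linarith [h.1, h.2]

theorem one_sub_two_mul_position_gt : 1 < 1 - 2 * position d b := by
  have := (abs_le.1 (abs_position_add_half_le hd hb)).2
  linarith [hd.le]

theorem strictMonoOn_arcPosition : StrictMonoOn (arcPosition d b) (Icc b (1 - b)) := by
  intro x hx y hy hxy
  have hb0 : 0 < b := by linarith [hb.ge, hd.1]
  have h := strictMonoOn_position hd.1 (Icc_subset_Ioo hb0 (by linarith) hx)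
    (Icc_subset_Ioo hb0 (by linarith) hy) hxy
  have := one_sub_two_mul_position_gt hd hb
  unfold arcPosition
  gcongr

theorem continuousOn_arcPosition : ContinuousOn (arcPosition d b) (Icc b (1 - b)) := by
  have hb0 : 0 < b := by linarith [hb.ge, hd.1]
  exact ((((continuousOn_position).mono (Icc_subset_Ioo hb0 (by linarith))).sub
    continuousOn_const).div_const _).const_add _

theorem arcPosition_left : arcPosition d b b = 0 := by
  have := one_sub_two_mul_position_gt hd hb
  rw [arcPosition]
  field_simp
  ring

theorem arcPosition_right : arcPosition d b (1 - b) = 1 := by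
  have := one_sub_two_mul_position_gt hd hb
  rw [arcPosition, position_symm]
  field_simp
  ring

/-- The position at `b` is within `15 d` of `-1 / 2`, so the normalization is almost the map `x ↦ (x
+ 1 / 2) / 2`. The error is at most `6 / 5 * (2 * 15 * d) = 36 * d`. -/
theorem abs_arcPosition_sub_le {w : ℝ} (hw : w ∈ Icc b (1 - b)) :
    |2 * arcPosition d b w - 1 / 2 - position d w| ≤ 40 * d := by
  have h1 := (position_approx hd (hb.ge.trans hw.1) (by linarith [hw.2, hb.ge])).1
  have h2 := abs_position_add_half_le hd hb
  have h3 := one_sub_two_mul_position_gt hd hb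
  have e : 2 * arcPosition d b w - 1 / 2 - position d w =
      (position d w - 1 / 2) * (2 * (position d b + 1 / 2)) / (1 - 2 * position d b) := by
    rw [arcPosition]
    field_simp
    ring
  rw [e, abs_div, abs_of_pos (show 0 < 1 - 2 * position d b by linarith),
    div_le_iff₀ (by linarith), abs_mul, abs_mul, abs_two]
  have := hd.1
  nlinarith [abs_nonneg (position d b + 1 / 2), abs_nonneg (position d w - 1 / 2)]

theorem dist_arc_singularCurve_le {w : ℝ} (hw : w ∈ Icc b (1 - b)) :
    dist (singularCurve (arcPosition d b w)) (arc d w) ≤ 10 * √d := by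
  have hd0 := hd.1
  have hs := hd.sqrt_pos
  have hs1 := hd.sqrt_le
  have hsq := hd.sq_sqrt
  have hle := hd.le
  have hds : d ≤ 1 / 10 ^ 5 * √d := by nlinarith
  have g1 : 3 / 2 * d < w := (hb.gt hd).trans_le hw.1
  have g2 : w < 1 - 3 / 2 * d := by linarith [hw.2, hb.gt hd]
  obtain ⟨hg, -⟩ := arcParam_spec hd g1 g2
  obtain ⟨-, e2, e3⟩ := position_approx hd (hb.ge.trans hw.1) (by linarith [hw.2, hb.ge])
  have e4 := abs_arcPosition_sub_le hd hb hw
  have hlr : b ≤ 1 - b := hw.1.trans hw.2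
  have hm := (strictMonoOn_arcPosition hd hb).monotoneOn
  have p0 : 0 ≤ arcPosition d b w := arcPosition_left hd hb ▸ hm (left_mem_Icc.2 hlr) hw hw.1
  have p1 : arcPosition d b w ≤ 1 := arcPosition_right hd hb ▸ hm hw (right_mem_Icc.2 hlr) hw.2
  rw [dist_eq_norm]
  refine max_le (linf_norm_le (by positivity) fun n => ?_) ?_
  · change |(singularCurve (arcPosition d b w)).1 n - (arc d w).1 n| ≤ _
    rw [singularCurve_fst_apply]
    rcases lt_trichotomy n 0 with hn | rfl | hn
    · have hn' : (n : ℝ) ≤ -1 := by exact_mod_cast (by omega : n ≤ -1)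
      have := abs_arcSeq_le hd hg hn
      change |(arc d w).1 n| ≤ _ at this
      rw [clamp_of_le (by linarith), zero_sub, abs_neg]
      linarith
    · rw [arc_zero hd g1 g2, Int.cast_zero, add_zero]
      have k1 := abs_clamp_sub_le (2 * arcPosition d b w - 1 / 2) (position d w)
      have k2 := abs_sub_le (clamp (2 * arcPosition d b w - 1 / 2)) (clamp (position d w)) w
      rw [abs_sub_comm] at e2
      linarith
    · have hn' : (1 : ℝ) ≤ n := by exact_mod_cast (by omega : 1 ≤ n)
      have := abs_one_sub_arcSeq_le hd hg hn
      change |1 - (arc d w).1 n| ≤ _ at this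
      rw [clamp_of_ge (by linarith)]
      linarith
  · change |fold (2 * arcPosition d b w - 1 / 2) - arcParam d w| ≤ _
    have k1 := (abs_fold_sub_le (2 * arcPosition d b w - 1 / 2) (position d w)).trans e4
    have k2 := abs_arcParam_sub_le hd g1 g2
    rw [abs_le] at k1 k2 e3 ⊢
    constructor <;> linarith [k1.1, k1.2, k2.1, k2.2, e3.1, e3.2]

end ArcPosition

/-- A shift-equivariant chain has a parametrization close to that of the singular curve. -/
theorem IsChain.exists_homeomorph {d b : ℝ} {c : ℝ → Linf × ℝ} (h : IsChain d b c) :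
    ∃ H : ℝ ≃ₜ ℝ, ∀ x, dist (singularCurve x) (c (H x)) ≤ 10 * √d := by
  have hd := h.isSmall
  have hb := h.isBondCentered
  have hlt := h.left_lt_right
  have hpos : 0 < 1 - b - b := by linarith
  have hmaps : MapsTo (fun v => b + (1 - b - b) * v) (Icc 0 1) (Icc b (1 - b)) := fun v hv =>
    ⟨by nlinarith [hv.1], by nlinarith [hv.2]⟩
  have haff : StrictMonoOn (fun v => b + (1 - b - b) * v) (Icc 0 1) := fun x _ y _ hxy => by
    dsimp only
    gcongr
  have hcont : ContinuousOn (fun v => b + (1 - b - b) * v) (Icc 0 1) := by fun_prop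
  obtain ⟨e₁, he₁⟩ := exists_periodic_orderIso (h.strictMonoOn_phase.comp haff hmaps)
    (h.continuousOn_phase.comp hcont hmaps) (by simp [h.phase_left]) (by simp [h.phase_right])
  obtain ⟨e₂, he₂⟩ := exists_periodic_orderIso ((strictMonoOn_arcPosition hd hb).comp haff hmaps)
    ((continuousOn_arcPosition hd hb).comp hcont hmaps) (by simp [arcPosition_left hd hb])
    (by simp [arcPosition_right hd hb])
  -- Both isomorphisms start from the same affine parameter of `[b, 1 - b]`: `e₁` leads to the time
  -- of `c` and `e₂` to the time of the singular curve. The composite matches times through the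
  -- common arc point.
  refine ⟨(e₂.symm.trans e₁).toHomeomorph, fun x => ?_⟩
  obtain ⟨y, rfl⟩ := e₂.surjective x
  have hy : Int.fract y ∈ Ico (0 : ℝ) 1 := ⟨Int.fract_nonneg y, Int.fract_lt_one y⟩
  have hw := hmaps (Ico_subset_Icc_self hy)
  have hH : (e₂.symm.trans e₁).toHomeomorph (e₂ y) = e₁ y := by simp
  rw [hH, ← Int.fract_add_floor y, he₁ _ hy, he₂ _ hy]
  simp only [Function.comp_apply]
  rw [h.apply_phase_add hw, singularCurve_add_int, dist_shiftBy]
  exact dist_arc_singularCurve_le hd hb hw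

/-! ### Choice of the coupling threshold and conclusion -/

theorem eventually_isSmall : ∃ D > 0, ∀ d ∈ Ioo 0 D, IsSmall d := by
  have hC : 0 < 10 ^ 5 * tailBound := by linarith [one_le_tailBound]
  refine ⟨(1 / (10 ^ 5 * tailBound)) ^ 2, by positivity, fun d hd => ⟨hd.1, ?_⟩⟩
  rw [← le_div_iff₀ hC]
  exact Real.sqrt_le_iff.2 ⟨by positivity, hd.2.le⟩

end Nagumo

theorem proposition1 :
    ∃ (dStar : ℝ) (Γ : ℝ → Set (Nagumo.Linf × ℝ)), 0 < dStar ∧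
      (∀ d ∈ Ioo 0 dStar,
        Nagumo.IsSmoothCurve (Γ d) ∧
        (∀ w ∈ Γ d, w.2 ∈ Ioo (0 : ℝ) 1) ∧
        (∀ w ∈ Γ d, Nagumo.IsSteadyState d w.2 w.1 ∧
          Tendsto (fun n : ℤ => w.1 n) atBot (𝓝 0) ∧
          Tendsto (fun n : ℤ => w.1 n) atTop (𝓝 1)) ∧
        Nagumo.IsClosedLoop (Nagumo.orbitMap '' Γ d) ∧
        Nagumo.IsNondegenerateFamily d (Γ d)) ∧
      Nagumo.CurvesTendstoUniformly Γ Nagumo.Gamma0 (𝓝[>] 0) := by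
  open Nagumo in
  obtain ⟨D, hD, hsmall⟩ := eventually_isSmall
  have hex : ∀ d, ∃ (b : ℝ) (c : ℝ → Linf × ℝ) (H : ℝ ≃ₜ ℝ), d ∈ Ioo 0 D →
      IsChain d b c ∧ ∀ x, dist (singularCurve x) (c (H x)) ≤ 10 * √d := fun d => by
    by_cases hd : d ∈ Ioo 0 D
    · obtain ⟨b, c, h⟩ := exists_isChain (hsmall d hd)
      obtain ⟨H, hH⟩ := h.exists_homeomorph
      exact ⟨b, c, H, fun _ => ⟨h, hH⟩⟩
    · exact ⟨0, 0, Homeomorph.refl ℝ, fun h => absurd h hd⟩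
  choose b c H hcH using hex
  refine ⟨D, fun d => range (c d), hD, fun d hd => ?_, fun d => c d ∘ H d, singularCurve, ?_,
    ⟨isEmbedding_singularCurve, range_singularCurve⟩, ?_⟩
  · have h := (hcH d hd).1
    have hs := h.isSmall.sqrt_pos
    refine ⟨h.isSmoothCurve, fun w hw => ?_, fun w hw => h.isSteadyState hw, h.isClosedLoop,
      h.isNondegenerateFamily⟩
    have := h.param_mem hw
    exact ⟨by linarith, by linarith⟩
  · filter_upwards [Ioo_mem_nhdsGT hD] with d hd
    exact ⟨(hcH d hd).1.isEmbedding.comp (H d).isEmbedding, (H d).surjective.range_comp (c d)⟩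
  · rw [Metric.tendstoUniformly_iff]
    intro ε hε
    have hlim : Tendsto (fun d : ℝ => 10 * √d) (𝓝[>] 0) (𝓝 0) := by
      have : Tendsto (fun d : ℝ => 10 * √d) (𝓝 0) (𝓝 (10 * √0)) :=
        (continuous_const.mul Real.continuous_sqrt).tendsto 0
      rw [Real.sqrt_zero, mul_zero] at this
      exact this.mono_left nhdsWithin_le_nhds
    filter_upwards [Ioo_mem_nhdsGT hD, hlim.eventually_lt_const hε] with d hd hlt x
    exact ((hcH d hd).2 x).trans_lt hlt
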